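/- **Setting.** For continuous $F:\mathbb R\to M_n(\mathbb R)$ let $\Phi_F(t,\tau)$ be the transition matrix: $\partial_t\Phi_F(t,\tau)=F(t)\Phi_F(t,\tau)$, $\Phi_F(\tau,\tau)=I$. $F$ is *exponentially stable* (resp. *anti-stable*) if there are $\alpha,\beta>0$ with $\|\Phi_F(t,t_0)\|\le\alpha e^{-\beta(t-t_0)}$ for all $t\ge t_0$ (resp. $\|\Phi_F(t,t_0)\|\le\alpha e^{\beta(t-t_0)}$ for all $t\le t_0$). *Dynamics.* Let $\dot x=A(t)x+B(t)u$, with $x\in\mathbb R^n$, $u\in\mathbb R^m$, $t\in\mathbb R$, where $A,B$ are $C^\infty$ and bounded, every $B(t)$ is injective, $\mathrm{span}\{B_i(t)v: v\in\mathbb R^m,\ i\ge 0\}=\mathbb R^n$ for every $t$, where $B_0=B$, $B_{i+1}=\dot B_i-AB_i$, and $(A,B)$ is uniformly controllable: there are $s,\beta>0$ such that $\int_t^{t+s}\Phi_A(t,\tau)B(\tau)B(\tau)^\top\Phi_A(t,\tau)^\top d\tau-\beta I$ is positive definite for every $t$. *Costs.* $\mathcal C_{LQ}$ is the set of costs $c=x^\top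 Q(t)x+2x^\top S(t)u+u^\top R(t)u$ with $Q,S,R$ $C^\infty$ and bounded, $Q,R$ symmetric, $R(t)-\alpha I$ positive definite for all $t$ for some constant $\alpha>0$ ($R$ is *uniformly positive definite*), and $Q-SR^{-1}S^\top$ positive semidefinite for every $t$. The *optimal synthesis* of $c$ is the set of all trajectories $x$ on intervals $[t_0,t_1]$, $t_0<t_1$, that minimize $\int_{t_0}^{t_1}c(t,x,u)\,dt$ among trajectories (with square integrable controls) with the same end points. The pair *describing* the optimal synthesis of $c\in\mathcal C_{LQ}$ is $(A_+,A_-)$, $A_\pm=A-BR^{-1}(S^\top+B^\top P_\pm)$, where $P_+$ (resp. $P_-$) is the symmetric solution on $\mathbb R$ of $\dot P=-PA-A^\top P+(PB+S)R^{-1}(B^\top P+S^\top)-Q$ for which $A_+$ is exponentially stable (resp. $A_-$ is exponentially anti-stable). *Canonical costs.* A canonical cost is $c=(u+K(t)x)^\top R(t)(u+K(t)x)$ with $R:\mathbb R\to\mathrm{Sym}(m)$ $C^\infty$, bounded and uniformly positive definite, $\det R(0)=1$, and $K:\mathbb R\to M_{m,n}(\mathbb R)$ $C^\infty$ and bounded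 such that $A-BK$ is exponentially stable; it is the cost of the above form with $Q=K^\top RK$ and $S=K^\top R$. **Proposition.** Let $\Gamma$ be the optimal synthesis of some cost in $\mathcal C_{LQ}$, described by the pair $(A_+,A_-)$. For mappings $K:\mathbb R\to M_{m,n}(\mathbb R)$ and $R:\mathbb R\to M_m(\mathbb R)$ the following are equivalent: (a) $c=(u+Kx)^\top R(u+Kx)$ is a canonical cost and its optimal synthesis is $\Gamma$; (b) $c=(u+Kx)^\top R(u+Kx)$ is a canonical cost and the pair describing its optimal synthesis is $(A_+,A_-)$; (c) $K=(B^\top B)^{-1}B^\top(A-A_+)$, and $R(t)=(\det Z(0))^{1/m}Z(t)^{-1}$ for all $t$, for some $C^\infty$ mapping $Z:\mathbb R\to\mathrm{Sym}(m)$ with positive definite values satisfying, for every $t\in\mathbb R$, $$\bigl(A_-(t)-A_+(t)\bigr)\int_0^t\Phi_{A_+}(t,s)B(s)Z(s)B(s)^\top\Phi_{A_+}(t,s)^\top ds-B(t)Z(t)B(t)^\top\Bigl(I-\Phi_{A_-}(t,0)^{-\top}\,\Phi_{A_+}(t,0)^\top\Bigr)=0 .$$ -/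

import Mathlib

open scoped ContDiff Matrix Matrix.Norms.L2Operator

noncomputable section

namespace InverseLQ

variable {n m : ℕ}

/-- `Φ` is the family of solutions of `∂Φ(t,τ)/∂t = A(t) Φ(t,τ)`, `Φ(τ,τ) = I`, on the whole line. -/
def IsTransitionMatrix (A : ℝ → Matrix (Fin n) (Fin n) ℝ)
    (Φ : ℝ → ℝ → Matrix (Fin n) (Fin n) ℝ) : Prop :=
  ∀ τ, Φ τ τ = 1 ∧ ∀ t, HasDerivAt (fun r => Φ r τ) (A t * Φ t τ) t

/-- The transition matrix `Φ_A(t,τ)`; for continuous `A` it exists and is unique. -/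
def transitionMatrix (A : ℝ → Matrix (Fin n) (Fin n) ℝ) : ℝ → ℝ → Matrix (Fin n) (Fin n) ℝ :=
  Classical.epsilon (IsTransitionMatrix A)

def IsExpStable (A : ℝ → Matrix (Fin n) (Fin n) ℝ) : Prop :=
  ∃ α > (0 : ℝ), ∃ β > (0 : ℝ), ∀ t₀ t : ℝ, t₀ ≤ t →
    ‖transitionMatrix A t t₀‖ ≤ α * Real.exp (-β * (t - t₀))

def IsExpAntiStable (A : ℝ → Matrix (Fin n) (Fin n) ℝ) : Prop :=
  ∃ α > (0 : ℝ), ∃ β > (0 : ℝ), ∀ t₀ t : ℝ, t ≤ t₀ →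
    ‖transitionMatrix A t t₀‖ ≤ α * Real.exp (β * (t - t₀))

/-- The norm is the operator norm for the Euclidean norms. -/
def IsBoundedMap {p q : ℕ} (M : ℝ → Matrix (Fin p) (Fin q) ℝ) : Prop :=
  ∃ C : ℝ, ∀ t, ‖M t‖ ≤ C

def IsUniformlyPosDef {p : ℕ} (R : ℝ → Matrix (Fin p) (Fin p) ℝ) : Prop :=
  ∃ α > (0 : ℝ), ∀ t, (R t - α • (1 : Matrix (Fin p) (Fin p) ℝ)).PosDef

/-- `B₀ = B`, `B_{i+1} = dB_i/dt - A B_i`. -/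
def kalmanSeq (A : ℝ → Matrix (Fin n) (Fin n) ℝ) (B : ℝ → Matrix (Fin n) (Fin m) ℝ) :
    ℕ → ℝ → Matrix (Fin n) (Fin m) ℝ
  | 0 => B
  | i + 1 => fun t => deriv (kalmanSeq A B i) t - A t * kalmanSeq A B i t

/-- Standing assumptions on the dynamics `x' = A x + B u`. -/
structure DynamicsAssumption (A : ℝ → Matrix (Fin n) (Fin n) ℝ)
    (B : ℝ → Matrix (Fin n) (Fin m) ℝ) : Prop where
  smooth_A : ContDiff ℝ ∞ A
  smooth_B : ContDiff ℝ ∞ B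
  bounded_A : IsBoundedMap A
  bounded_B : IsBoundedMap B
  injective_B : ∀ t, Function.Injective fun v : Fin m → ℝ => B t *ᵥ v
  kalman : ∀ t, Submodule.span ℝ
    {w : Fin n → ℝ | ∃ (i : ℕ) (v : Fin m → ℝ), w = kalmanSeq A B i t *ᵥ v} = ⊤
  uniformly_controllable : ∃ s > (0 : ℝ), ∃ β > (0 : ℝ), ∀ t : ℝ,
    ((∫ τ in t..(t + s), transitionMatrix A t τ * B τ * (B τ)ᵀ * (transitionMatrix A t τ)ᵀ)
      - β • (1 : Matrix (Fin n) (Fin n) ℝ)).PosDef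

/-- Standing assumptions on the cost `xᵀ Q x + 2 xᵀ S u + uᵀ R u`. -/
structure CostAssumption (Q : ℝ → Matrix (Fin n) (Fin n) ℝ) (S : ℝ → Matrix (Fin n) (Fin m) ℝ)
    (R : ℝ → Matrix (Fin m) (Fin m) ℝ) : Prop where
  symm_Q : ∀ t, (Q t).IsSymm
  symm_R : ∀ t, (R t).IsSymm
  smooth_Q : ContDiff ℝ ∞ Q
  smooth_S : ContDiff ℝ ∞ S
  smooth_R : ContDiff ℝ ∞ R
  bounded_Q : IsBoundedMap Q
  bounded_S : IsBoundedMap S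
  bounded_R : IsBoundedMap R
  uniformlyPosDef_R : IsUniformlyPosDef R
  nonneg : ∀ t, (Q t - S t * (R t)⁻¹ * (S t)ᵀ).PosSemidef

/-- `c(t,x,u) = xᵀ Q(t) x + 2 xᵀ S(t) u + uᵀ R(t) u`. -/
def quadCost (Q : ℝ → Matrix (Fin n) (Fin n) ℝ) (S : ℝ → Matrix (Fin n) (Fin m) ℝ)
    (R : ℝ → Matrix (Fin m) (Fin m) ℝ) : ℝ → (Fin n → ℝ) → (Fin m → ℝ) → ℝ :=
  fun t x u => x ⬝ᵥ (Q t *ᵥ x) + 2 * (x ⬝ᵥ (S t *ᵥ u)) + u ⬝ᵥ (R t *ᵥ u)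

/-- `c(t,x,u) = (u + K(t) x)ᵀ R(t) (u + K(t) x)`. -/
def feedbackCost (K : ℝ → Matrix (Fin m) (Fin n) ℝ) (R : ℝ → Matrix (Fin m) (Fin m) ℝ) :
    ℝ → (Fin n → ℝ) → (Fin m → ℝ) → ℝ :=
  fun t x u => (u + K t *ᵥ x) ⬝ᵥ (R t *ᵥ (u + K t *ᵥ x))

/-- `feedbackCost K R` written in the usual form: `Q = Kᵀ R K` and `S = Kᵀ R`. -/
theorem feedbackCost_eq_quadCost (K : ℝ → Matrix (Fin m) (Fin n) ℝ)
    (R : ℝ → Matrix (Fin m) (Fin m) ℝ) (hR : ∀ t, (R t).IsSymm) :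
    feedbackCost K R =
      quadCost (fun t => (K t)ᵀ * R t * K t) (fun t => (K t)ᵀ * R t) R := by
  funext t x u
  have h1 : x ⬝ᵥ (((K t)ᵀ * R t * K t) *ᵥ x) = (K t *ᵥ x) ⬝ᵥ (R t *ᵥ (K t *ᵥ x)) := by
    rw [Matrix.mul_assoc, ← Matrix.mulVec_mulVec, Matrix.dotProduct_mulVec,
      Matrix.vecMul_transpose, Matrix.mulVec_mulVec]
  have h2 : x ⬝ᵥ (((K t)ᵀ * R t) *ᵥ u) = (K t *ᵥ x) ⬝ᵥ (R t *ᵥ u) := by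
    rw [← Matrix.mulVec_mulVec, Matrix.dotProduct_mulVec, Matrix.vecMul_transpose]
  have h3 : u ⬝ᵥ (R t *ᵥ (K t *ᵥ x)) = (K t *ᵥ x) ⬝ᵥ (R t *ᵥ u) := by
    rw [Matrix.dotProduct_mulVec, ← Matrix.mulVec_transpose, (hR t).eq, dotProduct_comm]
  simp only [feedbackCost, quadCost, h1, h2, Matrix.mulVec_add, add_dotProduct,
    dotProduct_add, h3]
  ring

/-- `x` is the (absolutely continuous) trajectory on `[t₀,t₁]` of `x' = A x + B u` associated with
the square integrable control law `u`. -/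
structure IsTrajectory (A : ℝ → Matrix (Fin n) (Fin n) ℝ) (B : ℝ → Matrix (Fin n) (Fin m) ℝ)
    (t₀ t₁ : ℝ) (x : ℝ → Fin n → ℝ) (u : ℝ → Fin m → ℝ) : Prop where
  control : MeasureTheory.MemLp u 2 (MeasureTheory.volume.restrict (Set.Icc t₀ t₁))
  continuous : ContinuousOn x (Set.Icc t₀ t₁)
  ode : ∀ t ∈ Set.Icc t₀ t₁, x t = x t₀ + ∫ s in t₀..t, (A s *ᵥ x s + B s *ᵥ u s)

/-- The integral cost over `[t₀,t₁]`. -/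
def integralCost (c : ℝ → (Fin n → ℝ) → (Fin m → ℝ) → ℝ) (t₀ t₁ : ℝ) (x : ℝ → Fin n → ℝ)
    (u : ℝ → Fin m → ℝ) : ℝ :=
  ∫ t in t₀..t₁, c t (x t) (u t)

/-- The optimal synthesis of the dynamics `(A,B)` and the cost `c`: all `(t₀,t₁,x)` with `t₀ < t₁`
such that `x` is, on `[t₀,t₁]`, a minimizing trajectory among those with the same end points.
Only the restriction of `x` to `[t₀,t₁]` matters. -/
def optimalSynthesis (A : ℝ → Matrix (Fin n) (Fin n) ℝ) (B : ℝ → Matrix (Fin n) (Fin m) ℝ)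
    (c : ℝ → (Fin n → ℝ) → (Fin m → ℝ) → ℝ) : Set (ℝ × ℝ × (ℝ → Fin n → ℝ)) :=
  {γ | γ.1 < γ.2.1 ∧ ∃ u, IsTrajectory A B γ.1 γ.2.1 γ.2.2 u ∧
    ∀ y v, IsTrajectory A B γ.1 γ.2.1 y v → y γ.1 = γ.2.2 γ.1 → y γ.2.1 = γ.2.2 γ.2.1 →
      integralCost c γ.1 γ.2.1 γ.2.2 u ≤ integralCost c γ.1 γ.2.1 y v}

/-- `P` is a symmetric solution on the whole line of the Riccati differential equation
`P' = - P A - Aᵀ P + (P B + S) R⁻¹ (Bᵀ P + Sᵀ) - Q`. -/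
def IsRiccatiSolution (A : ℝ → Matrix (Fin n) (Fin n) ℝ) (B : ℝ → Matrix (Fin n) (Fin m) ℝ)
    (Q : ℝ → Matrix (Fin n) (Fin n) ℝ) (S : ℝ → Matrix (Fin n) (Fin m) ℝ)
    (R : ℝ → Matrix (Fin m) (Fin m) ℝ) (P : ℝ → Matrix (Fin n) (Fin n) ℝ) : Prop :=
  ∀ t, (P t).IsSymm ∧
    HasDerivAt P (-(P t * A t) - (A t)ᵀ * P t
      + (P t * B t + S t) * (R t)⁻¹ * ((B t)ᵀ * P t + (S t)ᵀ) - Q t) t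

/-- The closed loop `A - B R⁻¹ (Sᵀ + Bᵀ P)`. -/
def closedLoop (A : ℝ → Matrix (Fin n) (Fin n) ℝ) (B : ℝ → Matrix (Fin n) (Fin m) ℝ)
    (S : ℝ → Matrix (Fin n) (Fin m) ℝ) (R : ℝ → Matrix (Fin m) (Fin m) ℝ)
    (P : ℝ → Matrix (Fin n) (Fin n) ℝ) : ℝ → Matrix (Fin n) (Fin n) ℝ :=
  fun t => A t - B t * (R t)⁻¹ * ((S t)ᵀ + (B t)ᵀ * P t)

/-- `(Ap, Am) = (A₊, A₋)` is the pair describing the optimal synthesis associated with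
`(A, B, Q, S, R)`: the closed loops of the stabilizing and of the anti-stabilizing solution of the
Riccati differential equation. -/
def IsSynthesisPair (A : ℝ → Matrix (Fin n) (Fin n) ℝ) (B : ℝ → Matrix (Fin n) (Fin m) ℝ)
    (Q : ℝ → Matrix (Fin n) (Fin n) ℝ) (S : ℝ → Matrix (Fin n) (Fin m) ℝ)
    (R : ℝ → Matrix (Fin m) (Fin m) ℝ) (Ap Am : ℝ → Matrix (Fin n) (Fin n) ℝ) : Prop :=
  (∃ Pp, IsRiccatiSolution A B Q S R Pp ∧ Ap = closedLoop A B S R Pp ∧ IsExpStable Ap) ∧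
  (∃ Pm, IsRiccatiSolution A B Q S R Pm ∧ Am = closedLoop A B S R Pm ∧ IsExpAntiStable Am)

/-- `(u + K x)ᵀ R (u + K x)` is a canonical cost for the dynamics `(A,B)`. -/
structure IsCanonicalCost (A : ℝ → Matrix (Fin n) (Fin n) ℝ) (B : ℝ → Matrix (Fin n) (Fin m) ℝ)
    (K : ℝ → Matrix (Fin m) (Fin n) ℝ) (R : ℝ → Matrix (Fin m) (Fin m) ℝ) : Prop where
  symm_R : ∀ t, (R t).IsSymm
  smooth_R : ContDiff ℝ ∞ R
  bounded_R : IsBoundedMap R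
  uniformlyPosDef_R : IsUniformlyPosDef R
  det_R_zero : (R 0).det = 1
  smooth_K : ContDiff ℝ ∞ K
  bounded_K : IsBoundedMap K
  stabilizing : IsExpStable fun t => A t - B t * K t

/-- The linear integral equation for `Z` determined by the pair `(Ap, Am) = (A₊, A₋)`. -/
def SolvesReconstructionEq (B : ℝ → Matrix (Fin n) (Fin m) ℝ)
    (Ap Am : ℝ → Matrix (Fin n) (Fin n) ℝ) (Z : ℝ → Matrix (Fin m) (Fin m) ℝ) : Prop :=
  ∀ t : ℝ,
    (Am t - Ap t) * (∫ s in (0 : ℝ)..t,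
        transitionMatrix Ap t s * B s * Z s * (B s)ᵀ * (transitionMatrix Ap t s)ᵀ)
      - B t * Z t * (B t)ᵀ *
        (1 - ((transitionMatrix Am t 0)⁻¹)ᵀ * (transitionMatrix Ap t 0)ᵀ) = 0

end InverseLQ

end

/-! Write F = A₊, G = A₋, b(t) = Φ_F(0,t)B(t) and J_Z(t) = ∫₀ᵗ b Z bᵀ. Completing the square with
the stabilizing Riccati solution turns a cost into an R-weighted square of u + kx plus boundary
terms. Its minimizers are therefore exactly the arcs Φ_F(t,0)(z + J_{R⁻¹}(t)η)
(`mem_optimalSynthesis_iff`). The difference of the two Riccati solutions obeys a linear equation,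
whence Φ_G(t,0) = Φ_F(t,0)(1 + J_{R⁻¹}(t)D) with D = P₊(0) − P₋(0), and D is invertible because Φ_F
and Φ_G have opposite growth. So the optimal arcs are the curves Φ_F(t,0)a + Φ_G(t,0)b, which
involve only the pair (`mem_optimalSynthesis_iff_of_pair`): (b) implies (a).

(a) implies (c). For a canonical cost the stabilizing Riccati solution is 0, with closed loop A −
BK. Solutions of that closed loop lie in Γ on every interval; decay at +∞ rules out a G-component,
so A − BK = F and injectivity of B gives K. Solutions of G in turn are extremals of the canonical
cost, so Φ_G = Φ_F(1 + J_{R⁻¹}E) for some E (`eq_feedback_of_optimalSynthesis_eq`). Decay at −∞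
makes E symmetric, and then Z = R⁻¹ solves the integral equation identically
(`reconstruction_residual`).

(c) implies (b) is the core. Let Z₀ = R₀⁻¹, J₀ = J_{Z₀}, J = J_Z and Y = D⁻¹ + J₀. The integral
equation becomes Z₀bᵀY⁻¹J = Zbᵀ Y⁻¹J₀. It makes the derivative of Y⁻¹JD symmetric, which gives JDJ₀
= J₀DJ and then Z₀bᵀ = Zbᵀ J⁻¹J₀ for t ≠ 0. Hence J⁻¹J₀ has zero derivative on each half-line;
smoothness at 0 and the Kalman condition force the two constants to agree (`exists_intertwiner`).
With N the common value, J₀ = JN and Φ_G = Φ_F(1 + J·ND), from which an antistabilizing Riccati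
solution for the canonical cost is built (`isSynthesisPair_feedback`). The relation Z₀bᵀ = Zbᵀ N
bounds the eigenvalues of Z⁻¹ relative to Z₀⁻¹ by the norm of Nᵀ, so Z⁻¹ inherits the uniform bounds
of R₀. Boundedness of K comes from boundedness of Riccati solutions under uniform controllability.
-/

noncomputable section

namespace InverseLQ

/-! ### Calculus of matrix-valued functions of one variable. -/

section MatrixCalculus

variable {p q r : ℕ}

theorem hasDerivAt_matrix_iff {M : ℝ → Matrix (Fin p) (Fin q) ℝ} {M' : Matrix (Fin p) (Fin q) ℝ}
    {t : ℝ} : HasDerivAt M M' t ↔ ∀ i j, HasDerivAt (fun t => M t i j) (M' i j) t :=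
  ⟨fun h i j => hasDerivAt_pi.1 (hasDerivAt_pi.1 h i) j,
    fun h => hasDerivAt_pi.2 fun i => hasDerivAt_pi.2 fun j => h i j⟩

theorem contDiff_matrix_iff {k : ℕ∞ω} {M : ℝ → Matrix (Fin p) (Fin q) ℝ} :
    ContDiff ℝ k M ↔ ∀ i j, ContDiff ℝ k fun t => M t i j := by
  -- Matrices carry the operator norm and functions the sup norm; in finite dimension the identity
  -- is bicontinuous, so smoothness can be tested entrywise.
  let e : Matrix (Fin p) (Fin q) ℝ ≃L[ℝ] (Fin p → Fin q → ℝ) :=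
    (LinearEquiv.refl ℝ (Fin p → Fin q → ℝ) :
      Matrix (Fin p) (Fin q) ℝ ≃ₗ[ℝ] (Fin p → Fin q → ℝ)).toContinuousLinearEquiv
  rw [← e.comp_contDiff_iff, contDiff_pi]
  exact forall_congr' fun i => contDiff_pi

theorem continuous_matrix_iff {M : ℝ → Matrix (Fin p) (Fin q) ℝ} :
    Continuous M ↔ ∀ i j, Continuous fun t => M t i j :=
  ⟨fun h i j => h.matrix_elem i j, continuous_matrix⟩

theorem HasDerivAt.matMul {M : ℝ → Matrix (Fin p) (Fin q) ℝ} {N : ℝ → Matrix (Fin q) (Fin r) ℝ}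
    {M' N'} {t : ℝ} (hM : HasDerivAt M M' t) (hN : HasDerivAt N N' t) :
    HasDerivAt (fun s => M s * N s) (M' * N t + M t * N') t := by
  rw [hasDerivAt_matrix_iff] at *
  intro i j
  simp only [Matrix.mul_apply, Matrix.add_apply, ← Finset.sum_add_distrib]
  exact HasDerivAt.fun_sum fun k _ => (hM i k).mul (hN k j)

theorem HasDerivAt.matMul_const {M : ℝ → Matrix (Fin p) (Fin q) ℝ} {M'} {t : ℝ}
    (hM : HasDerivAt M M' t) (N : Matrix (Fin q) (Fin r) ℝ) :
    HasDerivAt (fun s => M s * N) (M' * N) t := by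
  simpa using HasDerivAt.matMul hM (hasDerivAt_const t N)

theorem HasDerivAt.matTranspose {M : ℝ → Matrix (Fin p) (Fin q) ℝ} {M'} {t : ℝ}
    (hM : HasDerivAt M M' t) : HasDerivAt (fun s => (M s)ᵀ) M'ᵀ t := by
  rw [hasDerivAt_matrix_iff] at *
  exact fun i j => hM j i

theorem HasDerivAt.mulVec {M : ℝ → Matrix (Fin p) (Fin q) ℝ} {x : ℝ → Fin q → ℝ}
    {M' x'} {t : ℝ} (hM : HasDerivAt M M' t) (hx : HasDerivAt x x' t) :
    HasDerivAt (fun s => M s *ᵥ x s) (M' *ᵥ x t + M t *ᵥ x') t := by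
  rw [hasDerivAt_matrix_iff] at hM
  rw [hasDerivAt_pi] at *
  intro i
  simp only [Matrix.mulVec, dotProduct, Pi.add_apply, ← Finset.sum_add_distrib]
  exact HasDerivAt.fun_sum fun k _ => (hM i k).mul (hx k)

theorem HasDerivAt.mulVec_const {M : ℝ → Matrix (Fin p) (Fin q) ℝ} {M'} {t : ℝ}
    (hM : HasDerivAt M M' t) (x : Fin q → ℝ) :
    HasDerivAt (fun s => M s *ᵥ x) (M' *ᵥ x) t := by
  simpa using HasDerivAt.mulVec hM (hasDerivAt_const t x)

theorem HasDerivAt.dotProduct' {x y : ℝ → Fin q → ℝ} {x' y'} {t : ℝ}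
    (hx : HasDerivAt x x' t) (hy : HasDerivAt y y' t) :
    HasDerivAt (fun s => x s ⬝ᵥ y s) (x' ⬝ᵥ y t + x t ⬝ᵥ y') t := by
  rw [hasDerivAt_pi] at *
  simp only [dotProduct, ← Finset.sum_add_distrib]
  exact HasDerivAt.fun_sum fun k _ => (hx k).mul (hy k)

theorem HasDerivAt.matInv {M : ℝ → Matrix (Fin p) (Fin p) ℝ} {M'} {t : ℝ}
    (hM : HasDerivAt M M' t) (hu : IsUnit (M t)) :
    HasDerivAt (fun s => (M s)⁻¹) (-((M t)⁻¹ * M' * (M t)⁻¹)) t := by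
  obtain ⟨u, hu⟩ := hu
  have h := hasFDerivAt_ringInverse (𝕜 := ℝ) u
  rw [hu] at h
  have h2 := h.comp_hasDerivAt t hM
  have h3 : (↑u⁻¹ : Matrix (Fin p) (Fin p) ℝ) = (M t)⁻¹ := by
    rw [← hu, Matrix.coe_units_inv]
  simp only [neg_apply, ContinuousLinearMap.mulLeftRight_apply, h3] at h2
  have e : (fun s => (M s)⁻¹) = Ring.inverse ∘ M := by
    funext s
    simp [Matrix.nonsing_inv_eq_ringInverse]
  rw [e]
  exact h2

theorem ContDiff.matMul {k : ℕ∞ω} {M : ℝ → Matrix (Fin p) (Fin q) ℝ}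
    {N : ℝ → Matrix (Fin q) (Fin r) ℝ} (hM : ContDiff ℝ k M) (hN : ContDiff ℝ k N) :
    ContDiff ℝ k fun t => M t * N t := by
  rw [contDiff_matrix_iff] at *
  intro i j
  simp only [Matrix.mul_apply]
  exact ContDiff.sum fun l _ => (hM i l).mul (hN l j)

theorem ContDiff.matTranspose {k : ℕ∞ω} {M : ℝ → Matrix (Fin p) (Fin q) ℝ}
    (hM : ContDiff ℝ k M) : ContDiff ℝ k fun t => (M t)ᵀ := by
  rw [contDiff_matrix_iff] at *
  exact fun i j => hM j i

theorem ContDiff.matInv {k : ℕ∞ω} {M : ℝ → Matrix (Fin p) (Fin p) ℝ}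
    (hM : ContDiff ℝ k M) (hu : ∀ t, IsUnit (M t)) : ContDiff ℝ k fun t => (M t)⁻¹ := by
  rw [contDiff_iff_contDiffAt] at *
  intro t
  obtain ⟨u, hu⟩ := hu t
  have h := contDiffAt_ringInverse ℝ (n := k) u
  rw [hu] at h
  have h2 := h.comp t (hM t)
  have e : (fun s => (M s)⁻¹) = Ring.inverse ∘ M := by
    funext s
    simp [Matrix.nonsing_inv_eq_ringInverse]
  rw [e]
  exact h2

theorem continuous_matInv {M : ℝ → Matrix (Fin p) (Fin p) ℝ}
    (hM : Continuous M) (hu : ∀ t, IsUnit (M t)) : Continuous fun t => (M t)⁻¹ :=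
  (ContDiff.matInv (contDiff_zero.2 hM) hu).continuous

theorem intervalIntegral_hasDerivAt {E : Type*} [NormedAddCommGroup E] [NormedSpace ℝ E]
    [CompleteSpace E] {f : ℝ → E} (hf : Continuous f) (a t : ℝ) :
    HasDerivAt (fun s => ∫ r in a..s, f r) (f t) t :=
  intervalIntegral.integral_hasDerivAt_right (hf.intervalIntegrable _ _)
    (hf.stronglyMeasurableAtFilter _ _) hf.continuousAt

theorem eq_of_hasDerivAt_eq {E : Type*} [NormedAddCommGroup E] [NormedSpace ℝ E]
    {f g f' : ℝ → E} (hf : ∀ t, HasDerivAt f (f' t) t) (hg : ∀ t, HasDerivAt g (f' t) t)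
    {a : ℝ} (h : f a = g a) (t : ℝ) : f t = g t := by
  have h1 : ∀ t, HasDerivAt (fun s => f s - g s) 0 t := fun t => by
    simpa using (hf t).fun_sub (hg t)
  have := is_const_of_deriv_eq_zero (fun t => (h1 t).differentiableAt)
    (fun t => (h1 t).deriv) t a
  simpa [h, sub_eq_zero] using this

theorem hasDerivAt_continuous {E : Type*} [NormedAddCommGroup E] [NormedSpace ℝ E]
    {f f' : ℝ → E} (hf : ∀ t, HasDerivAt f (f' t) t) : Continuous f :=
  continuous_iff_continuousAt.2 fun t => (hf t).continuousAt

/-- A bounded linear map applied to matrices commutes with the integral of a continuous map. -/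
theorem map_intervalIntegral {E : Type*} [NormedAddCommGroup E] [NormedSpace ℝ E]
    [CompleteSpace E] {f : ℝ → Matrix (Fin p) (Fin q) ℝ} (hf : Continuous f)
    (L : Matrix (Fin p) (Fin q) ℝ →ₗ[ℝ] E) (a b : ℝ) :
    L (∫ t in a..b, f t) = ∫ t in a..b, L (f t) :=
  ((LinearMap.toContinuousLinearMap L).intervalIntegral_comp_comm
    (hf.intervalIntegrable a b)).symm

end MatrixCalculus

/-! ### Existence and properties of transition matrices. -/

section LinearODE

variable {n : ℕ}

/-- Picard iterates of the linear equation `X' = F X`, `X(τ) = 1`. -/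
def picardTerm (F : ℝ → Matrix (Fin n) (Fin n) ℝ) (τ : ℝ) : ℕ → ℝ → Matrix (Fin n) (Fin n) ℝ
  | 0 => fun _ => 1
  | k + 1 => fun t => ∫ s in τ..t, F s * picardTerm F τ k s

variable {F : ℝ → Matrix (Fin n) (Fin n) ℝ}

theorem continuous_picardTerm (hF : Continuous F) (τ : ℝ) (k : ℕ) :
    Continuous (picardTerm F τ k) := by
  induction k with
  | zero => exact continuous_const
  | succ k ih =>
    exact hasDerivAt_continuous fun t => intervalIntegral_hasDerivAt (hF.matrix_mul ih) τ t

theorem hasDerivAt_picardTerm_succ (hF : Continuous F) (τ : ℝ) (k : ℕ) (t : ℝ) :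
    HasDerivAt (picardTerm F τ (k + 1)) (F t * picardTerm F τ k t) t :=
  intervalIntegral_hasDerivAt (hF.matrix_mul (continuous_picardTerm hF τ k)) τ t

/-- Each integration raises the power of |t − τ| by one and divides by the new exponent, which
produces the terms of an exponential series. -/
theorem norm_picardTerm_le {τ T M : ℝ}
    (hM : ∀ t ∈ Set.Icc (τ - T) (τ + T), ‖F t‖ ≤ M) (k : ℕ) :
    ∀ t ∈ Set.Icc (τ - T) (τ + T),
      ‖picardTerm F τ k t‖ ≤ ‖(1 : Matrix (Fin n) (Fin n) ℝ)‖ *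
        ((M * |t - τ|) ^ k / k.factorial) := by
  induction k with
  | zero => intro t _; simp [picardTerm]
  | succ k ih =>
    intro t ht
    set c := ‖(1 : Matrix (Fin n) (Fin n) ℝ)‖
    have hM0 : 0 ≤ M := (norm_nonneg _).trans (hM t ht)
    have hsub : ∀ s ∈ Set.uIoc τ t, s ∈ Set.Icc (τ - T) (τ + T) := by
      intro s hs
      rw [Set.mem_uIoc] at hs
      rcases hs with hs | hs <;> constructor <;> linarith [ht.1, ht.2]
    have hb : ∀ s ∈ Set.uIoc τ t, ‖F s * picardTerm F τ k s‖ ≤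
        c * (M ^ (k + 1) / k.factorial) * |s - τ| ^ k := by
      intro s hs
      calc ‖F s * picardTerm F τ k s‖ ≤ ‖F s‖ * ‖picardTerm F τ k s‖ := norm_mul_le _ _
        _ ≤ M * (c * ((M * |s - τ|) ^ k / k.factorial)) :=
          mul_le_mul (hM s (hsub s hs)) (ih s (hsub s hs)) (norm_nonneg _) hM0
        _ = _ := by rw [mul_pow]; ring
    have h1 := intervalIntegral.norm_integral_le_abs_of_norm_le
      (f := fun s => F s * picardTerm F τ k s) (μ := MeasureTheory.volume) (a := τ) (b := t)
      (g := fun s => c * (M ^ (k + 1) / k.factorial) * |s - τ| ^ k)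
      ((MeasureTheory.ae_restrict_mem measurableSet_uIoc).mono hb)
      (by apply Continuous.intervalIntegrable; fun_prop)
    refine h1.trans (le_of_eq ?_)
    rw [intervalIntegral.integral_const_mul]
    have h2 : |∫ s in τ..t, |s - τ| ^ k| = |t - τ| ^ (k + 1) / (k + 1) := by
      have := integral_pow_abs_sub_uIoc (a := τ) (b := t) (n := k)
      rw [← this, intervalIntegral.abs_intervalIntegral_eq, abs_of_nonneg]
      exact MeasureTheory.setIntegral_nonneg measurableSet_uIoc fun s _ => by positivity
    rw [abs_mul, h2, abs_of_nonneg (by positivity), Nat.factorial_succ, mul_pow]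
    push_cast
    field_simp

/-- The sum of the Picard iterates can be differentiated term by term, locally uniformly in t.
Existence is what gives content to the choice operator in `transitionMatrix`. -/
theorem exists_isTransitionMatrix (hF : Continuous F) : ∃ Φ, IsTransitionMatrix F Φ := by
  refine ⟨fun t τ => ∑' k, picardTerm F τ k t, fun τ => ⟨?_, fun t => ?_⟩⟩
  · beta_reduce
    rw [tsum_eq_single 0]
    · simp [picardTerm]
    · intro k hk
      obtain ⟨k, rfl⟩ := Nat.exists_eq_succ_of_ne_zero hk
      simp [picardTerm]
  -- The open interval of radius T about τ contains both τ, where summability of the series starts,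
  -- and t, where the derivative is taken.
  · set T : ℝ := |t - τ| + 1
    obtain ⟨M, hM⟩ := (isCompact_Icc (a := τ - T) (b := τ + T)).exists_bound_of_continuousOn
      hF.continuousOn
    have htT : t ∈ Set.Ioo (τ - T) (τ + T) := by
      constructor <;> simp only [T] <;> linarith [neg_abs_le (t - τ), le_abs_self (t - τ)]
    have hτT : τ ∈ Set.Ioo (τ - T) (τ + T) := by
      constructor <;> simp only [T] <;> linarith [abs_nonneg (t - τ)]
    have hM0 : 0 ≤ M := (norm_nonneg _).trans (hM t (Set.Ioo_subset_Icc_self htT))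
    have hT0 : 0 ≤ T := by positivity
    set c := ‖(1 : Matrix (Fin n) (Fin n) ℝ)‖
    have hbound : ∀ k, ∀ s ∈ Set.Ioo (τ - T) (τ + T),
        ‖picardTerm F τ k s‖ ≤ c * ((M * T) ^ k / k.factorial) := by
      intro k s hs
      refine (norm_picardTerm_le hM k s (Set.Ioo_subset_Icc_self hs)).trans ?_
      have : |s - τ| ≤ T := by rw [abs_le]; constructor <;> linarith [hs.1, hs.2]
      gcongr
    have hsum : Summable fun k : ℕ => c * ((M * T) ^ k / k.factorial) :=
      (Real.summable_pow_div_factorial (M * T)).mul_left c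
    have hs1 : ∀ s ∈ Set.Ioo (τ - T) (τ + T), Summable fun k => picardTerm F τ k s :=
      fun s hs => Summable.of_norm_bounded hsum fun k => hbound k s hs
    have hd := hasDerivAt_tsum_of_isPreconnected
      (g := fun k => picardTerm F τ (k + 1)) (g' := fun k s => F s * picardTerm F τ k s)
      (u := fun k : ℕ => M * (c * ((M * T) ^ k / k.factorial)))
      (hsum.mul_left M) isOpen_Ioo isPreconnected_Ioo
      (fun k s _ => hasDerivAt_picardTerm_succ hF τ k s)
      (fun k s hs => (norm_mul_le _ _).trans
        (mul_le_mul (hM s (Set.Ioo_subset_Icc_self hs)) (hbound k s hs) (norm_nonneg _) hM0))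
      hτT ((summable_nat_add_iff 1).2 (hs1 τ hτT)) htT
    have hval : ∑' k, F t * picardTerm F τ k t = F t * ∑' k, picardTerm F τ k t :=
      (hs1 t htT).tsum_mul_left _
    rw [hval] at hd
    have hd2 := hd.const_add (1 : Matrix (Fin n) (Fin n) ℝ)
    refine hd2.congr_of_eventuallyEq ?_
    filter_upwards [isOpen_Ioo.mem_nhds htT] with s hs
    rw [(hs1 s hs).tsum_eq_zero_add]
    rfl

theorem isTransitionMatrix_transitionMatrix (hF : Continuous F) :
    IsTransitionMatrix F (transitionMatrix F) :=
  Classical.epsilon_spec (exists_isTransitionMatrix hF)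

theorem transitionMatrix_self (hF : Continuous F) (τ : ℝ) : transitionMatrix F τ τ = 1 :=
  (isTransitionMatrix_transitionMatrix hF τ).1

theorem hasDerivAt_transitionMatrix (hF : Continuous F) (t τ : ℝ) :
    HasDerivAt (fun r => transitionMatrix F r τ) (F t * transitionMatrix F t τ) t :=
  (isTransitionMatrix_transitionMatrix hF τ).2 t

/-- The transpose of the transition matrix of the adjoint equation q' = −Fᵀq is a left inverse,
since the product has zero derivative. -/
theorem isUnit_transitionMatrix (hF : Continuous F) (t τ : ℝ) :
    IsUnit (transitionMatrix F t τ) := by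
  have hG : Continuous fun t => -(F t)ᵀ := by fun_prop
  set Ψ := fun t => (transitionMatrix (fun t => -(F t)ᵀ) t τ)ᵀ
  have h1 : ∀ t, HasDerivAt (fun t => Ψ t * transitionMatrix F t τ) 0 t := fun t => by
    have := HasDerivAt.matMul (HasDerivAt.matTranspose (hasDerivAt_transitionMatrix hG t τ))
      (hasDerivAt_transitionMatrix hF t τ)
    convert this using 1
    simp [Matrix.transpose_mul, Matrix.mul_assoc]
  have h2 := eq_of_hasDerivAt_eq h1 (fun t => hasDerivAt_const t
    (1 : Matrix (Fin n) (Fin n) ℝ)) (a := τ) (by simp [Ψ, transitionMatrix_self, hF, hG]) t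
  exact (Matrix.isUnit_iff_isUnit_det _).2 (Matrix.isUnit_det_of_left_inverse h2)

theorem hasDerivAt_transitionMatrix_inv (hF : Continuous F) (t τ : ℝ) :
    HasDerivAt (fun r => (transitionMatrix F r τ)⁻¹) (-((transitionMatrix F t τ)⁻¹ * F t)) t := by
  have hu := isUnit_transitionMatrix hF t τ
  convert HasDerivAt.matInv (hasDerivAt_transitionMatrix hF t τ) hu using 2
  rw [Matrix.mul_assoc, Matrix.mul_assoc,
    Matrix.mul_nonsing_inv _ ((Matrix.isUnit_iff_isUnit_det _).1 hu), Matrix.mul_one]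

theorem transitionMatrix_mul_inv (hF : Continuous F) (t τ : ℝ) :
    transitionMatrix F t τ * (transitionMatrix F t τ)⁻¹ = 1 :=
  Matrix.mul_nonsing_inv _ ((Matrix.isUnit_iff_isUnit_det _).1 (isUnit_transitionMatrix hF t τ))

/-- Solutions of `X' = F X` are given by the transition matrix. -/
theorem eq_transitionMatrix_mul (hF : Continuous F) {p : ℕ} {X : ℝ → Matrix (Fin n) (Fin p) ℝ}
    (hX : ∀ t, HasDerivAt X (F t * X t) t) (t τ : ℝ) : X t = transitionMatrix F t τ * X τ := by
  have h1 : ∀ t, HasDerivAt (fun t => (transitionMatrix F t τ)⁻¹ * X t) 0 t := fun t => by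
    convert HasDerivAt.matMul (hasDerivAt_transitionMatrix_inv hF t τ) (hX t) using 1
    simp [Matrix.mul_assoc]
  have h2 := eq_of_hasDerivAt_eq h1 (fun t => hasDerivAt_const t (X τ)) (a := τ)
    (by simp [transitionMatrix_self hF]) t
  rw [← h2, ← Matrix.mul_assoc, transitionMatrix_mul_inv hF, Matrix.one_mul]

theorem transitionMatrix_mul (hF : Continuous F) (t s r : ℝ) :
    transitionMatrix F t s * transitionMatrix F s r = transitionMatrix F t r :=
  (eq_transitionMatrix_mul hF (fun t => hasDerivAt_transitionMatrix hF t r) t s).symm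

theorem transitionMatrix_inv (hF : Continuous F) (t s : ℝ) :
    (transitionMatrix F t s)⁻¹ = transitionMatrix F s t :=
  Matrix.inv_eq_right_inv (by rw [transitionMatrix_mul hF, transitionMatrix_self hF])

theorem hasDerivAt_transitionMatrix_right (hF : Continuous F) (t s : ℝ) :
    HasDerivAt (fun r => transitionMatrix F t r) (-(transitionMatrix F t s * F s)) s := by
  have h := hasDerivAt_transitionMatrix_inv hF s t
  simpa only [transitionMatrix_inv hF] using h

theorem continuous_transitionMatrix_right (hF : Continuous F) (t : ℝ) :
    Continuous fun τ => transitionMatrix F t τ :=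
  hasDerivAt_continuous fun s => hasDerivAt_transitionMatrix_right hF t s

/-- The coefficient is recovered from its flow as the logarithmic derivative Φ'Φ⁻¹. -/
theorem eq_of_transitionMatrix_eq {F G : ℝ → Matrix (Fin n) (Fin n) ℝ} (hF : Continuous F)
    (hG : Continuous G) {τ : ℝ} (h : ∀ t, transitionMatrix F t τ = transitionMatrix G t τ) :
    F = G := by
  funext t
  have h1 := hasDerivAt_transitionMatrix hF t τ
  have h2 := hasDerivAt_transitionMatrix hG t τ
  simp only [h] at h1
  have h3 := congrArg (· * (transitionMatrix G t τ)⁻¹) (h1.unique h2)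
  simpa [Matrix.mul_assoc, transitionMatrix_mul_inv hG] using h3

theorem norm_transitionMatrix_le (hF : Continuous F) {M : ℝ} (hM : ∀ t, ‖F t‖ ≤ M) (t τ : ℝ) :
    ‖transitionMatrix F t τ‖ ≤
      ‖(1 : Matrix (Fin n) (Fin n) ℝ)‖ * Real.exp (M * |t - τ|) := by
  -- The sign ε selects forward or backward time, so one application of Grönwall's inequality covers
  -- both.
  have key : ∀ ε : ℝ, |ε| = 1 → ∀ r, 0 ≤ r →
      ‖transitionMatrix F (τ + ε * r) τ‖ ≤
        ‖(1 : Matrix (Fin n) (Fin n) ℝ)‖ * Real.exp (M * r) := by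
    intro ε hε r hr
    have hd : ∀ r, HasDerivAt (fun r => transitionMatrix F (τ + ε * r) τ)
        (ε • (F (τ + ε * r) * transitionMatrix F (τ + ε * r) τ)) r := fun r => by
      have h1 : HasDerivAt (fun r => τ + ε * r) ε r := by
        simpa using ((hasDerivAt_id r).const_mul ε).const_add τ
      exact (hasDerivAt_transitionMatrix hF (τ + ε * r) τ).scomp r h1
    have := norm_le_gronwallBound_of_norm_deriv_right_le (δ := ‖(1 : Matrix (Fin n) (Fin n) ℝ)‖)
      (K := M) (ε := 0) (a := 0) (b := r)
      (hasDerivAt_continuous hd).continuousOn (fun s _ => (hd s).hasDerivWithinAt)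
      (by simp [transitionMatrix_self hF])
      (fun s _ => by
        rw [norm_smul, Real.norm_eq_abs, hε, one_mul, add_zero]
        exact (norm_mul_le _ _).trans (mul_le_mul_of_nonneg_right (hM _) (norm_nonneg _)))
      r ⟨hr, le_rfl⟩
    simpa [gronwallBound_ε0] using this
  rcases le_total τ t with h | h
  · have := key 1 (by simp) (t - τ) (by linarith)
    rw [abs_of_nonneg (by linarith)]
    convert this using 3; ring
  · have := key (-1) (by simp) (τ - t) (by linarith)
    rw [abs_of_nonpos (by linarith)]
    convert this using 3 <;> ring_nf

end LinearODE

/-! ### Unique continuation for the adjoint equation from the Kalman condition. -/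

section Kalman

variable {n m : ℕ} {A : ℝ → Matrix (Fin n) (Fin n) ℝ} {B : ℝ → Matrix (Fin n) (Fin m) ℝ}

theorem contDiff_kalmanSeq (hA : ContDiff ℝ ∞ A) (hB : ContDiff ℝ ∞ B) (i : ℕ) :
    ContDiff ℝ ∞ (kalmanSeq A B i) := by
  induction i with
  | zero => exact hB
  | succ i ih => exact (contDiff_infty_iff_deriv.1 ih).2.sub (ContDiff.matMul hA ih)

/-- Differentiating B_iᵀq along an adjoint arc yields B_{i+1}ᵀq up to a multiple of the output Bᵀq.
All the B_iᵀq are thus determined by the output and its derivatives, whatever the feedback K. -/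
theorem hasDerivAt_kalmanSeq_transpose_mulVec (hA : ContDiff ℝ ∞ A) (hB : ContDiff ℝ ∞ B)
    {K : ℝ → Matrix (Fin m) (Fin n) ℝ} {q : ℝ → Fin n → ℝ} {t : ℝ}
    (hq : HasDerivAt q (-((A t - B t * K t)ᵀ *ᵥ q t)) t) (i : ℕ) :
    HasDerivAt (fun t => (kalmanSeq A B i t)ᵀ *ᵥ q t)
      ((kalmanSeq A B (i + 1) t)ᵀ *ᵥ q t +
        ((kalmanSeq A B i t)ᵀ * (K t)ᵀ) *ᵥ ((B t)ᵀ *ᵥ q t)) t := by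
  have h1 := ((contDiff_kalmanSeq hA hB i).differentiable (by simp) t).hasDerivAt
  convert HasDerivAt.mulVec (HasDerivAt.matTranspose h1) hq using 1
  simp only [kalmanSeq, Matrix.transpose_sub, Matrix.transpose_mul, Matrix.sub_mulVec,
    Matrix.mulVec_neg,
    Matrix.mulVec_mulVec, Matrix.mulVec_sub, Matrix.mul_assoc]
  abel

theorem eq_zero_of_kalmanSeq_transpose_mulVec
    {t : ℝ} (hk : Submodule.span ℝ
      {w : Fin n → ℝ | ∃ (i : ℕ) (v : Fin m → ℝ), w = kalmanSeq A B i t *ᵥ v} = ⊤)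
    {y : Fin n → ℝ} (hy : ∀ i, (kalmanSeq A B i t)ᵀ *ᵥ y = 0) : y = 0 := by
  have h : ∀ w ∈ Submodule.span ℝ
      {w : Fin n → ℝ | ∃ (i : ℕ) (v : Fin m → ℝ), w = kalmanSeq A B i t *ᵥ v}, y ⬝ᵥ w = 0 := by
    intro w hw
    induction hw using Submodule.span_induction with
    | mem w hw =>
      obtain ⟨i, v, rfl⟩ := hw
      rw [Matrix.dotProduct_mulVec, ← Matrix.mulVec_transpose, hy, zero_dotProduct]
    | zero => simp
    | add a b _ _ ha hb => rw [dotProduct_add, ha, hb, add_zero]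
    | smul c a _ ha => rw [dotProduct_smul, ha, smul_zero]
  exact dotProduct_self_eq_zero.1 (h y (hk ▸ Submodule.mem_top))

/-- Repeated differentiation of the vanishing output shows that q is orthogonal to the columns of
every B_i, and these span the space. -/
theorem eq_zero_of_transpose_mulVec_eq_zero (hAB : DynamicsAssumption A B)
    {K : ℝ → Matrix (Fin m) (Fin n) ℝ} {q : ℝ → Fin n → ℝ} {S : Set ℝ} (hS : IsOpen S)
    (hq : ∀ t ∈ S, HasDerivAt q (-((A t - B t * K t)ᵀ *ᵥ q t)) t)
    (h0 : ∀ t ∈ S, (B t)ᵀ *ᵥ q t = 0) {t : ℝ} (ht : t ∈ S) : q t = 0 := by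
  refine eq_zero_of_kalmanSeq_transpose_mulVec (hAB.kalman t) fun i => ?_
  suffices h : ∀ t ∈ S, (kalmanSeq A B i t)ᵀ *ᵥ q t = 0 from h t ht
  induction i with
  | zero => exact h0
  | succ i ih =>
    intro t ht
    have h1 := hasDerivAt_kalmanSeq_transpose_mulVec hAB.smooth_A hAB.smooth_B (hq t ht) i
    have h2 : HasDerivAt (fun t => (kalmanSeq A B i t)ᵀ *ᵥ q t) 0 t :=
      (hasDerivAt_const t (0 : Fin m → ℝ)).congr_of_eventuallyEq
        (by filter_upwards [hS.mem_nhds ht] with s hs using ih s hs)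
    have h3 := h1.unique h2
    simpa [h0 t ht] using h3

/-- Two adjoint arcs whose outputs are glued smoothly at `0` coincide at `0`. -/
theorem eq_of_smooth_gluing (hAB : DynamicsAssumption A B)
    {K : ℝ → Matrix (Fin m) (Fin n) ℝ} (hK : ContDiff ℝ ∞ K) {q₁ q₂ : ℝ → Fin n → ℝ}
    (hq₁ : ∀ t, HasDerivAt q₁ (-((A t - B t * K t)ᵀ *ᵥ q₁ t)) t)
    (hq₂ : ∀ t, HasDerivAt q₂ (-((A t - B t * K t)ᵀ *ᵥ q₂ t)) t)
    {g : ℝ → Fin m → ℝ} (hg : ContDiff ℝ ∞ g)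
    (h₁ : ∀ t, 0 < t → (B t)ᵀ *ᵥ q₁ t = g t) (h₂ : ∀ t, t < 0 → (B t)ᵀ *ᵥ q₂ t = g t) :
    q₁ 0 = q₂ 0 := by
  -- One smooth function `f` represents B_iᵀq₁ to the right of 0 and B_iᵀq₂ to the left. Its
  -- derivative, corrected by the feedback term, does the same for i + 1; one-sided limits at 0 then
  -- give B_iᵀ(q₁ − q₂) = 0 for all i.
  have key : ∀ i, ∃ f : ℝ → Fin m → ℝ, ContDiff ℝ ∞ f ∧
      (∀ t, 0 < t → (kalmanSeq A B i t)ᵀ *ᵥ q₁ t = f t) ∧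
      (∀ t, t < 0 → (kalmanSeq A B i t)ᵀ *ᵥ q₂ t = f t) := by
    intro i
    induction i with
    | zero => exact ⟨g, hg, h₁, h₂⟩
    | succ i ih =>
      obtain ⟨f, hf, hf₁, hf₂⟩ := ih
      have hsm : ContDiff ℝ ∞ fun t => ((kalmanSeq A B i t)ᵀ * (K t)ᵀ) *ᵥ g t := by
        have h1 := ContDiff.matMul
          (ContDiff.matTranspose (contDiff_kalmanSeq hAB.smooth_A hAB.smooth_B i))
          (ContDiff.matTranspose hK)
        rw [contDiff_matrix_iff] at h1
        rw [contDiff_pi] at hg ⊢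
        intro j
        simp only [Matrix.mulVec, dotProduct]
        exact ContDiff.sum fun l _ => (h1 j l).mul (hg l)
      refine ⟨fun t => deriv f t - ((kalmanSeq A B i t)ᵀ * (K t)ᵀ) *ᵥ g t,
        (contDiff_infty_iff_deriv.1 hf).2.sub hsm, fun t ht => ?_, fun t ht => ?_⟩
      · beta_reduce
        have h1 := hasDerivAt_kalmanSeq_transpose_mulVec hAB.smooth_A hAB.smooth_B (hq₁ t) i
        have h2 := (hf.differentiable (by simp) t).hasDerivAt.congr_of_eventuallyEq
          (f₁ := fun t => (kalmanSeq A B i t)ᵀ *ᵥ q₁ t)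
          (by filter_upwards [lt_mem_nhds ht] with s hs using hf₁ s hs)
        rw [← h1.unique h2, h₁ t ht]
        abel
      · beta_reduce
        have h1 := hasDerivAt_kalmanSeq_transpose_mulVec hAB.smooth_A hAB.smooth_B (hq₂ t) i
        have h2 := (hf.differentiable (by simp) t).hasDerivAt.congr_of_eventuallyEq
          (f₁ := fun t => (kalmanSeq A B i t)ᵀ *ᵥ q₂ t)
          (by filter_upwards [gt_mem_nhds ht] with s hs using hf₂ s hs)
        rw [← h1.unique h2, h₂ t ht]
        abel
  rw [← sub_eq_zero]
  refine eq_zero_of_kalmanSeq_transpose_mulVec (hAB.kalman 0) fun i => ?_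
  obtain ⟨f, hf, hf₁, hf₂⟩ := key i
  have c₁ := (hasDerivAt_kalmanSeq_transpose_mulVec hAB.smooth_A hAB.smooth_B
    (hq₁ 0) i).continuousAt
  have c₂ := (hasDerivAt_kalmanSeq_transpose_mulVec hAB.smooth_A hAB.smooth_B
    (hq₂ 0) i).continuousAt
  have e₁ : (kalmanSeq A B i 0)ᵀ *ᵥ q₁ 0 = f 0 :=
    tendsto_nhds_unique ((c₁.tendsto.mono_left nhdsWithin_le_nhds).congr' (by
      filter_upwards [self_mem_nhdsWithin] with s hs using hf₁ s hs))
      (hf.continuous.continuousAt.tendsto.mono_left (nhdsWithin_le_nhds (s := Set.Ioi 0)))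
  have e₂ : (kalmanSeq A B i 0)ᵀ *ᵥ q₂ 0 = f 0 :=
    tendsto_nhds_unique ((c₂.tendsto.mono_left nhdsWithin_le_nhds).congr' (by
      filter_upwards [self_mem_nhdsWithin] with s hs using hf₂ s hs))
      (hf.continuous.continuousAt.tendsto.mono_left (nhdsWithin_le_nhds (s := Set.Iio 0)))
  rw [Matrix.mulVec_sub, e₁, e₂, sub_self]

end Kalman

/-! ### Weighted controllability Gramians. -/

section Gramian

variable {n m : ℕ} {F : ℝ → Matrix (Fin n) (Fin n) ℝ} {B : ℝ → Matrix (Fin n) (Fin m) ℝ}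
  {Z : ℝ → Matrix (Fin m) (Fin m) ℝ}

/-- The input matrix transported to time `0` by the flow of `F`. -/
def pulledInput (F : ℝ → Matrix (Fin n) (Fin n) ℝ) (B : ℝ → Matrix (Fin n) (Fin m) ℝ) (t : ℝ) :
    Matrix (Fin n) (Fin m) ℝ :=
  transitionMatrix F 0 t * B t

/-- The weighted controllability Gramian on `[0,t]`, transported to time `0`. -/
def gramian (F : ℝ → Matrix (Fin n) (Fin n) ℝ) (B : ℝ → Matrix (Fin n) (Fin m) ℝ)
    (Z : ℝ → Matrix (Fin m) (Fin m) ℝ) (t : ℝ) : Matrix (Fin n) (Fin n) ℝ :=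
  ∫ s in (0 : ℝ)..t, pulledInput F B s * Z s * (pulledInput F B s)ᵀ

theorem continuous_pulledInput (hF : Continuous F) (hB : Continuous B) :
    Continuous (pulledInput F B) :=
  (continuous_transitionMatrix_right hF 0).matrix_mul hB

theorem hasDerivAt_gramian (hF : Continuous F) (hB : Continuous B) (hZ : Continuous Z) (t : ℝ) :
    HasDerivAt (gramian F B Z) (pulledInput F B t * Z t * (pulledInput F B t)ᵀ) t := by
  have := continuous_pulledInput hF hB
  exact intervalIntegral_hasDerivAt (by fun_prop) 0 t

@[simp]
theorem gramian_zero : gramian F B Z 0 = 0 := by simp [gramian]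

theorem gramian_transpose (hF : Continuous F) (hB : Continuous B) (hZ : Continuous Z)
    (hs : ∀ t, (Z t).IsSymm) (t : ℝ) : (gramian F B Z t)ᵀ = gramian F B Z t := by
  refine eq_of_hasDerivAt_eq (fun t => HasDerivAt.matTranspose (hasDerivAt_gramian hF hB hZ t))
    (fun t => ?_) (a := 0) (by simp [gramian]) t
  have h := hasDerivAt_gramian hF hB hZ t
  have e : (pulledInput F B t * Z t * (pulledInput F B t)ᵀ)ᵀ =
      pulledInput F B t * Z t * (pulledInput F B t)ᵀ := by
    simp [Matrix.transpose_mul, (hs t).eq, Matrix.mul_assoc]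
  rwa [e]

theorem dotProduct_mul_mul_transpose_mulVec {n m : ℕ} (b : Matrix (Fin n) (Fin m) ℝ)
    (Z : Matrix (Fin m) (Fin m) ℝ) (v : Fin n → ℝ) :
    v ⬝ᵥ ((b * Z * bᵀ) *ᵥ v) = (bᵀ *ᵥ v) ⬝ᵥ (Z *ᵥ (bᵀ *ᵥ v)) := by
  rw [Matrix.mul_assoc, ← Matrix.mulVec_mulVec, ← Matrix.mulVec_mulVec, Matrix.dotProduct_mulVec,
    Matrix.mulVec_transpose]

theorem hasDerivAt_dotProduct_gramian (hF : Continuous F) (hB : Continuous B) (hZ : Continuous Z)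
    (v : Fin n → ℝ) (t : ℝ) :
    HasDerivAt (fun t => v ⬝ᵥ (gramian F B Z t *ᵥ v))
      (((pulledInput F B t)ᵀ *ᵥ v) ⬝ᵥ (Z t *ᵥ ((pulledInput F B t)ᵀ *ᵥ v))) t := by
  have := HasDerivAt.dotProduct' (hasDerivAt_const t v)
    (HasDerivAt.mulVec_const (hasDerivAt_gramian hF hB hZ t) v)
  simpa only [zero_dotProduct, zero_add, dotProduct_mul_mul_transpose_mulVec] using this

theorem monotone_dotProduct_gramian (hF : Continuous F) (hB : Continuous B) (hZ : Continuous Z)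
    (hpos : ∀ t, (Z t).PosDef) (v : Fin n → ℝ) :
    Monotone fun t => v ⬝ᵥ (gramian F B Z t *ᵥ v) := by
  have hd := hasDerivAt_dotProduct_gramian hF hB hZ v
  refine monotone_of_deriv_nonneg (fun t => (hd t).differentiableAt) fun t => ?_
  rw [(hd t).deriv]
  exact (hpos t).posSemidef.dotProduct_mulVec_nonneg _

theorem hasDerivAt_adjoint (hF : Continuous F) (v : Fin n → ℝ) (t : ℝ) :
    HasDerivAt (fun t => (transitionMatrix F 0 t)ᵀ *ᵥ v)
      (-((F t)ᵀ *ᵥ ((transitionMatrix F 0 t)ᵀ *ᵥ v))) t := by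
  convert HasDerivAt.mulVec_const
    (HasDerivAt.matTranspose (hasDerivAt_transitionMatrix_right hF 0 t)) v using 1
  simp [Matrix.transpose_mul, Matrix.neg_mulVec]

/-- On a kernel vector v the monotone function vᵀJ(t)v takes equal values at t₀ and t₁, hence is
constant between them. Positivity of Z then kills the output of the adjoint arc through v, and the
Kalman condition gives v = 0. -/
theorem isUnit_gramian_sub {A : ℝ → Matrix (Fin n) (Fin n) ℝ} (hAB : DynamicsAssumption A B)
    {K : ℝ → Matrix (Fin m) (Fin n) ℝ} (hFK : ∀ t, F t = A t - B t * K t) (hF : Continuous F)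
    (hZ : Continuous Z) (hpos : ∀ t, (Z t).PosDef) {t₀ t₁ : ℝ} (h : t₀ < t₁) :
    IsUnit (gramian F B Z t₁ - gramian F B Z t₀) := by
  have hB := hAB.smooth_B.continuous
  rw [Matrix.isUnit_iff_isUnit_det, isUnit_iff_ne_zero]
  intro hdet
  obtain ⟨v, hv, hv0⟩ := Matrix.exists_mulVec_eq_zero_iff.2 hdet
  have hmono := monotone_dotProduct_gramian hF hB hZ hpos v
  have heq : v ⬝ᵥ (gramian F B Z t₁ *ᵥ v) = v ⬝ᵥ (gramian F B Z t₀ *ᵥ v) := by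
    rw [← sub_eq_zero, ← dotProduct_sub, ← Matrix.sub_mulVec, hv0, dotProduct_zero]
  have hout : ∀ t ∈ Set.Ioo t₀ t₁, (B t)ᵀ *ᵥ ((transitionMatrix F 0 t)ᵀ *ᵥ v) = 0 := by
    intro t ht
    have h1 := hasDerivAt_dotProduct_gramian hF hB hZ v t
    have h2 : HasDerivAt (fun t => v ⬝ᵥ (gramian F B Z t *ᵥ v)) 0 t := by
      refine (hasDerivAt_const t (v ⬝ᵥ (gramian F B Z t₀ *ᵥ v))).congr_of_eventuallyEq ?_
      filter_upwards [isOpen_Ioo.mem_nhds ht] with s hs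
      exact le_antisymm ((hmono hs.2.le).trans heq.le) (hmono hs.1.le)
    have h3 := h1.unique h2
    by_contra hne
    refine absurd h3 (ne_of_gt ?_)
    refine (hpos t).dotProduct_mulVec_pos (x := (pulledInput F B t)ᵀ *ᵥ v) ?_
    rwa [pulledInput, Matrix.transpose_mul, ← Matrix.mulVec_mulVec]
  have hmid : (t₀ + t₁) / 2 ∈ Set.Ioo t₀ t₁ := by constructor <;> linarith
  have h4 := eq_zero_of_transpose_mulVec_eq_zero hAB (K := K) isOpen_Ioo
    (fun t _ => by
      have := hasDerivAt_adjoint hF v t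
      rw [hFK t] at this
      exact this) hout hmid
  apply hv
  have h5 : ((transitionMatrix F ((t₀ + t₁) / 2) 0)ᵀ *
      (transitionMatrix F 0 ((t₀ + t₁) / 2))ᵀ) *ᵥ v = v := by
    rw [← Matrix.transpose_mul, transitionMatrix_mul hF, transitionMatrix_self hF]
    simp
  rw [← h5, ← Matrix.mulVec_mulVec, h4, Matrix.mulVec_zero]

theorem isUnit_gramian {A : ℝ → Matrix (Fin n) (Fin n) ℝ} (hAB : DynamicsAssumption A B)
    {K : ℝ → Matrix (Fin m) (Fin n) ℝ} (hFK : ∀ t, F t = A t - B t * K t) (hF : Continuous F)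
    (hZ : Continuous Z) (hpos : ∀ t, (Z t).PosDef) {t : ℝ} (h : t ≠ 0) :
    IsUnit (gramian F B Z t) := by
  rcases lt_or_gt_of_ne h with h | h
  · simpa using (isUnit_gramian_sub hAB hFK hF hZ hpos h).neg
  · simpa using isUnit_gramian_sub hAB hFK hF hZ hpos h

end Gramian

/-! ### The fundamental theorem of calculus for absolutely continuous functions. -/

section AbsolutelyContinuous

open MeasureTheory

theorem integral_eq_sub_of_absolutelyContinuous {g g' : ℝ → ℝ} {a b : ℝ}
    (hg : AbsolutelyContinuousOnInterval g a b)
    (hd : ∀ᵐ t, t ∈ Set.uIcc a b → HasDerivAt g (g' t) t) :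
    ∫ t in a..b, g' t = g b - g a := by
  rw [← hg.integral_deriv_eq_sub]
  refine intervalIntegral.integral_congr_ae ?_
  filter_upwards [hd] with t ht hmem
  exact (ht (Set.uIoc_subset_uIcc hmem)).deriv.symm

theorem absolutelyContinuousOnInterval_const (c a b : ℝ) :
    AbsolutelyContinuousOnInterval (fun _ => c) a b :=
  (contDiff_const.contDiffOn (𝕜 := ℝ)).absolutelyContinuousOnInterval

theorem absolutelyContinuousOnInterval_sum {ι : Type*} (s : Finset ι) {g : ι → ℝ → ℝ} {a b : ℝ}
    (hg : ∀ i ∈ s, AbsolutelyContinuousOnInterval (g i) a b) :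
    AbsolutelyContinuousOnInterval (fun t => ∑ i ∈ s, g i t) a b := by
  classical
  induction s using Finset.induction_on with
  | empty => simpa using absolutelyContinuousOnInterval_const 0 a b
  | insert i s hi ih =>
    simp only [Finset.sum_insert hi]
    exact (hg i (by simp)).fun_add (ih fun j hj => hg j (by simp [hj]))

theorem absolutelyContinuousOnInterval_dotProduct_mulVec {p q : ℕ} {y : ℝ → Fin p → ℝ}
    {M : ℝ → Matrix (Fin p) (Fin q) ℝ} {x : ℝ → Fin q → ℝ} {a b : ℝ}
    (hy : ∀ i, AbsolutelyContinuousOnInterval (fun t => y t i) a b)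
    (hM : ContDiff ℝ 1 M)
    (hx : ∀ i, AbsolutelyContinuousOnInterval (fun t => x t i) a b) :
    AbsolutelyContinuousOnInterval (fun t => y t ⬝ᵥ (M t *ᵥ x t)) a b := by
  simp only [dotProduct, Matrix.mulVec]
  exact absolutelyContinuousOnInterval_sum _ fun i _ => (hy i).fun_mul
    (absolutelyContinuousOnInterval_sum _ fun j _ => AbsolutelyContinuousOnInterval.fun_mul
      ((contDiff_matrix_iff.1 hM i j).contDiffOn.absolutelyContinuousOnInterval) (hx j))

end AbsolutelyContinuous

/-! ### Square integrability of controls and integrability of quadratic expressions. -/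

section SquareIntegrable

open MeasureTheory

variable {p q : ℕ} {t₀ t₁ : ℝ}

theorem memLp_continuousOn_mul {g f : ℝ → ℝ} (hg : ContinuousOn g (Set.Icc t₀ t₁))
    (hf : MemLp f 2 (volume.restrict (Set.Icc t₀ t₁))) :
    MemLp (fun t => g t * f t) 2 (volume.restrict (Set.Icc t₀ t₁)) := by
  obtain ⟨C, hC⟩ := isCompact_Icc.exists_bound_of_continuousOn hg
  refine hf.of_le_mul (c := C)
    ((hg.aestronglyMeasurable measurableSet_Icc).mul hf.aestronglyMeasurable) ?_
  filter_upwards [ae_restrict_mem measurableSet_Icc] with t ht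
  rw [norm_mul]
  exact mul_le_mul_of_nonneg_right (hC t ht) (norm_nonneg _)

theorem memLp_of_continuousOn {g : ℝ → ℝ} (hg : ContinuousOn g (Set.Icc t₀ t₁)) :
    MemLp g 2 (volume.restrict (Set.Icc t₀ t₁)) := by
  simpa using memLp_continuousOn_mul hg (f := fun _ => 1) (memLp_const 1)

theorem memLp_mulVec {M : ℝ → Matrix (Fin p) (Fin q) ℝ} {v : ℝ → Fin q → ℝ}
    (hM : Continuous M) (hv : MemLp v 2 (volume.restrict (Set.Icc t₀ t₁))) :
    MemLp (fun t => M t *ᵥ v t) 2 (volume.restrict (Set.Icc t₀ t₁)) := by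
  rw [memLp_pi_iff] at hv ⊢
  intro i
  simp only [Matrix.mulVec, dotProduct]
  exact memLp_finsetSum _ fun j _ =>
    memLp_continuousOn_mul (continuous_matrix_iff.1 hM i j).continuousOn (hv j)

theorem memLp_pi_of_continuousOn {v : ℝ → Fin q → ℝ} (hv : ContinuousOn v (Set.Icc t₀ t₁)) :
    MemLp v 2 (volume.restrict (Set.Icc t₀ t₁)) :=
  memLp_pi_iff.2 fun i => memLp_of_continuousOn (continuousOn_pi.1 hv i)

theorem intervalIntegrable_dotProduct {v w : ℝ → Fin q → ℝ} (h : t₀ ≤ t₁)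
    (hv : MemLp v 2 (volume.restrict (Set.Icc t₀ t₁)))
    (hw : MemLp w 2 (volume.restrict (Set.Icc t₀ t₁))) :
    IntervalIntegrable (fun t => v t ⬝ᵥ w t) volume t₀ t₁ := by
  rw [intervalIntegrable_iff_integrableOn_Icc_of_le h]
  simp only [dotProduct]
  exact integrable_finsetSum _ fun i _ =>
    (memLp_pi_iff.1 hv i).integrable_mul (memLp_pi_iff.1 hw i)

theorem intervalIntegrable_of_memLp {v : ℝ → Fin q → ℝ} (h : t₀ ≤ t₁)
    (hv : MemLp v 2 (volume.restrict (Set.Icc t₀ t₁))) :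
    IntervalIntegrable v volume t₀ t₁ := by
  rw [intervalIntegrable_iff_integrableOn_Icc_of_le h]
  exact hv.integrable (by norm_num)

end SquareIntegrable

/-! ### Regularity of trajectories. -/

section Trajectories

open MeasureTheory

variable {n m : ℕ} {A : ℝ → Matrix (Fin n) (Fin n) ℝ} {B : ℝ → Matrix (Fin n) (Fin m) ℝ}
  {t₀ t₁ : ℝ} {x : ℝ → Fin n → ℝ} {u : ℝ → Fin m → ℝ}

/-- `x` is arbitrary outside [t₀,t₁]; the representative `y` is the integral formula itself, so that
two-sided derivatives make sense almost everywhere on the closed interval. -/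
theorem IsTrajectory.exists_absolutelyContinuous (hA : Continuous A) (hB : Continuous B)
    (h : t₀ ≤ t₁) (hx : IsTrajectory A B t₀ t₁ x u) :
    ∃ y : ℝ → Fin n → ℝ, (∀ t ∈ Set.Icc t₀ t₁, y t = x t) ∧
      (∀ i, AbsolutelyContinuousOnInterval (fun t => y t i) t₀ t₁) ∧
      ∀ᵐ t, t ∈ Set.uIcc t₀ t₁ → HasDerivAt y (A t *ᵥ x t + B t *ᵥ u t) t := by
  have hint : IntervalIntegrable (fun s => A s *ᵥ x s + B s *ᵥ u s) volume t₀ t₁ :=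
    (intervalIntegrable_of_memLp h (memLp_mulVec hA (memLp_pi_of_continuousOn hx.continuous))).add
      (intervalIntegrable_of_memLp h (memLp_mulVec hB hx.control))
  refine ⟨fun t => x t₀ + ∫ s in t₀..t, (A s *ᵥ x s + B s *ᵥ u s), fun t ht => (hx.ode t ht).symm,
    fun i => ?_, ?_⟩
  · have hi : IntervalIntegrable (fun s => (A s *ᵥ x s + B s *ᵥ u s) i) volume t₀ t₁ :=
      ⟨(Integrable.eval hint.1 i), (Integrable.eval hint.2 i)⟩
    have h1 := (absolutelyContinuousOnInterval_const (x t₀ i) t₀ t₁).fun_add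
      (hi.absolutelyContinuousOnInterval_intervalIntegral (c := t₀) (by simp))
    have h2 : Set.EqOn (fun t => x t₀ i + ∫ s in t₀..t, (A s *ᵥ x s + B s *ᵥ u s) i)
        (fun t => (x t₀ + ∫ s in t₀..t, (A s *ᵥ x s + B s *ᵥ u s)) i) (Set.uIcc t₀ t₁) := by
      intro t ht
      have hint' := hint.mono_set (Set.uIcc_subset_uIcc_left ht)
      have := (ContinuousLinearMap.proj (R := ℝ) (φ := fun _ : Fin n => ℝ)
        i).intervalIntegral_comp_comm hint'
      simpa using this
    -- Absolute continuity on an interval only involves values at points of that interval, so it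
    -- transfers along the equality `h2`.
    rw [absolutelyContinuousOnInterval_iff] at h1 ⊢
    intro ε hε
    obtain ⟨δ, hδ, hh⟩ := h1 ε hε
    refine ⟨δ, hδ, fun E hE hlt => ?_⟩
    have h3 := hh E hE hlt
    convert h3 using 1
    refine Finset.sum_congr rfl fun k hk => ?_
    exact (congrArg₂ dist (h2 (hE.1 k hk).1) (h2 (hE.1 k hk).2)).symm
  · filter_upwards [hint.ae_hasDerivAt_integral] with t ht hmem
    exact (ht hmem t₀ (by simp)).const_add (x t₀)

theorem IsTrajectory.mono (hx : IsTrajectory A B t₀ t₁ x u) {t : ℝ} (ht : t ≤ t₁) :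
    IsTrajectory A B t₀ t x u where
  control := hx.control.mono_measure (Measure.restrict_mono (Set.Icc_subset_Icc_right ht) le_rfl)
  continuous := hx.continuous.mono (Set.Icc_subset_Icc_right ht)
  ode s hs := hx.ode s ⟨hs.1, hs.2.trans ht⟩

theorem isTrajectory_of_hasDerivAt (hA : Continuous A) (hB : Continuous B) (hu : Continuous u)
    {y : ℝ → Fin n → ℝ} (hy : ∀ t, HasDerivAt y (A t *ᵥ y t + B t *ᵥ u t) t)
    (hxy : ∀ t ∈ Set.Icc t₀ t₁, x t = y t) (h : t₀ ≤ t₁) : IsTrajectory A B t₀ t₁ x u where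
  control := memLp_pi_of_continuousOn hu.continuousOn
  continuous := (hasDerivAt_continuous hy).continuousOn.congr hxy
  ode t ht := by
    have hc : Continuous y := hasDerivAt_continuous hy
    have h1 : ∫ s in t₀..t, (A s *ᵥ x s + B s *ᵥ u s) =
        ∫ s in t₀..t, (A s *ᵥ y s + B s *ᵥ u s) := by
      refine intervalIntegral.integral_congr fun s hs => ?_
      rw [Set.uIcc_of_le ht.1] at hs
      simp only [hxy s ⟨hs.1, hs.2.trans ht.2⟩]
    rw [h1, hxy t ht, hxy t₀ ⟨le_rfl, h⟩, intervalIntegral.integral_eq_sub_of_hasDerivAt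
      (fun s _ => hy s) (Continuous.intervalIntegrable (by fun_prop) _ _)]
    abel

end Trajectories

/-! ### Completion of the square and comparison of costs. -/

section Optimality

open MeasureTheory

variable {n m : ℕ} {A : ℝ → Matrix (Fin n) (Fin n) ℝ} {B : ℝ → Matrix (Fin n) (Fin m) ℝ}
  {Q : ℝ → Matrix (Fin n) (Fin n) ℝ} {S : ℝ → Matrix (Fin n) (Fin m) ℝ}
  {R : ℝ → Matrix (Fin m) (Fin m) ℝ} {P : ℝ → Matrix (Fin n) (Fin n) ℝ}
  {t₀ t₁ : ℝ} {x y : ℝ → Fin n → ℝ} {u v : ℝ → Fin m → ℝ}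

/-- The optimal gain `R⁻¹ (Sᵀ + Bᵀ P)`. -/
def riccatiGain (B : ℝ → Matrix (Fin n) (Fin m) ℝ) (S : ℝ → Matrix (Fin n) (Fin m) ℝ)
    (R : ℝ → Matrix (Fin m) (Fin m) ℝ) (P : ℝ → Matrix (Fin n) (Fin n) ℝ) (t : ℝ) :
    Matrix (Fin m) (Fin n) ℝ :=
  (R t)⁻¹ * ((S t)ᵀ + (B t)ᵀ * P t)

theorem closedLoop_eq (t : ℝ) :
    closedLoop A B S R P t = A t - B t * riccatiGain B S R P t := by
  simp only [closedLoop, riccatiGain, Matrix.mul_assoc]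

theorem mulVec_dotProduct {p q : ℕ} (M : Matrix (Fin p) (Fin q) ℝ) (x : Fin q → ℝ)
    (y : Fin p → ℝ) : (M *ᵥ x) ⬝ᵥ y = x ⬝ᵥ (Mᵀ *ᵥ y) := by
  rw [dotProduct_comm, Matrix.dotProduct_mulVec, ← Matrix.mulVec_transpose, dotProduct_comm]

theorem posDef_mul_inv {p : ℕ} {M : Matrix (Fin p) (Fin p) ℝ} (h : M.PosDef) : M * M⁻¹ = 1 :=
  Matrix.mul_nonsing_inv _ ((Matrix.isUnit_iff_isUnit_det _).1 h.isUnit)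

theorem posDef_inv_mul {p : ℕ} {M : Matrix (Fin p) (Fin p) ℝ} (h : M.PosDef) : M⁻¹ * M = 1 :=
  Matrix.nonsing_inv_mul _ ((Matrix.isUnit_iff_isUnit_det _).1 h.isUnit)

theorem posDef_isSymm {p : ℕ} {M : Matrix (Fin p) (Fin p) ℝ} (h : M.PosDef) : M.IsSymm := by
  have := h.isHermitian
  rwa [Matrix.IsHermitian, Matrix.conjTranspose_eq_transpose_of_trivial] at this

/-- Completion of the square. -/
theorem quadCost_eq_sub {t : ℝ} (hR : (R t).PosDef) (hP : (P t).IsSymm)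
    (x : Fin n → ℝ) (u : Fin m → ℝ) :
    quadCost Q S R t x u =
      (u + riccatiGain B S R P t *ᵥ x) ⬝ᵥ (R t *ᵥ (u + riccatiGain B S R P t *ᵥ x)) -
      ((A t *ᵥ x + B t *ᵥ u) ⬝ᵥ (P t *ᵥ x) +
        x ⬝ᵥ ((-(P t * A t) - (A t)ᵀ * P t
          + (P t * B t + S t) * (R t)⁻¹ * ((B t)ᵀ * P t + (S t)ᵀ) - Q t) *ᵥ x +
          P t *ᵥ (A t *ᵥ x + B t *ᵥ u))) := by
  have hRK : R t * riccatiGain B S R P t = (B t)ᵀ * P t + (S t)ᵀ := by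
    rw [riccatiGain, ← Matrix.mul_assoc, posDef_mul_inv hR, Matrix.one_mul, add_comm]
  have hKT : (riccatiGain B S R P t)ᵀ = (P t * B t + S t) * (R t)⁻¹ := by
    rw [riccatiGain, Matrix.transpose_mul, Matrix.transpose_nonsing_inv, (posDef_isSymm hR).eq,
      Matrix.transpose_add, Matrix.transpose_mul, hP.eq, Matrix.transpose_transpose,
      Matrix.transpose_transpose, add_comm]
  set k := riccatiGain B S R P t
  have e1 : u ⬝ᵥ (R t *ᵥ (k *ᵥ x)) = x ⬝ᵥ ((P t * B t) *ᵥ u) + x ⬝ᵥ (S t *ᵥ u) := by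
    rw [Matrix.mulVec_mulVec, hRK, dotProduct_comm, mulVec_dotProduct, Matrix.transpose_add,
      Matrix.transpose_mul, Matrix.transpose_transpose, Matrix.transpose_transpose, hP.eq,
      Matrix.add_mulVec, dotProduct_add]
  have e2 : (k *ᵥ x) ⬝ᵥ (R t *ᵥ u) = u ⬝ᵥ (R t *ᵥ (k *ᵥ x)) := by
    rw [dotProduct_comm, mulVec_dotProduct, (posDef_isSymm hR).eq]
  have e3 : (k *ᵥ x) ⬝ᵥ (R t *ᵥ (k *ᵥ x)) =
      x ⬝ᵥ (((P t * B t + S t) * (R t)⁻¹ * ((B t)ᵀ * P t + (S t)ᵀ)) *ᵥ x) := by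
    rw [mulVec_dotProduct, Matrix.mulVec_mulVec, Matrix.mulVec_mulVec, Matrix.mul_assoc kᵀ, hRK,
      hKT, Matrix.mul_assoc]
  have e4 : (A t *ᵥ x) ⬝ᵥ (P t *ᵥ x) = x ⬝ᵥ (((A t)ᵀ * P t) *ᵥ x) := by
    rw [mulVec_dotProduct, Matrix.mulVec_mulVec]
  have e5 : (B t *ᵥ u) ⬝ᵥ (P t *ᵥ x) = x ⬝ᵥ ((P t * B t) *ᵥ u) := by
    rw [dotProduct_comm, mulVec_dotProduct, hP.eq, Matrix.mulVec_mulVec]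
  simp only [quadCost, add_dotProduct, dotProduct_add, Matrix.mulVec_add, Matrix.add_mulVec,
    Matrix.sub_mulVec, Matrix.neg_mulVec, dotProduct_sub, dotProduct_neg, e1, e2, e3, e4, e5]
  simp only [Matrix.mulVec_mulVec, Matrix.add_mul, Matrix.mul_add, Matrix.add_mulVec, dotProduct_add]
  ring

theorem IsRiccatiSolution.continuous (hP : IsRiccatiSolution A B Q S R P) : Continuous P :=
  hasDerivAt_continuous fun t => (hP t).2

theorem IsRiccatiSolution.contDiff_one (hA : Continuous A) (hB : Continuous B) (hQ : Continuous Q)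
    (hS : Continuous S) (hR : Continuous R) (hRpos : ∀ t, (R t).PosDef)
    (hP : IsRiccatiSolution A B Q S R P) : ContDiff ℝ 1 P := by
  rw [contDiff_one_iff_deriv]
  refine ⟨fun t => (hP t).2.differentiableAt, ?_⟩
  have h1 : deriv P = _ := funext fun t => (hP t).2.deriv
  rw [h1]
  have := hP.continuous
  have := continuous_matInv hR fun t => (hRpos t).isUnit
  fun_prop

theorem continuous_riccatiGain (hB : Continuous B) (hS : Continuous S) (hR : Continuous R)
    (hRpos : ∀ t, (R t).PosDef) (hP : Continuous P) : Continuous (riccatiGain B S R P) := by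
  have := continuous_matInv hR fun t => (hRpos t).isUnit
  unfold riccatiGain
  fun_prop

theorem continuous_closedLoop (hA : Continuous A) (hB : Continuous B) (hS : Continuous S)
    (hR : Continuous R) (hRpos : ∀ t, (R t).PosDef) (hP : Continuous P) :
    Continuous (closedLoop A B S R P) := by
  have h1 := continuous_riccatiGain hB hS hR hRpos hP
  have h2 : closedLoop A B S R P = fun t => A t - B t * riccatiGain B S R P t :=
    funext closedLoop_eq
  rw [h2]
  fun_prop

theorem memLp_riccatiControl (hB : Continuous B) (hS : Continuous S) (hR : Continuous R)
    (hRpos : ∀ t, (R t).PosDef) (hP : Continuous P) (hx : IsTrajectory A B t₀ t₁ x u) :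
    MemLp (fun t => u t + riccatiGain B S R P t *ᵥ x t) 2 (volume.restrict (Set.Icc t₀ t₁)) :=
  hx.control.add (memLp_mulVec (continuous_riccatiGain hB hS hR hRpos hP)
    (memLp_pi_of_continuousOn hx.continuous))

/-- The integrated completion of the square: minimizing with fixed end points becomes minimizing the
weighted L² norm of u + kx, where k is the Riccati gain. -/
theorem integralCost_eq (hA : Continuous A) (hB : Continuous B) (hQ : Continuous Q)
    (hS : Continuous S) (hR : Continuous R) (hRpos : ∀ t, (R t).PosDef)
    (hP : IsRiccatiSolution A B Q S R P) (h : t₀ ≤ t₁) (hx : IsTrajectory A B t₀ t₁ x u) :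
    integralCost (quadCost Q S R) t₀ t₁ x u =
      (∫ t in t₀..t₁, (u t + riccatiGain B S R P t *ᵥ x t) ⬝ᵥ
        (R t *ᵥ (u t + riccatiGain B S R P t *ᵥ x t))) -
      (x t₁ ⬝ᵥ (P t₁ *ᵥ x t₁) - x t₀ ⬝ᵥ (P t₀ *ᵥ x t₀)) := by
  obtain ⟨y, hyx, hyac, hyd⟩ := hx.exists_absolutelyContinuous hA hB h
  set f : ℝ → ℝ := fun t => ((A t *ᵥ x t + B t *ᵥ u t) ⬝ᵥ (P t *ᵥ x t) +
        x t ⬝ᵥ ((-(P t * A t) - (A t)ᵀ * P t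
          + (P t * B t + S t) * (R t)⁻¹ * ((B t)ᵀ * P t + (S t)ᵀ) - Q t) *ᵥ x t +
          P t *ᵥ (A t *ᵥ x t + B t *ᵥ u t))) with hf
  have hac := absolutelyContinuousOnInterval_dotProduct_mulVec hyac
    (hP.contDiff_one hA hB hQ hS hR hRpos) hyac
  have hfd : ∀ᵐ t, t ∈ Set.uIcc t₀ t₁ →
      HasDerivAt (fun t => y t ⬝ᵥ (P t *ᵥ y t)) (f t) t := by
    filter_upwards [hyd] with t ht hmem
    have h1 := HasDerivAt.dotProduct' (ht hmem) (HasDerivAt.mulVec (hP t).2 (ht hmem))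
    rwa [hyx t (by rwa [Set.uIcc_of_le h] at hmem)] at h1
  have h1 := integral_eq_sub_of_absolutelyContinuous hac hfd
  rw [hyx t₁ ⟨h, le_rfl⟩, hyx t₀ ⟨le_rfl, h⟩] at h1
  have hxL := memLp_pi_of_continuousOn hx.continuous
  have hPc := hP.continuous
  have hRi := continuous_matInv hR fun t => (hRpos t).isUnit
  have hfint : IntervalIntegrable f volume t₀ t₁ := by
    have hL : MemLp (fun t => A t *ᵥ x t + B t *ᵥ u t) 2 (volume.restrict (Set.Icc t₀ t₁)) :=
      (memLp_mulVec hA hxL).add (memLp_mulVec hB hx.control)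
    refine (intervalIntegrable_dotProduct h hL (memLp_mulVec hPc hxL)).add
      (intervalIntegrable_dotProduct h hxL ((memLp_mulVec ?_ hxL).add (memLp_mulVec hPc hL)))
    fun_prop
  have hv := memLp_riccatiControl hB hS hR hRpos hPc hx
  rw [← h1, ← intervalIntegral.integral_sub
    (intervalIntegrable_dotProduct h hv (memLp_mulVec hR hv)) hfint]
  exact intervalIntegral.integral_congr fun t _ => quadCost_eq_sub (hRpos t) (hP t).1 _ _

/-- Variation of constants for Φ_F(0,t)x(t), tested against η. Fixing the end points is thus a
linear constraint on u + Kx, for which η plays the role of a Lagrange multiplier. -/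
theorem integral_pulledInput {K : ℝ → Matrix (Fin m) (Fin n) ℝ} {F : ℝ → Matrix (Fin n) (Fin n) ℝ}
    (hA : Continuous A) (hB : Continuous B) (hF : Continuous F)
    (hFK : ∀ t, F t = A t - B t * K t) (h : t₀ ≤ t₁)
    (hx : IsTrajectory A B t₀ t₁ x u) (η : Fin n → ℝ) :
    ∫ t in t₀..t₁, η ⬝ᵥ (pulledInput F B t *ᵥ (u t + K t *ᵥ x t)) =
      η ⬝ᵥ (transitionMatrix F 0 t₁ *ᵥ x t₁) - η ⬝ᵥ (transitionMatrix F 0 t₀ *ᵥ x t₀) := by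
  obtain ⟨y, hyx, hyac, hyd⟩ := hx.exists_absolutelyContinuous hA hB h
  have hd := hasDerivAt_transitionMatrix_right hF 0
  have hC1 : ContDiff ℝ 1 fun t => transitionMatrix F 0 t := by
    rw [contDiff_one_iff_deriv]
    refine ⟨fun t => (hd t).differentiableAt, ?_⟩
    have h1 : deriv (fun t => transitionMatrix F 0 t) = _ := funext fun t => (hd t).deriv
    rw [h1]
    have := continuous_transitionMatrix_right hF 0
    fun_prop
  have hac := absolutelyContinuousOnInterval_dotProduct_mulVec (y := fun _ => η)
    (fun i => absolutelyContinuousOnInterval_const (η i) t₀ t₁) hC1 hyac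
  have h1 := integral_eq_sub_of_absolutelyContinuous hac
    (g' := fun t => η ⬝ᵥ (pulledInput F B t *ᵥ (u t + K t *ᵥ x t))) (by
      filter_upwards [hyd] with t ht hmem
      have h1 := HasDerivAt.dotProduct' (hasDerivAt_const t η)
        (HasDerivAt.mulVec (hd t) (ht hmem))
      rw [hyx t (by rwa [Set.uIcc_of_le h] at hmem)] at h1
      convert h1 using 1
      simp only [zero_dotProduct, zero_add, pulledInput, hFK t, Matrix.mul_sub, Matrix.neg_mulVec,
        Matrix.sub_mulVec, Matrix.mulVec_add, Matrix.mulVec_mulVec, Matrix.mul_assoc]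
      congr 1
      abel)
  rw [h1, hyx t₁ ⟨h, le_rfl⟩, hyx t₀ ⟨le_rfl, h⟩]

/-- The cost of a competitor in terms of the cost of an extremal. -/
theorem integralCost_eq_add (hA : Continuous A) (hB : Continuous B) (hQ : Continuous Q)
    (hS : Continuous S) (hR : Continuous R) (hRpos : ∀ t, (R t).PosDef)
    (hP : IsRiccatiSolution A B Q S R P) (h : t₀ ≤ t₁)
    (hx : IsTrajectory A B t₀ t₁ x u) (hy : IsTrajectory A B t₀ t₁ y v) (η : Fin n → ℝ)
    (hext : ∀ t ∈ Set.Icc t₀ t₁, R t *ᵥ (u t + riccatiGain B S R P t *ᵥ x t) =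
      (pulledInput (closedLoop A B S R P) B t)ᵀ *ᵥ η)
    (h₀ : y t₀ = x t₀) (h₁ : y t₁ = x t₁) :
    integralCost (quadCost Q S R) t₀ t₁ y v = integralCost (quadCost Q S R) t₀ t₁ x u +
      ∫ t in t₀..t₁, (v t + riccatiGain B S R P t *ᵥ y t - (u t + riccatiGain B S R P t *ᵥ x t)) ⬝ᵥ
        (R t *ᵥ (v t + riccatiGain B S R P t *ᵥ y t -
          (u t + riccatiGain B S R P t *ᵥ x t))) := by
  rw [integralCost_eq hA hB hQ hS hR hRpos hP h hx, integralCost_eq hA hB hQ hS hR hRpos hP h hy,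
    h₀, h₁]
  have hF := continuous_closedLoop hA hB hS hR hRpos hP.continuous
  have hvx := memLp_riccatiControl hB hS hR hRpos hP.continuous hx
  have hvy := memLp_riccatiControl hB hS hR hRpos hP.continuous hy
  have e1 := integral_pulledInput hA hB hF closedLoop_eq h hx η
  have e2 := integral_pulledInput hA hB hF closedLoop_eq h hy η
  rw [h₀, h₁, ← e1] at e2
  set a := fun t => u t + riccatiGain B S R P t *ᵥ x t with ha
  set b := fun t => v t + riccatiGain B S R P t *ᵥ y t with hb
  have hη : MemLp (fun _ : ℝ => η) 2 (volume.restrict (Set.Icc t₀ t₁)) :=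
    memLp_pi_of_continuousOn continuousOn_const
  have hpc := continuous_pulledInput hF hB
  have i1 := intervalIntegrable_dotProduct h hη (memLp_mulVec hpc hvx)
  have i2 := intervalIntegrable_dotProduct h hη (memLp_mulVec hpc hvy)
  have i3 := intervalIntegrable_dotProduct h hvx (memLp_mulVec hR hvx)
  have i4 := intervalIntegrable_dotProduct h hvy (memLp_mulVec hR hvy)
  have i5 : IntervalIntegrable (fun t => (b t - a t) ⬝ᵥ (R t *ᵥ (b t - a t))) volume t₀ t₁ :=
    intervalIntegrable_dotProduct h (hvy.sub hvx) (memLp_mulVec hR (hvy.sub hvx))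
  -- Expand the square about `a`. By the extremality relation the cross term is the constraint
  -- functional at `b − a`, whose integral vanishes because the end points agree.
  have key : ∫ t in t₀..t₁, b t ⬝ᵥ (R t *ᵥ b t) =
      ∫ t in t₀..t₁, (a t ⬝ᵥ (R t *ᵥ a t) + (b t - a t) ⬝ᵥ (R t *ᵥ (b t - a t)) +
        2 * (η ⬝ᵥ (pulledInput (closedLoop A B S R P) B t *ᵥ b t) -
          η ⬝ᵥ (pulledInput (closedLoop A B S R P) B t *ᵥ a t))) := by
    refine intervalIntegral.integral_congr fun t ht => ?_
    rw [Set.uIcc_of_le h] at ht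
    have s1 : ∀ w, η ⬝ᵥ (pulledInput (closedLoop A B S R P) B t *ᵥ w) = w ⬝ᵥ (R t *ᵥ a t) := by
      intro w
      rw [ha, hext t ht, dotProduct_comm, mulVec_dotProduct]
    have s2 : a t ⬝ᵥ (R t *ᵥ b t) = b t ⬝ᵥ (R t *ᵥ a t) := by
      rw [dotProduct_comm, mulVec_dotProduct, (posDef_isSymm (hRpos t)).eq]
    simp only [s1, Matrix.mulVec_sub, dotProduct_sub, sub_dotProduct, s2]
    ring
  have key2 : ∫ t in t₀..t₁, (η ⬝ᵥ (pulledInput (closedLoop A B S R P) B t *ᵥ b t) -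
          η ⬝ᵥ (pulledInput (closedLoop A B S R P) B t *ᵥ a t)) = 0 := by
    rw [intervalIntegral.integral_sub i2 i1, sub_eq_zero]
    exact e2
  rw [key, intervalIntegral.integral_add (i3.add i5) ((i2.sub i1).const_mul 2),
    intervalIntegral.integral_add i3 i5, intervalIntegral.integral_const_mul, key2]
  ring

end Optimality

/-! ### Optimal trajectories are the extremal arcs. -/

section Extremals

open MeasureTheory

variable {n m : ℕ} {A : ℝ → Matrix (Fin n) (Fin n) ℝ} {B : ℝ → Matrix (Fin n) (Fin m) ℝ}
  {Q : ℝ → Matrix (Fin n) (Fin n) ℝ} {S : ℝ → Matrix (Fin n) (Fin m) ℝ}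
  {R : ℝ → Matrix (Fin m) (Fin m) ℝ} {P : ℝ → Matrix (Fin n) (Fin n) ℝ}
  {t₀ t₁ : ℝ} {x : ℝ → Fin n → ℝ}

/-- Projections on the state space of the solutions of the Hamiltonian system. -/
def extremalArc (F : ℝ → Matrix (Fin n) (Fin n) ℝ) (B : ℝ → Matrix (Fin n) (Fin m) ℝ)
    (Z : ℝ → Matrix (Fin m) (Fin m) ℝ) (z η : Fin n → ℝ) (t : ℝ) : Fin n → ℝ :=
  transitionMatrix F t 0 *ᵥ (z + gramian F B Z t *ᵥ η)

theorem hasDerivAt_extremalArc {F : ℝ → Matrix (Fin n) (Fin n) ℝ}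
    {Z : ℝ → Matrix (Fin m) (Fin m) ℝ} (hF : Continuous F) (hB : Continuous B)
    (hZ : Continuous Z) (z η : Fin n → ℝ) (t : ℝ) :
    HasDerivAt (extremalArc F B Z z η)
      (F t *ᵥ extremalArc F B Z z η t + B t *ᵥ (Z t *ᵥ ((pulledInput F B t)ᵀ *ᵥ η))) t := by
  have h1 := HasDerivAt.mulVec (hasDerivAt_transitionMatrix hF t 0)
    ((HasDerivAt.mulVec_const (hasDerivAt_gramian hF hB hZ t) η).const_add z)
  have h2 : transitionMatrix F t 0 * pulledInput F B t = B t := by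
    rw [pulledInput, ← Matrix.mul_assoc, transitionMatrix_mul hF, transitionMatrix_self hF,
      Matrix.one_mul]
  have h3 : transitionMatrix F t 0 *ᵥ ((pulledInput F B t * Z t * (pulledInput F B t)ᵀ) *ᵥ η) =
      B t *ᵥ (Z t *ᵥ ((pulledInput F B t)ᵀ *ᵥ η)) := by
    simp only [Matrix.mulVec_mulVec]
    rw [← Matrix.mul_assoc, ← Matrix.mul_assoc, h2, Matrix.mul_assoc]
  rw [h3, ← Matrix.mulVec_mulVec] at h1
  exact h1

theorem exists_control_extremalArc (hA : Continuous A) (hB : Continuous B)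
    (hS : Continuous S) (hR : Continuous R) (hRpos : ∀ t, (R t).PosDef)
    (hP : Continuous P) (h : t₀ ≤ t₁) (z η : Fin n → ℝ)
    (hx : ∀ t ∈ Set.Icc t₀ t₁,
      x t = extremalArc (closedLoop A B S R P) B (fun t => (R t)⁻¹) z η t) :
    ∃ u, IsTrajectory A B t₀ t₁ x u ∧ ∀ t ∈ Set.Icc t₀ t₁,
      R t *ᵥ (u t + riccatiGain B S R P t *ᵥ x t) =
        (pulledInput (closedLoop A B S R P) B t)ᵀ *ᵥ η := by
  have hF := continuous_closedLoop hA hB hS hR hRpos hP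
  have hRi := continuous_matInv hR fun t => (hRpos t).isUnit
  have hK := continuous_riccatiGain hB hS hR hRpos hP
  have hd := hasDerivAt_extremalArc hF hB hRi z η
  have hyc := hasDerivAt_continuous hd
  have hpc := continuous_pulledInput hF hB
  set y := extremalArc (closedLoop A B S R P) B (fun t => (R t)⁻¹) z η
  -- The feedback is evaluated on `y` rather than `x`: they agree on [t₀,t₁], but only `y` is
  -- continuous on the whole line.
  refine ⟨fun t => (R t)⁻¹ *ᵥ ((pulledInput (closedLoop A B S R P) B t)ᵀ *ᵥ η) -
    riccatiGain B S R P t *ᵥ y t, isTrajectory_of_hasDerivAt hA hB (by fun_prop) (fun t => ?_)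
      hx h, fun t ht => ?_⟩
  · convert hd t using 1
    rw [closedLoop_eq, Matrix.mulVec_sub, Matrix.sub_mulVec, ← Matrix.mulVec_mulVec]
    abel
  · rw [hx t ht, sub_add_cancel, Matrix.mulVec_mulVec, posDef_mul_inv (hRpos t), Matrix.one_mulVec]

/-- The optimal synthesis consists of the projections of the solutions of the Hamiltonian
system. -/
theorem mem_optimalSynthesis_iff (hAB : DynamicsAssumption A B) (hQ : Continuous Q)
    (hS : Continuous S) (hR : Continuous R) (hRpos : ∀ t, (R t).PosDef)
    (hP : IsRiccatiSolution A B Q S R P) :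
    (t₀, t₁, x) ∈ optimalSynthesis A B (quadCost Q S R) ↔ t₀ < t₁ ∧ ∃ z η, ∀ t ∈ Set.Icc t₀ t₁,
      x t = extremalArc (closedLoop A B S R P) B (fun t => (R t)⁻¹) z η t := by
  have hA := hAB.smooth_A.continuous
  have hB := hAB.smooth_B.continuous
  have hPc := hP.continuous
  have hF := continuous_closedLoop hA hB hS hR hRpos hPc
  have hRi := continuous_matInv hR fun t => (hRpos t).isUnit
  set F := closedLoop A B S R P with hFdef
  constructor
  · rintro ⟨hlt, u, hu, hopt⟩
    simp only at hlt hu hopt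
    refine ⟨hlt, ?_⟩
    have hG := isUnit_gramian_sub hAB (K := riccatiGain B S R P) closedLoop_eq hF hRi
      (fun t => (hRpos t).inv) hlt
    set J := gramian F B (fun t => (R t)⁻¹)
    -- `η` and `z` are chosen so that the extremal arc has the end points of `x`; this two-point
    -- problem is solvable because the Gramian over [t₀,t₁] is invertible.
    set η := (J t₁ - J t₀)⁻¹ *ᵥ
      (transitionMatrix F 0 t₁ *ᵥ x t₁ - transitionMatrix F 0 t₀ *ᵥ x t₀) with hη
    set z := transitionMatrix F 0 t₀ *ᵥ x t₀ - J t₀ *ᵥ η with hz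
    refine ⟨z, η, ?_⟩
    set y := extremalArc F B (fun t => (R t)⁻¹) z η with hy
    obtain ⟨v, hv, hext⟩ := exists_control_extremalArc (x := y) hA hB hS hR hRpos hPc hlt.le z η
      (fun t _ => rfl)
    have hcancel : ∀ t, transitionMatrix F t 0 *ᵥ (transitionMatrix F 0 t *ᵥ x t) = x t := by
      intro t
      rw [Matrix.mulVec_mulVec, transitionMatrix_mul hF, transitionMatrix_self hF,
        Matrix.one_mulVec]
    have h0 : y t₀ = x t₀ := by
      rw [hy, extremalArc, hz, sub_add_cancel, hcancel]
    have h1 : y t₁ = x t₁ := by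
      have e1 : (J t₁ - J t₀) *ᵥ η =
          transitionMatrix F 0 t₁ *ᵥ x t₁ - transitionMatrix F 0 t₀ *ᵥ x t₀ := by
        rw [hη, Matrix.mulVec_mulVec, Matrix.mul_nonsing_inv _
          ((Matrix.isUnit_iff_isUnit_det _).1 hG), Matrix.one_mulVec]
      have e2 : z + J t₁ *ᵥ η = transitionMatrix F 0 t₁ *ᵥ x t₁ := by
        rw [Matrix.sub_mulVec] at e1
        rw [hz, sub_add_eq_add_sub, add_sub_assoc, e1]
        abel
      rw [hy, extremalArc, e2, hcancel]
    have hle := hopt y v hv h0 h1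
    -- The minimizer exceeds the extremal by the integral of wᵀRw ≥ 0, yet costs no more; hence w =
    -- 0 almost everywhere.
    rw [integralCost_eq_add hA hB hQ hS hR hRpos hP hlt.le hv hu η hext h0.symm h1.symm] at hle
    have hvx := memLp_riccatiControl hB hS hR hRpos hPc hu
    have hvy := memLp_riccatiControl hB hS hR hRpos hPc hv
    set w := fun t => u t + riccatiGain B S R P t *ᵥ x t - (v t + riccatiGain B S R P t *ᵥ y t)
      with hw
    have hwL : MemLp w 2 (volume.restrict (Set.Icc t₀ t₁)) := hvx.sub hvy
    have hnn : ∀ t, 0 ≤ w t ⬝ᵥ (R t *ᵥ w t) := fun t =>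
      (hRpos t).posSemidef.dotProduct_mulVec_nonneg _
    have hzero : ∫ t in t₀..t₁, w t ⬝ᵥ (R t *ᵥ w t) = 0 :=
      le_antisymm (by linarith) (intervalIntegral.integral_nonneg hlt.le fun t _ => hnn t)
    rw [intervalIntegral.integral_eq_zero_iff_of_le_of_nonneg_ae hlt.le
      (Filter.Eventually.of_forall hnn)
      (intervalIntegrable_dotProduct hlt.le hwL (memLp_mulVec hR hwL))] at hzero
    have hw0 : ∀ᵐ t, t ∈ Set.Ioc t₀ t₁ → w t = 0 := by
      rw [Filter.EventuallyEq, ae_restrict_iff' measurableSet_Ioc] at hzero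
      filter_upwards [hzero] with t ht hmem
      by_contra hne
      exact ((hRpos t).dotProduct_mulVec_pos hne).ne' (ht hmem)
    intro t ht
    -- Equality of u + kx and v + ky almost everywhere gives equality of the states at every t, by
    -- variation of constants on [t₀,t].
    have key : ∀ ξ, ξ ⬝ᵥ (transitionMatrix F 0 t *ᵥ x t) = ξ ⬝ᵥ (transitionMatrix F 0 t *ᵥ y t) := by
      intro ξ
      have i1 := integral_pulledInput hA hB hF (closedLoop_eq (A := A)) ht.1 (hu.mono ht.2) ξ
      have i2 := integral_pulledInput hA hB hF (closedLoop_eq (A := A)) ht.1 (hv.mono ht.2) ξ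
      rw [h0] at i2
      have i3 : ∫ s in t₀..t, ξ ⬝ᵥ (pulledInput F B s *ᵥ (u s + riccatiGain B S R P s *ᵥ x s)) =
          ∫ s in t₀..t, ξ ⬝ᵥ (pulledInput F B s *ᵥ (v s + riccatiGain B S R P s *ᵥ y s)) := by
        refine intervalIntegral.integral_congr_ae ?_
        filter_upwards [hw0] with s hs hmem
        rw [Set.uIoc_of_le ht.1] at hmem
        rw [sub_eq_zero.1 (hs ⟨hmem.1, hmem.2.trans ht.2⟩)]
      rw [i1, i2] at i3
      linarith
    have key2 : transitionMatrix F 0 t *ᵥ x t = transitionMatrix F 0 t *ᵥ y t :=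
      dotProduct_eq _ _ fun ξ => by rw [dotProduct_comm, key ξ, dotProduct_comm]
    have := congrArg (transitionMatrix F t 0 *ᵥ ·) key2
    simpa only [Matrix.mulVec_mulVec, transitionMatrix_mul hF, transitionMatrix_self hF,
      Matrix.one_mulVec] using this
  · rintro ⟨hlt, z, η, hx⟩
    obtain ⟨u, hu, hext⟩ := exists_control_extremalArc hA hB hS hR hRpos hPc hlt.le z η hx
    refine ⟨hlt, u, hu, fun y v hv h0 h1 => ?_⟩
    simp only at h0 h1 hv ⊢
    rw [integralCost_eq_add hA hB hQ hS hR hRpos hP hlt.le hu hv η hext h0 h1]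
    have := intervalIntegral.integral_nonneg (μ := volume) hlt.le
      (f := fun t => (v t + riccatiGain B S R P t *ᵥ y t - (u t + riccatiGain B S R P t *ᵥ x t)) ⬝ᵥ
        (R t *ᵥ (v t + riccatiGain B S R P t *ᵥ y t - (u t + riccatiGain B S R P t *ᵥ x t))))
      fun t _ => (hRpos t).posSemidef.dotProduct_mulVec_nonneg _
    linarith

end Extremals

/-! ### The stabilizing and antistabilizing Riccati solutions. -/

section RiccatiPair

open Filter Topology

variable {n m : ℕ} {A : ℝ → Matrix (Fin n) (Fin n) ℝ} {B : ℝ → Matrix (Fin n) (Fin m) ℝ}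
  {Q : ℝ → Matrix (Fin n) (Fin n) ℝ} {S : ℝ → Matrix (Fin n) (Fin m) ℝ}
  {R : ℝ → Matrix (Fin m) (Fin m) ℝ} {P P' : ℝ → Matrix (Fin n) (Fin n) ℝ}
  {F G : ℝ → Matrix (Fin n) (Fin n) ℝ}

theorem IsExpStable.tendsto_atTop (hF : IsExpStable F) :
    Tendsto (fun t => transitionMatrix F t 0) atTop (𝓝 0) := by
  obtain ⟨α, hα, β, hβ, h⟩ := hF
  have h1 : Tendsto (fun t => α * Real.exp (-β * (t - 0))) atTop (𝓝 (α * 0)) := by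
    refine (Real.tendsto_exp_atBot.comp ?_).const_mul α
    simpa using tendsto_id.const_mul_atTop_of_neg (neg_lt_zero.2 hβ)
  rw [mul_zero] at h1
  refine squeeze_zero_norm' ?_ h1
  filter_upwards [eventually_ge_atTop 0] with t ht using h 0 t ht

theorem IsExpStable.tendsto_atBot (hF : IsExpStable F) :
    Tendsto (fun t => transitionMatrix F 0 t) atBot (𝓝 0) := by
  obtain ⟨α, hα, β, hβ, h⟩ := hF
  have h1 : Tendsto (fun t => α * Real.exp (-β * (0 - t))) atBot (𝓝 (α * 0)) := by
    refine (Real.tendsto_exp_atBot.comp ?_).const_mul α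
    simpa using tendsto_id.const_mul_atBot hβ
  rw [mul_zero] at h1
  refine squeeze_zero_norm' ?_ h1
  filter_upwards [eventually_le_atBot 0] with t ht using h t 0 ht

theorem IsExpAntiStable.tendsto_atBot (hF : IsExpAntiStable F) :
    Tendsto (fun t => transitionMatrix F t 0) atBot (𝓝 0) := by
  obtain ⟨α, hα, β, hβ, h⟩ := hF
  have h1 : Tendsto (fun t => α * Real.exp (β * (t - 0))) atBot (𝓝 (α * 0)) := by
    refine (Real.tendsto_exp_atBot.comp ?_).const_mul α
    simpa using tendsto_id.const_mul_atBot hβ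
  rw [mul_zero] at h1
  refine squeeze_zero_norm' ?_ h1
  filter_upwards [eventually_le_atBot 0] with t ht using h 0 t ht

theorem IsExpAntiStable.tendsto_atTop (hF : IsExpAntiStable F) :
    Tendsto (fun t => transitionMatrix F 0 t) atTop (𝓝 0) := by
  obtain ⟨α, hα, β, hβ, h⟩ := hF
  have h1 : Tendsto (fun t => α * Real.exp (β * (0 - t))) atTop (𝓝 (α * 0)) := by
    refine (Real.tendsto_exp_atBot.comp ?_).const_mul α
    simpa using tendsto_id.const_mul_atTop_of_neg (neg_lt_zero.2 hβ)
  rw [mul_zero] at h1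
  refine squeeze_zero_norm' ?_ h1
  filter_upwards [eventually_ge_atTop 0] with t ht using h t 0 ht

/-- The quadratic terms factor, leaving a linear Sylvester equation with the two closed loops acting
on opposite sides. -/
theorem hasDerivAt_riccati_sub (hRpos : ∀ t, (R t).PosDef) (hP : IsRiccatiSolution A B Q S R P)
    (hP' : IsRiccatiSolution A B Q S R P') (t : ℝ) :
    HasDerivAt (fun t => P t - P' t)
      (-((closedLoop A B S R P t)ᵀ * (P t - P' t)) -
        (P t - P' t) * closedLoop A B S R P' t) t := by
  refine HasDerivAt.congr_deriv ((hP t).2.fun_sub (hP' t).2) ?_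
  simp only [closedLoop, Matrix.transpose_sub, Matrix.transpose_mul, Matrix.transpose_add,
    Matrix.transpose_transpose, (hP t).1.eq, Matrix.transpose_nonsing_inv,
    (posDef_isSymm (hRpos t)).eq, Matrix.mul_sub, Matrix.sub_mul, Matrix.mul_add, Matrix.add_mul,
    Matrix.mul_assoc]
  abel

theorem closedLoop_sub (t : ℝ) :
    closedLoop A B S R P' t - closedLoop A B S R P t =
      B t * (R t)⁻¹ * (B t)ᵀ * (P t - P' t) := by
  simp only [closedLoop, Matrix.mul_sub, Matrix.mul_add, Matrix.mul_assoc]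
  abel

/-- The Sylvester equation integrated: Φ_F(t,0)ᵀ(P − P')Φ_G(t,0) is constant, with F and G the
closed loops of P and P'. -/
theorem riccati_sub_mul_transitionMatrix (hF : Continuous (closedLoop A B S R P))
    (hG : Continuous (closedLoop A B S R P')) (hRpos : ∀ t, (R t).PosDef)
    (hP : IsRiccatiSolution A B Q S R P) (hP' : IsRiccatiSolution A B Q S R P') (t : ℝ) :
    (P t - P' t) * transitionMatrix (closedLoop A B S R P') t 0 =
      (transitionMatrix (closedLoop A B S R P) 0 t)ᵀ * (P 0 - P' 0) := by
  have hd : ∀ t, HasDerivAt (fun t => (transitionMatrix (closedLoop A B S R P) t 0)ᵀ *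
      ((P t - P' t) * transitionMatrix (closedLoop A B S R P') t 0)) 0 t := fun t => by
    convert HasDerivAt.matMul (HasDerivAt.matTranspose (hasDerivAt_transitionMatrix hF t 0))
      (HasDerivAt.matMul (hasDerivAt_riccati_sub hRpos hP hP' t)
        (hasDerivAt_transitionMatrix hG t 0)) using 1
    simp only [Matrix.transpose_mul, Matrix.sub_mul, Matrix.neg_mul, Matrix.mul_assoc,
      Matrix.mul_sub, Matrix.mul_neg, Matrix.mul_add]
    abel
  have h1 := eq_of_hasDerivAt_eq hd (fun t => hasDerivAt_const t (P 0 - P' 0)) (a := 0)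
    (by simp [transitionMatrix_self hF, transitionMatrix_self hG]) t
  rw [← h1, ← Matrix.mul_assoc, ← Matrix.transpose_mul, transitionMatrix_mul hF,
    transitionMatrix_self hF, Matrix.transpose_one, Matrix.one_mul]

/-- The flow of `G` when `G - F = B Z Bᵀ M` with `M(t) Φ_G(t,0) = Φ_F(0,t)ᵀ E`. -/
theorem transitionMatrix_eq_mul_gramian {Z : ℝ → Matrix (Fin m) (Fin m) ℝ}
    {E : Matrix (Fin n) (Fin n) ℝ} (hF : Continuous F)
    (hG : Continuous G) (hB : Continuous B) (hZ : Continuous Z)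
    (h : ∀ t, (G t - F t) * transitionMatrix G t 0 =
      B t * Z t * (B t)ᵀ * ((transitionMatrix F 0 t)ᵀ * E)) (t : ℝ) :
    transitionMatrix G t 0 = transitionMatrix F t 0 * (1 + gramian F B Z t * E) := by
  have h1 : ∀ t, HasDerivAt (fun t => transitionMatrix F 0 t * transitionMatrix G t 0)
      (pulledInput F B t * Z t * (pulledInput F B t)ᵀ * E) t := fun t => by
    convert HasDerivAt.matMul (hasDerivAt_transitionMatrix_right hF 0 t)
      (hasDerivAt_transitionMatrix hG t 0) using 1
    have e : transitionMatrix F 0 t * ((G t - F t) * transitionMatrix G t 0) =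
        pulledInput F B t * Z t * (pulledInput F B t)ᵀ * E := by
      rw [h]
      simp only [pulledInput, Matrix.transpose_mul, Matrix.mul_assoc]
    rw [← e]
    simp only [Matrix.sub_mul, Matrix.neg_mul, Matrix.mul_sub, Matrix.mul_assoc]
    abel
  have h2 : ∀ t, HasDerivAt (fun t => 1 + gramian F B Z t * E)
      (pulledInput F B t * Z t * (pulledInput F B t)ᵀ * E) t := fun t =>
    (HasDerivAt.matMul_const (hasDerivAt_gramian hF hB hZ t) E).const_add 1
  rw [← eq_of_hasDerivAt_eq h1 h2 (a := 0)
    (by simp [transitionMatrix_self hF, transitionMatrix_self hG]) t, ← Matrix.mul_assoc,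
    transitionMatrix_mul hF, transitionMatrix_self hF, Matrix.one_mul]

theorem transitionMatrix_closedLoop_eq (hF : Continuous (closedLoop A B S R P))
    (hG : Continuous (closedLoop A B S R P')) (hB : Continuous B) (hR : Continuous R)
    (hRpos : ∀ t, (R t).PosDef)
    (hP : IsRiccatiSolution A B Q S R P) (hP' : IsRiccatiSolution A B Q S R P') (t : ℝ) :
    transitionMatrix (closedLoop A B S R P') t 0 = transitionMatrix (closedLoop A B S R P) t 0 *
      (1 + gramian (closedLoop A B S R P) B (fun t => (R t)⁻¹) t * (P 0 - P' 0)) := by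
  refine transitionMatrix_eq_mul_gramian hF hG hB
    (continuous_matInv hR fun t => (hRpos t).isUnit) (fun t => ?_) t
  rw [closedLoop_sub, Matrix.mul_assoc, riccati_sub_mul_transitionMatrix hF hG hRpos hP hP']

/-- On a kernel vector v the two flows coincide, so v = Φ_G(0,t)Φ_F(t,0)v; both factors tend to 0 at
+∞. -/
theorem isUnit_riccati_sub (hF : Continuous (closedLoop A B S R P))
    (hG : Continuous (closedLoop A B S R P')) (hB : Continuous B) (hR : Continuous R)
    (hRpos : ∀ t, (R t).PosDef)
    (hP : IsRiccatiSolution A B Q S R P) (hP' : IsRiccatiSolution A B Q S R P')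
    (hst : IsExpStable (closedLoop A B S R P)) (hanti : IsExpAntiStable (closedLoop A B S R P')) :
    IsUnit (P 0 - P' 0) := by
  rw [Matrix.isUnit_iff_isUnit_det, isUnit_iff_ne_zero]
  intro hdet
  obtain ⟨v, hv, hv0⟩ := Matrix.exists_mulVec_eq_zero_iff.2 hdet
  apply hv
  have h1 : ∀ t, (transitionMatrix (closedLoop A B S R P') 0 t *
      transitionMatrix (closedLoop A B S R P) t 0) *ᵥ v = v := by
    intro t
    have h2 : transitionMatrix (closedLoop A B S R P') t 0 *ᵥ v =
        transitionMatrix (closedLoop A B S R P) t 0 *ᵥ v := by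
      rw [transitionMatrix_closedLoop_eq hF hG hB hR hRpos hP hP', ← Matrix.mulVec_mulVec,
        Matrix.add_mulVec, ← Matrix.mulVec_mulVec, hv0, Matrix.mulVec_zero, add_zero,
        Matrix.one_mulVec]
    rw [← Matrix.mulVec_mulVec, ← h2, Matrix.mulVec_mulVec, transitionMatrix_mul hG,
      transitionMatrix_self hG, Matrix.one_mulVec]
  have h3 := hanti.tendsto_atTop.mul hst.tendsto_atTop
  have h4 : Tendsto (fun t => (transitionMatrix (closedLoop A B S R P') 0 t *
      transitionMatrix (closedLoop A B S R P) t 0) *ᵥ v) atTop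
      (𝓝 ((0 * 0 : Matrix (Fin n) (Fin n) ℝ) *ᵥ v)) :=
    ((continuous_id.matrix_mulVec continuous_const).tendsto _).comp h3
  simp only [h1, mul_zero, Matrix.zero_mulVec] at h4
  exact tendsto_nhds_unique tendsto_const_nhds h4

/-- The optimal synthesis in terms of the pair describing it. -/
theorem mem_optimalSynthesis_iff_of_pair (hAB : DynamicsAssumption A B) (hQ : Continuous Q)
    (hS : Continuous S) (hR : Continuous R) (hRpos : ∀ t, (R t).PosDef)
    (hpair : IsSynthesisPair A B Q S R F G) {t₀ t₁ : ℝ} {x : ℝ → Fin n → ℝ} :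
    (t₀, t₁, x) ∈ optimalSynthesis A B (quadCost Q S R) ↔ t₀ < t₁ ∧ ∃ a b, ∀ t ∈ Set.Icc t₀ t₁,
      x t = transitionMatrix F t 0 *ᵥ a + transitionMatrix G t 0 *ᵥ b := by
  obtain ⟨⟨P, hP, rfl, hst⟩, ⟨P', hP', rfl, hanti⟩⟩ := hpair
  have hA := hAB.smooth_A.continuous
  have hB := hAB.smooth_B.continuous
  have hF := continuous_closedLoop hA hB hS hR hRpos hP.continuous
  have hG := continuous_closedLoop hA hB hS hR hRpos hP'.continuous
  have hD := (Matrix.isUnit_iff_isUnit_det _).1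
    (isUnit_riccati_sub hF hG hB hR hRpos hP hP' hst hanti)
  -- The parameters correspond by z = a + b, η = Db with D = P(0) − P'(0), a bijection since D is
  -- invertible.
  have key : ∀ a b t, transitionMatrix (closedLoop A B S R P) t 0 *ᵥ a +
      transitionMatrix (closedLoop A B S R P') t 0 *ᵥ b =
      extremalArc (closedLoop A B S R P) B (fun t => (R t)⁻¹) (a + b) ((P 0 - P' 0) *ᵥ b) t := by
    intro a b t
    rw [transitionMatrix_closedLoop_eq hF hG hB hR hRpos hP hP', extremalArc,
      ← Matrix.mulVec_mulVec, ← Matrix.mulVec_add, Matrix.add_mulVec, Matrix.one_mulVec,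
      ← Matrix.mulVec_mulVec, add_assoc]
  rw [mem_optimalSynthesis_iff hAB hQ hS hR hRpos hP]
  refine and_congr_right fun _ => ⟨?_, ?_⟩
  · rintro ⟨z, η, hx⟩
    refine ⟨z - (P 0 - P' 0)⁻¹ *ᵥ η, (P 0 - P' 0)⁻¹ *ᵥ η, fun t ht => ?_⟩
    rw [hx t ht, key, sub_add_cancel, Matrix.mulVec_mulVec, Matrix.mul_nonsing_inv _ hD,
      Matrix.one_mulVec]
  · rintro ⟨a, b, hx⟩
    exact ⟨a + b, (P 0 - P' 0) *ᵥ b, fun t ht => by rw [hx t ht, key]⟩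

end RiccatiPair

/-! ### Pairs described by canonical costs, and the reconstruction equation. -/

section CanonicalPair

open Filter Topology

variable {n m : ℕ} {A : ℝ → Matrix (Fin n) (Fin n) ℝ} {B : ℝ → Matrix (Fin n) (Fin m) ℝ}
  {K : ℝ → Matrix (Fin m) (Fin n) ℝ} {R : ℝ → Matrix (Fin m) (Fin m) ℝ}
  {F G : ℝ → Matrix (Fin n) (Fin n) ℝ} {Z Z₀ : ℝ → Matrix (Fin m) (Fin m) ℝ}
  {E : Matrix (Fin n) (Fin n) ℝ}

theorem transitionMatrix_mul_cancel (hF : Continuous F) (t s : ℝ) {p : ℕ}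
    (M : Matrix (Fin n) (Fin p) ℝ) :
    transitionMatrix F t s * (transitionMatrix F s t * M) = M := by
  rw [← Matrix.mul_assoc, transitionMatrix_mul hF, transitionMatrix_self hF, Matrix.one_mul]

theorem transitionMatrix_transpose_mul_cancel (hF : Continuous F) (t s : ℝ) {p : ℕ}
    (M : Matrix (Fin n) (Fin p) ℝ) :
    (transitionMatrix F s t)ᵀ * ((transitionMatrix F t s)ᵀ * M) = M := by
  rw [← Matrix.mul_assoc, ← Matrix.transpose_mul, transitionMatrix_mul hF,
    transitionMatrix_self hF, Matrix.transpose_one, Matrix.one_mul]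

/-- Translates the integral of the reconstruction equation into the Gramian based at time 0. -/
theorem mul_gramian_transpose (hF : Continuous F) (hB : Continuous B) (hZ : Continuous Z)
    (t : ℝ) : transitionMatrix F t 0 * gramian F B Z t * (transitionMatrix F t 0)ᵀ =
      ∫ s in (0 : ℝ)..t, transitionMatrix F t s * B s * Z s * (B s)ᵀ *
        (transitionMatrix F t s)ᵀ := by
  have hc := continuous_pulledInput hF hB
  have h1 := map_intervalIntegral (f := fun s => pulledInput F B s * Z s * (pulledInput F B s)ᵀ)
    (by fun_prop) ((LinearMap.mulRight ℝ (transitionMatrix F t 0)ᵀ).comp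
      (LinearMap.mulLeft ℝ (transitionMatrix F t 0))) 0 t
  simp only [LinearMap.comp_apply, LinearMap.mulRight_apply, LinearMap.mulLeft_apply] at h1
  rw [gramian, h1]
  refine intervalIntegral.integral_congr fun s _ => ?_
  simp only [pulledInput, ← transitionMatrix_mul hF t 0 s, Matrix.transpose_mul, Matrix.mul_assoc]

/-- Differentiated form of `Φ_G(t,0) = Φ_F(t,0) (1 + J(t) E)`. -/
theorem sub_mul_transitionMatrix_of_eq (hF : Continuous F) (hG : Continuous G) (hB : Continuous B)
    (hZ : Continuous Z) (h : ∀ t, transitionMatrix G t 0 =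
      transitionMatrix F t 0 * (1 + gramian F B Z t * E)) (t : ℝ) :
    (G t - F t) * transitionMatrix G t 0 =
      B t * Z t * (B t)ᵀ * ((transitionMatrix F 0 t)ᵀ * E) := by
  have h1 := HasDerivAt.matMul (hasDerivAt_transitionMatrix hF t 0)
    ((HasDerivAt.matMul_const (hasDerivAt_gramian hF hB hZ t) E).const_add 1)
  have h2 := hasDerivAt_transitionMatrix hG t 0
  have e : (fun t => transitionMatrix G t 0) =
      fun t => transitionMatrix F t 0 * (1 + gramian F B Z t * E) := funext h
  rw [← e] at h1
  have h3 := h2.unique h1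
  rw [Matrix.sub_mul, h3, h t]
  simp only [pulledInput, Matrix.transpose_mul, Matrix.mul_assoc,
    transitionMatrix_mul_cancel hF]
  abel

/-- Put X = Φ_F(0,t)Φ_G(t,0) = 1 + JE. As J is symmetric, XᵀE − EᵀX equals E − Eᵀ for all t, while X
tends to 0 at −∞. -/
theorem transpose_eq_of_transitionMatrix_eq (hF : Continuous F) (hB : Continuous B)
    (hZ : Continuous Z) (hs : ∀ t, (Z t).IsSymm) (hst : IsExpStable F) (hanti : IsExpAntiStable G)
    (h : ∀ t, transitionMatrix G t 0 =
      transitionMatrix F t 0 * (1 + gramian F B Z t * E)) : Eᵀ = E := by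
  have hX : ∀ t, transitionMatrix F 0 t * transitionMatrix G t 0 = 1 + gramian F B Z t * E :=
    fun t => by rw [h, transitionMatrix_mul_cancel hF]
  have hlim : Tendsto (fun t => transitionMatrix F 0 t * transitionMatrix G t 0) atBot
      (𝓝 (0 * 0)) := hst.tendsto_atBot.mul hanti.tendsto_atBot
  have hc : Continuous fun X : Matrix (Fin n) (Fin n) ℝ => Xᵀ * E - Eᵀ * X := by fun_prop
  have h2 := (hc.tendsto _).comp hlim
  have h3 : ((fun X : Matrix (Fin n) (Fin n) ℝ => Xᵀ * E - Eᵀ * X) ∘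
      fun t => transitionMatrix F 0 t * transitionMatrix G t 0) = fun _ => E - Eᵀ := by
    funext t
    simp only [Function.comp, hX, Matrix.transpose_add, Matrix.transpose_mul,
      gramian_transpose hF hB hZ hs, Matrix.transpose_one, Matrix.add_mul, Matrix.mul_add,
      Matrix.one_mul, Matrix.mul_one, Matrix.mul_assoc]
    abel
  rw [h3] at h2
  have h4 := tendsto_nhds_unique tendsto_const_nhds h2
  simp only [mul_zero, Matrix.transpose_zero, zero_mul, sub_zero] at h4
  exact (sub_eq_zero.1 h4).symm

theorem closedLoop_feedback {P : ℝ → Matrix (Fin n) (Fin n) ℝ} (hR : ∀ t, (R t).PosDef) (t : ℝ) :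
    closedLoop A B (fun t => (K t)ᵀ * R t) R P t =
      A t - B t * K t - B t * (R t)⁻¹ * (B t)ᵀ * P t := by
  have h : B t * (R t)⁻¹ * ((K t)ᵀ * R t)ᵀ = B t * K t := by
    rw [Matrix.transpose_mul, Matrix.transpose_transpose, (posDef_isSymm (hR t)).eq,
      Matrix.mul_assoc, ← Matrix.mul_assoc _ (R t), posDef_inv_mul (hR t), Matrix.one_mul]
  rw [closedLoop, Matrix.mul_add, h, Matrix.mul_assoc _ (B t)ᵀ]
  abel

/-- For Q = KᵀRK and S = KᵀR the constant term cancels, so the Riccati equation becomes homogeneous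
and P = 0 solves it. -/
theorem riccati_feedback {P : Matrix (Fin n) (Fin n) ℝ} (hR : ∀ t, (R t).PosDef) (t : ℝ) :
    -(P * A t) - (A t)ᵀ * P + (P * B t + (K t)ᵀ * R t) * (R t)⁻¹ *
      ((B t)ᵀ * P + ((K t)ᵀ * R t)ᵀ) - (K t)ᵀ * R t * K t =
      -((A t - B t * K t)ᵀ * P) - P * (A t - B t * K t) + P * B t * (R t)⁻¹ * (B t)ᵀ * P := by
  have h1 : (P * B t + (K t)ᵀ * R t) * (R t)⁻¹ = P * B t * (R t)⁻¹ + (K t)ᵀ := by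
    rw [Matrix.add_mul, Matrix.mul_assoc (K t)ᵀ, posDef_mul_inv (hR t), Matrix.mul_one]
  have h2 : ((K t)ᵀ * R t)ᵀ = R t * K t := by
    rw [Matrix.transpose_mul, Matrix.transpose_transpose, (posDef_isSymm (hR t)).eq]
  have h3 : P * B t * (R t)⁻¹ * (R t * K t) = P * B t * K t := by
    rw [Matrix.mul_assoc, ← Matrix.mul_assoc _ (R t), posDef_inv_mul (hR t), Matrix.one_mul]
  rw [h1, h2, Matrix.add_mul, Matrix.mul_add, Matrix.mul_add, h3]
  simp only [Matrix.transpose_sub, Matrix.transpose_mul, Matrix.sub_mul, Matrix.mul_sub,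
    Matrix.mul_assoc]
  abel

theorem isRiccatiSolution_zero (hR : ∀ t, (R t).PosDef) :
    IsRiccatiSolution A B (fun t => (K t)ᵀ * R t * K t) (fun t => (K t)ᵀ * R t) R
      (fun _ => 0) := by
  intro t
  refine ⟨Matrix.isSymm_zero, ?_⟩
  have h := riccati_feedback (A := A) (B := B) (K := K) (P := 0) hR t
  beta_reduce
  rw [h]
  simpa using hasDerivAt_const t (0 : Matrix (Fin n) (Fin n) ℝ)

/-- Construction of the antistabilizing solution for a canonical cost. -/
theorem isSynthesisPair_feedback (hF : Continuous F) (hG : Continuous G) (hB : Continuous B)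
    (hR : Continuous R) (hRpos : ∀ t, (R t).PosDef) (hFK : ∀ t, F t = A t - B t * K t)
    (hst : IsExpStable F) (hanti : IsExpAntiStable G)
    (h : ∀ t, transitionMatrix G t 0 =
      transitionMatrix F t 0 * (1 + gramian F B (fun t => (R t)⁻¹) t * E)) :
    IsSynthesisPair A B (fun t => (K t)ᵀ * R t * K t) (fun t => (K t)ᵀ * R t) R F G := by
  have hZ := continuous_matInv hR fun t => (hRpos t).isUnit
  have hs : ∀ t, ((R t)⁻¹).IsSymm := fun t => posDef_isSymm (hRpos t).inv
  refine ⟨⟨fun _ => 0, isRiccatiSolution_zero hRpos, ?_, hst⟩, ?_⟩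
  · funext t
    rw [closedLoop_feedback hRpos, hFK]
    simp
  have hE := transpose_eq_of_transitionMatrix_eq hF hB hZ hs hst hanti h
  have hX : ∀ t, transitionMatrix F 0 t * transitionMatrix G t 0 =
      1 + gramian F B (fun t => (R t)⁻¹) t * E :=
    fun t => by rw [h, transitionMatrix_mul_cancel hF]
  -- `M` is read off from the derivative of Φ_G = Φ_F(1 + JE), which gives G − F = BR⁻¹BᵀM. As the
  -- stabilizing solution is 0, the antistabilizing one must be −M.
  set M := fun t => (transitionMatrix F 0 t)ᵀ * E * transitionMatrix G 0 t with hM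
  have hMG : ∀ t, G t - F t = B t * (R t)⁻¹ * (B t)ᵀ * M t := by
    intro t
    have h1 := congrArg (· * transitionMatrix G 0 t) (sub_mul_transitionMatrix_of_eq hF hG hB hZ h t)
    simp only [Matrix.mul_assoc, transitionMatrix_mul hG, transitionMatrix_self hG,
      Matrix.mul_one] at h1
    rw [h1, hM]
    simp only [Matrix.mul_assoc]
  have hMsymm : ∀ t, (M t)ᵀ = M t := by
    intro t
    -- `M` is congruent to XᵀE with X = 1 + JE, and XᵀE is symmetric because E and J are.
    have e : M t = (transitionMatrix G 0 t)ᵀ *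
        ((transitionMatrix F 0 t * transitionMatrix G t 0)ᵀ * E) * transitionMatrix G 0 t := by
      rw [Matrix.transpose_mul, Matrix.mul_assoc (transitionMatrix G t 0)ᵀ,
        transitionMatrix_transpose_mul_cancel hG]
    have e2 : ((transitionMatrix F 0 t * transitionMatrix G t 0)ᵀ * E)ᵀ =
        (transitionMatrix F 0 t * transitionMatrix G t 0)ᵀ * E := by
      rw [hX]
      simp only [Matrix.transpose_add, Matrix.transpose_mul, Matrix.transpose_one,
        gramian_transpose hF hB hZ hs, hE, Matrix.add_mul, Matrix.one_mul, Matrix.mul_assoc]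
    rw [e, Matrix.transpose_mul, Matrix.transpose_mul, e2, Matrix.transpose_transpose]
    exact (Matrix.mul_assoc _ _ _).symm
  have hMd : ∀ t, HasDerivAt M (-((F t)ᵀ * M t) - M t * G t) t := by
    intro t
    refine HasDerivAt.congr_deriv (HasDerivAt.matMul (HasDerivAt.matMul_const
      (HasDerivAt.matTranspose (hasDerivAt_transitionMatrix_right hF 0 t)) E)
      (hasDerivAt_transitionMatrix_right hG 0 t)) ?_
    simp only [hM, Matrix.transpose_neg, Matrix.transpose_mul, Matrix.neg_mul, Matrix.mul_neg,
      Matrix.mul_assoc]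
    abel
  refine ⟨fun t => -M t, fun t => ⟨?_, ?_⟩, ?_, hanti⟩
  · rw [Matrix.IsSymm, Matrix.transpose_neg, hMsymm]
  · refine HasDerivAt.congr_deriv (hMd t).fun_neg ?_
    rw [riccati_feedback hRpos, ← hFK, show G t = F t + B t * (R t)⁻¹ * (B t)ᵀ * M t by
      rw [← hMG]; abel]
    simp only [Matrix.mul_neg, Matrix.neg_mul, Matrix.mul_add, Matrix.mul_assoc]
    abel
  · funext t
    rw [closedLoop_feedback hRpos, ← hFK, Matrix.mul_neg, ← hMG]
    abel

/-- The residual of the reconstruction equation in terms of Gramians. -/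
theorem reconstruction_residual (hF : Continuous F) (hG : Continuous G) (hB : Continuous B)
    (hZ : Continuous Z) (hZ₀ : Continuous Z₀) (hs : ∀ t, (Z₀ t).IsSymm) (hE : Eᵀ = E)
    (h : ∀ t, transitionMatrix G t 0 =
      transitionMatrix F t 0 * (1 + gramian F B Z₀ t * E)) (t : ℝ) :
    (G t - F t) * (∫ s in (0 : ℝ)..t, transitionMatrix F t s * B s * Z s * (B s)ᵀ *
        (transitionMatrix F t s)ᵀ) - B t * Z t * (B t)ᵀ *
        (1 - ((transitionMatrix G t 0)⁻¹)ᵀ * (transitionMatrix F t 0)ᵀ) =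
      B t * (Z₀ t * (pulledInput F B t)ᵀ *
        (E * (1 + gramian F B Z₀ t * E)⁻¹ * gramian F B Z t) -
        Z t * (pulledInput F B t)ᵀ *
        (E * (1 + gramian F B Z₀ t * E)⁻¹ * gramian F B Z₀ t)) * (transitionMatrix F t 0)ᵀ := by
  set J := gramian F B Z₀ t with hJ
  have hJt : Jᵀ = J := gramian_transpose hF hB hZ₀ hs t
  set X := 1 + J * E with hX
  have hXX : X * (transitionMatrix G 0 t * transitionMatrix F t 0) = 1 := by
    have : X = transitionMatrix F 0 t * transitionMatrix G t 0 := by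
      rw [h, transitionMatrix_mul_cancel hF]
    rw [this, Matrix.mul_assoc, transitionMatrix_mul_cancel hG, transitionMatrix_mul hF,
      transitionMatrix_self hF]
  have hXi : X⁻¹ = transitionMatrix G 0 t * transitionMatrix F t 0 := Matrix.inv_eq_right_inv hXX
  have hXm : X * X⁻¹ = 1 := by rw [hXi, hXX]
  have hGi : transitionMatrix G 0 t = X⁻¹ * transitionMatrix F 0 t := by
    rw [hXi, Matrix.mul_assoc, transitionMatrix_mul hF, transitionMatrix_self hF, Matrix.mul_one]
  have hGF : G t - F t = B t * Z₀ t * (B t)ᵀ * (transitionMatrix F 0 t)ᵀ * E *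
      (X⁻¹ * transitionMatrix F 0 t) := by
    have h1 := congrArg (· * transitionMatrix G 0 t)
      (sub_mul_transitionMatrix_of_eq hF hG hB hZ₀ h t)
    simp only [Matrix.mul_assoc, transitionMatrix_mul hG, transitionMatrix_self hG,
      Matrix.mul_one] at h1
    rw [h1, ← hGi]
    simp only [Matrix.mul_assoc]
  -- From XᵀE = EX. This identity gives the second term of the equation the same shape as the first,
  -- with the weights exchanged.
  have key : E * X⁻¹ * J = 1 - (X⁻¹)ᵀ := by
    have hXt : (X⁻¹)ᵀ * Xᵀ = 1 := by rw [← Matrix.transpose_mul, hXm, Matrix.transpose_one]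
    have h1 : Xᵀ * (E * X⁻¹ * J) = Xᵀ * 1 - 1 := by
      have : Xᵀ * E = E * X := by
        rw [hX]
        simp only [Matrix.transpose_add, Matrix.transpose_mul, hE, hJt, Matrix.transpose_one,
          Matrix.add_mul, Matrix.mul_add, Matrix.one_mul, Matrix.mul_one, Matrix.mul_assoc]
      rw [← Matrix.mul_assoc, ← Matrix.mul_assoc, this, Matrix.mul_assoc E, hXm, Matrix.mul_one,
        Matrix.mul_one, hX, Matrix.transpose_add, Matrix.transpose_mul, hE, hJt,
        Matrix.transpose_one]
      abel
    have h2 := congrArg ((X⁻¹)ᵀ * ·) h1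
    simpa only [← Matrix.mul_assoc, hXt, Matrix.mul_sub, Matrix.one_mul, Matrix.mul_one] using h2
  have hone : (transitionMatrix F 0 t)ᵀ * (transitionMatrix F t 0)ᵀ = 1 := by
    rw [← Matrix.transpose_mul, transitionMatrix_mul hF, transitionMatrix_self hF,
      Matrix.transpose_one]
  rw [← mul_gramian_transpose hF hB hZ, hGF, transitionMatrix_inv hG, hGi, key,
    Matrix.transpose_mul]
  simp only [pulledInput, Matrix.transpose_mul, Matrix.mul_sub, Matrix.sub_mul, Matrix.mul_assoc,
    transitionMatrix_mul_cancel hF, Matrix.mul_one, hone]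

end CanonicalPair

/-! ### Recovering the feedback and the flow of A₋ from the optimal synthesis. -/

section FromSynthesis

open Filter Topology

variable {n m : ℕ} {A : ℝ → Matrix (Fin n) (Fin n) ℝ} {B : ℝ → Matrix (Fin n) (Fin m) ℝ}
  {K : ℝ → Matrix (Fin m) (Fin n) ℝ} {R : ℝ → Matrix (Fin m) (Fin m) ℝ}
  {Q₀ : ℝ → Matrix (Fin n) (Fin n) ℝ} {S₀ : ℝ → Matrix (Fin n) (Fin m) ℝ}
  {R₀ : ℝ → Matrix (Fin m) (Fin m) ℝ}
  {F G : ℝ → Matrix (Fin n) (Fin n) ℝ} {Z : ℝ → Matrix (Fin m) (Fin m) ℝ}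

/-- The parameters found on [−T,T] might depend on T, but the values at times 0 and 1 determine them
since J(1) is invertible. -/
theorem eq_extremalArc_of_forall_Icc (hF : Continuous F) (hJ : IsUnit (gramian F B Z 1))
    {y : ℝ → Fin n → ℝ} (h : ∀ T > 0, ∃ z η, ∀ t ∈ Set.Icc (-T) T, y t = extremalArc F B Z z η t)
    (t : ℝ) : y t = extremalArc F B Z (y 0)
      ((gramian F B Z 1)⁻¹ *ᵥ (transitionMatrix F 0 1 *ᵥ y 1 - y 0)) t := by
  -- This radius makes the interval contain 0, 1 and t.
  have hT : 0 < max 1 |t| := by positivity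
  obtain ⟨z, η, hy⟩ := h (max 1 |t|) hT
  have h0 : y 0 = z := by
    rw [hy 0 ⟨by linarith, hT.le⟩]
    simp [extremalArc, transitionMatrix_self hF]
  have h1 : gramian F B Z 1 *ᵥ η = transitionMatrix F 0 1 *ᵥ y 1 - y 0 := by
    rw [hy 1 ⟨by linarith, le_max_left _ _⟩, h0, extremalArc, Matrix.mulVec_mulVec,
      transitionMatrix_mul hF, transitionMatrix_self hF, Matrix.one_mulVec]
    abel
  rw [← h1, Matrix.mulVec_mulVec, Matrix.nonsing_inv_mul _ ((Matrix.isUnit_iff_isUnit_det _).1 hJ),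
    Matrix.one_mulVec, h0]
  exact hy t ⟨by linarith [neg_abs_le t, le_max_right 1 |t|],
    (le_abs_self t).trans (le_max_right _ _)⟩

/-- A canonical cost with the synthesis described by `(F, G)` has `A - B K = F`, and its
Hamiltonian flow contains the flow of `G`. -/
theorem eq_feedback_of_optimalSynthesis_eq (hAB : DynamicsAssumption A B)
    (hQ₀ : Continuous Q₀) (hS₀ : Continuous S₀) (hR₀ : Continuous R₀)
    (hR₀pos : ∀ t, (R₀ t).PosDef) (hpair : IsSynthesisPair A B Q₀ S₀ R₀ F G)
    (hK : Continuous K) (hR : Continuous R) (hRpos : ∀ t, (R t).PosDef)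
    (hst : IsExpStable fun t => A t - B t * K t)
    (hΓ : optimalSynthesis A B (quadCost (fun t => (K t)ᵀ * R t * K t) (fun t => (K t)ᵀ * R t) R) =
      optimalSynthesis A B (quadCost Q₀ S₀ R₀)) :
    (F = fun t => A t - B t * K t) ∧ ∃ E, ∀ t, transitionMatrix G t 0 =
      transitionMatrix F t 0 * (1 + gramian F B (fun t => (R t)⁻¹) t * E) := by
  have hpair' := hpair
  obtain ⟨⟨P, hP, hFP, hstF⟩, ⟨P', hP', hGP, hanti⟩⟩ := hpair
  have hA := hAB.smooth_A.continuous
  have hB := hAB.smooth_B.continuous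
  have hF : Continuous F := hFP ▸ continuous_closedLoop hA hB hS₀ hR₀ hR₀pos hP.continuous
  have hG : Continuous G := hGP ▸ continuous_closedLoop hA hB hS₀ hR₀ hR₀pos hP'.continuous
  have hFK : ∀ t, F t = A t - B t * riccatiGain B S₀ R₀ P t := fun t => by
    rw [hFP, closedLoop_eq]
  have hC : Continuous fun t => A t - B t * K t := by fun_prop
  have hRi := continuous_matInv hR fun t => (hRpos t).isUnit
  have hR₀i := continuous_matInv hR₀ fun t => (hR₀pos t).isUnit
  have hclosed : closedLoop A B (fun t => (K t)ᵀ * R t) R (fun _ => 0) =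
      fun t => A t - B t * K t := by
    funext t
    rw [closedLoop_feedback hRpos]
    simp
  have hcan : ∀ t₀ t₁ x, (t₀, t₁, x) ∈ optimalSynthesis A B (quadCost Q₀ S₀ R₀) ↔ t₀ < t₁ ∧
      ∃ z η, ∀ t ∈ Set.Icc t₀ t₁,
        x t = extremalArc (fun t => A t - B t * K t) B (fun t => (R t)⁻¹) z η t := by
    intro t₀ t₁ x
    rw [← hΓ, mem_optimalSynthesis_iff hAB (by fun_prop) (by fun_prop) hR hRpos
      (isRiccatiSolution_zero hRpos), hclosed]
  have hflow := transitionMatrix_closedLoop_eq (hFP ▸ hF) (hGP ▸ hG) hB hR₀ hR₀pos hP hP'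
  rw [← hFP, ← hGP] at hflow
  have hD := (Matrix.isUnit_iff_isUnit_det _).1 (isUnit_riccati_sub (hFP ▸ hF) (hGP ▸ hG) hB hR₀
    hR₀pos hP hP' (hFP ▸ hstF) (hGP ▸ hanti))
  have hFC : F = fun t => A t - B t * K t := by
    refine eq_of_transitionMatrix_eq hF hC (τ := 0) fun t => ?_
    refine Matrix.ext_iff_mulVec.2 fun z => ?_
    set y := fun t => transitionMatrix (fun t => A t - B t * K t) t 0 *ᵥ z with hy
    have hy0 : y 0 = z := by simp [hy, transitionMatrix_self hC]
    have h1 := eq_extremalArc_of_forall_Icc (B := B) (Z := fun t => (R₀ t)⁻¹) hF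
      (isUnit_gramian hAB hFK hF hR₀i (fun t => (hR₀pos t).inv) one_ne_zero) (y := y)
      (fun T hT => by
        have h2 := (hcan (-T) T y).2 ⟨by linarith, z, 0, fun t _ => by simp [extremalArc, hy]⟩
        rw [mem_optimalSynthesis_iff hAB hQ₀ hS₀ hR₀ hR₀pos hP, ← hFP] at h2
        exact h2.2)
    set η := (gramian F B (fun t => (R₀ t)⁻¹) 1)⁻¹ *ᵥ (transitionMatrix F 0 1 *ᵥ y 1 - y 0)
    set b := (P 0 - P' 0)⁻¹ *ᵥ η with hb
    have hη : η = (P 0 - P' 0) *ᵥ b := by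
      rw [hb, Matrix.mulVec_mulVec, Matrix.mul_nonsing_inv _ hD, Matrix.one_mulVec]
    have h3 : ∀ t, y t = transitionMatrix F t 0 *ᵥ (z - b) + transitionMatrix G t 0 *ᵥ b := by
      intro t
      rw [h1 t, extremalArc, hflow, hy0, hη, ← Matrix.mulVec_mulVec, ← Matrix.mulVec_add,
        Matrix.add_mulVec, Matrix.one_mulVec, Matrix.mulVec_mulVec, ← add_assoc, sub_add_cancel]
    -- The G-component `b` is isolated and pulled back to time 0. At +∞ the pullback and both stable
    -- flows tend to 0, so `b` = 0.
    have h4 : ∀ t, transitionMatrix G 0 t *ᵥ (transitionMatrix (fun t => A t - B t * K t) t 0 *ᵥ z -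
        transitionMatrix F t 0 *ᵥ (z - b)) = b := by
      intro t
      have := h3 t
      simp only [hy] at this
      rw [this, add_sub_cancel_left, Matrix.mulVec_mulVec, transitionMatrix_mul hG,
        transitionMatrix_self hG, Matrix.one_mulVec]
    have l1 : Tendsto (fun t => transitionMatrix (fun t => A t - B t * K t) t 0 *ᵥ z -
        transitionMatrix F t 0 *ᵥ (z - b)) atTop
        (𝓝 ((0 : Matrix (Fin n) (Fin n) ℝ) *ᵥ z - (0 : Matrix (Fin n) (Fin n) ℝ) *ᵥ (z - b))) :=
      (((continuous_id.matrix_mulVec continuous_const).tendsto _).comp hst.tendsto_atTop).sub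
        (((continuous_id.matrix_mulVec continuous_const).tendsto _).comp hstF.tendsto_atTop)
    have l2 := ((continuous_fst.matrix_mulVec continuous_snd).tendsto _).comp
      (hanti.tendsto_atTop.prodMk_nhds l1)
    simp only [Function.comp_def, h4, Matrix.zero_mulVec] at l2
    have hb0 : b = 0 := tendsto_nhds_unique tendsto_const_nhds l2
    have := h3 t
    simpa [hb0, hy] using this.symm
  refine ⟨hFC, ?_⟩
  have hJ := isUnit_gramian hAB hFK hF hRi (fun t => (hRpos t).inv) one_ne_zero
  -- This value of E is forced by the identity at t = 1.
  refine ⟨(gramian F B (fun t => (R t)⁻¹) 1)⁻¹ * (transitionMatrix F 0 1 * transitionMatrix G 1 0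
    - 1), fun t => Matrix.ext_iff_mulVec.2 fun v => ?_⟩
  have h1 := eq_extremalArc_of_forall_Icc hF hJ (y := fun t => transitionMatrix G t 0 *ᵥ v)
    (fun T hT => by
      have h2 := (mem_optimalSynthesis_iff_of_pair hAB hQ₀ hS₀ hR₀ hR₀pos hpair'
        (t₀ := -T) (t₁ := T) (x := fun t => transitionMatrix G t 0 *ᵥ v)).2
        ⟨by linarith, 0, v, fun t _ => by simp⟩
      rw [hcan, ← hFC] at h2
      exact h2.2) t
  rw [h1, extremalArc, transitionMatrix_self hG, Matrix.one_mulVec, ← Matrix.mulVec_mulVec,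
    Matrix.add_mulVec, Matrix.one_mulVec, ← Matrix.mulVec_mulVec, ← Matrix.mulVec_mulVec,
    Matrix.sub_mulVec, Matrix.one_mulVec, Matrix.mulVec_mulVec v]

end FromSynthesis

/-! ### Smoothness of solutions of differential equations. -/

section Smoothness

/-- Bootstrapping of regularity for solutions of differential equations. -/
theorem contDiff_infty_of_bootstrap {E : Type*} [NormedAddCommGroup E] [NormedSpace ℝ E]
    {f f' : ℝ → E} (hd : ∀ t, HasDerivAt f (f' t) t)
    (h : ∀ k : ℕ, ContDiff ℝ k f → ContDiff ℝ k f') : ContDiff ℝ ∞ f := by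
  rw [contDiff_infty]
  intro k
  have h1 : deriv f = f' := funext fun t => (hd t).deriv
  induction k with
  | zero => exact contDiff_zero.2 (hasDerivAt_continuous hd)
  | succ k ih =>
    have := contDiff_succ_iff_deriv (𝕜 := ℝ) (f := f) (n := (k : ℕ∞ω))
    push_cast
    rw [this]
    -- The middle clause concerns only analytic regularity ω, which a natural number k never equals.
    refine ⟨fun t => (hd t).differentiableAt, fun hk => ?_, h1 ▸ h k ih⟩
    simp at hk

theorem contDiff_transitionMatrix_right {n : ℕ} {F : ℝ → Matrix (Fin n) (Fin n) ℝ}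
    (hF : ContDiff ℝ ∞ F) (t : ℝ) : ContDiff ℝ ∞ fun s => transitionMatrix F t s :=
  contDiff_infty_of_bootstrap (fun s => hasDerivAt_transitionMatrix_right hF.continuous t s)
    fun k hk => (ContDiff.matMul hk (hF.of_le (by exact_mod_cast le_top))).neg

end Smoothness

/-! ### The constant matrix relating two solutions of the reconstruction equation. -/

section Intertwiner

variable {n m : ℕ} {A : ℝ → Matrix (Fin n) (Fin n) ℝ} {B : ℝ → Matrix (Fin n) (Fin m) ℝ}
  {K : ℝ → Matrix (Fin m) (Fin n) ℝ} {F : ℝ → Matrix (Fin n) (Fin n) ℝ}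
  {Z Z₀ : ℝ → Matrix (Fin m) (Fin m) ℝ} {w : Matrix (Fin n) (Fin n) ℝ}

/-- If `J₀' Y⁻¹ J = J' Y⁻¹ J₀` with `Y = w + J₀`, then `J w⁻¹ J₀` is symmetric. -/
theorem gramian_mul_inv_mul_gramian_comm (hF : Continuous F) (hB : Continuous B)
    (hZ : Continuous Z) (hZ₀ : Continuous Z₀) (hZs : ∀ t, (Z t).IsSymm)
    (hZ₀s : ∀ t, (Z₀ t).IsSymm) (hw : wᵀ = w) (hwu : IsUnit w)
    (hY : ∀ t, IsUnit (w + gramian F B Z₀ t))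
    (heq : ∀ t, Z₀ t * (pulledInput F B t)ᵀ * ((w + gramian F B Z₀ t)⁻¹ * gramian F B Z t) =
      Z t * (pulledInput F B t)ᵀ * ((w + gramian F B Z₀ t)⁻¹ * gramian F B Z₀ t)) (t : ℝ) :
    gramian F B Z t * w⁻¹ * gramian F B Z₀ t = gramian F B Z₀ t * w⁻¹ * gramian F B Z t := by
  have hdet := fun t => (Matrix.isUnit_iff_isUnit_det _).1 (hY t)
  have hwdet := (Matrix.isUnit_iff_isUnit_det _).1 hwu
  have hJs := gramian_transpose hF hB hZ hZs
  have hJ₀s := gramian_transpose hF hB hZ₀ hZ₀s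
  have hYd : ∀ t, HasDerivAt (fun t => (w + gramian F B Z₀ t)⁻¹)
      (-((w + gramian F B Z₀ t)⁻¹ * (pulledInput F B t * Z₀ t * (pulledInput F B t)ᵀ) *
        (w + gramian F B Z₀ t)⁻¹)) t := fun t =>
    HasDerivAt.matInv ((hasDerivAt_gramian hF hB hZ₀ t).const_add w) (hY t)
  have hYs : ∀ t, ((w + gramian F B Z₀ t)⁻¹)ᵀ = (w + gramian F B Z₀ t)⁻¹ := fun t => by
    rw [Matrix.transpose_nonsing_inv, Matrix.transpose_add, hw, hJ₀s]
  have hws : (w⁻¹)ᵀ = w⁻¹ := by rw [Matrix.transpose_nonsing_inv, hw]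
  -- With Y = w + J₀, the hypothesis `heq` and 1 − Y⁻¹J₀ = Y⁻¹w reduce the derivative of Y⁻¹Jw⁻¹ to
  -- Y⁻¹J'Y⁻¹. That is symmetric, and Y⁻¹Jw⁻¹ vanishes at 0, so it is symmetric for all t.
  have hU : ∀ t, HasDerivAt (fun t => (w + gramian F B Z₀ t)⁻¹ * gramian F B Z t * w⁻¹)
      ((w + gramian F B Z₀ t)⁻¹ * (pulledInput F B t * Z t * (pulledInput F B t)ᵀ) *
        (w + gramian F B Z₀ t)⁻¹) t := fun t => by
    refine HasDerivAt.congr_deriv (HasDerivAt.matMul_const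
      (HasDerivAt.matMul (hYd t) (hasDerivAt_gramian hF hB hZ t)) w⁻¹) ?_
    have h1 := congrArg (pulledInput F B t * ·) (heq t)
    beta_reduce at h1
    set Yi := (w + gramian F B Z₀ t)⁻¹ with hYi
    set b := pulledInput F B t
    have h2 : 1 - Yi * gramian F B Z₀ t = Yi * w := by
      rw [sub_eq_iff_eq_add, ← Matrix.mul_add, hYi, Matrix.nonsing_inv_mul _ (hdet t)]
    have h3 : -(Yi * (b * Z₀ t * bᵀ) * Yi) * gramian F B Z t + Yi * (b * Z t * bᵀ) =
        Yi * (b * Z t * bᵀ) * (1 - Yi * gramian F B Z₀ t) := by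
      have h4 : Yi * (b * Z₀ t * bᵀ) * Yi * gramian F B Z t =
          Yi * (b * (Z₀ t * bᵀ * (Yi * gramian F B Z t))) := by
        simp only [Matrix.mul_assoc]
      rw [Matrix.neg_mul, h4, h1, Matrix.mul_sub, Matrix.mul_one]
      simp only [Matrix.mul_assoc]
      abel
    rw [h3, h2, Matrix.mul_assoc _ (Yi * w), Matrix.mul_assoc Yi w, Matrix.mul_nonsing_inv _ hwdet,
      Matrix.mul_one]
  have hUs := eq_of_hasDerivAt_eq (fun t => HasDerivAt.matTranspose (hU t))
    (fun t => (hU t).congr_deriv (by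
      simp only [Matrix.transpose_mul, hYs, Matrix.transpose_transpose, (hZs t).eq,
        Matrix.mul_assoc])) (a := 0) (by simp) t
  simp only [Matrix.transpose_mul, hYs, hJs, hws] at hUs
  -- Multiplying the symmetry by Y on both sides clears Y⁻¹; after expansion the terms J cancel and
  -- only the commutation relation remains.
  have h5 := congrArg (fun M => (w + gramian F B Z₀ t) * M * (w + gramian F B Z₀ t)) hUs
  have h6 : ∀ M : Matrix (Fin n) (Fin n) ℝ, M * ((w + gramian F B Z₀ t)⁻¹ *
      (w + gramian F B Z₀ t)) = M := fun M => by
    rw [Matrix.nonsing_inv_mul _ (hdet t), Matrix.mul_one]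
  have h7 : ∀ M : Matrix (Fin n) (Fin n) ℝ, (w + gramian F B Z₀ t) *
      ((w + gramian F B Z₀ t)⁻¹ * M) = M := fun M => by
    rw [← Matrix.mul_assoc, Matrix.mul_nonsing_inv _ (hdet t), Matrix.one_mul]
  simp only [Matrix.mul_assoc, h6, h7] at h5
  simp only [Matrix.add_mul, Matrix.mul_add, Matrix.nonsing_inv_mul _ hwdet, Matrix.mul_one] at h5
  rw [← Matrix.mul_assoc w, Matrix.mul_nonsing_inv _ hwdet, Matrix.one_mul] at h5
  simpa [Matrix.mul_assoc] using h5.symm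

/-- Away from `0`, the quotient of the Gramians intertwines the two weights. -/
theorem intertwines_gramian_quotient (hF : Continuous F) (hB : Continuous B)
    (hZ : Continuous Z) (hZ₀ : Continuous Z₀) (hZs : ∀ t, (Z t).IsSymm)
    (hZ₀s : ∀ t, (Z₀ t).IsSymm) (hw : wᵀ = w) (hwu : IsUnit w)
    (hY : ∀ t, IsUnit (w + gramian F B Z₀ t))
    (heq : ∀ t, Z₀ t * (pulledInput F B t)ᵀ * ((w + gramian F B Z₀ t)⁻¹ * gramian F B Z t) =
      Z t * (pulledInput F B t)ᵀ * ((w + gramian F B Z₀ t)⁻¹ * gramian F B Z₀ t)) {t : ℝ}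
    (hJ : IsUnit (gramian F B Z t)) :
    Z₀ t * (pulledInput F B t)ᵀ =
      Z t * (pulledInput F B t)ᵀ * ((gramian F B Z t)⁻¹ * gramian F B Z₀ t) := by
  have hc := gramian_mul_inv_mul_gramian_comm hF hB hZ hZ₀ hZs hZ₀s hw hwu hY heq t
  have hdet := (Matrix.isUnit_iff_isUnit_det _).1 (hY t)
  have hwdet := (Matrix.isUnit_iff_isUnit_det _).1 hwu
  have hJdet := (Matrix.isUnit_iff_isUnit_det _).1 hJ
  have he := heq t
  set J := gramian F B Z t
  set J₀ := gramian F B Z₀ t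
  -- J⁻¹J₀ is moved past w, then past Y = w + J₀, to write Y⁻¹J₀ = J⁻¹J₀ · Y⁻¹J. The invertible
  -- factor Y⁻¹J can then be cancelled from both sides of `he`.
  have c1 : w * (J⁻¹ * J₀) = J₀ * J⁻¹ * w := by
    have h1 := congrArg (fun M => w * (J⁻¹ * M * J⁻¹) * w) hc
    simp only [← Matrix.mul_assoc, Matrix.nonsing_inv_mul _ hJdet, Matrix.one_mul,
      Matrix.mul_nonsing_inv _ hwdet] at h1
    rw [Matrix.mul_assoc (w * J⁻¹ * J₀ * w⁻¹), Matrix.mul_nonsing_inv _ hJdet, Matrix.mul_one,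
      Matrix.mul_assoc _ w⁻¹, Matrix.nonsing_inv_mul _ hwdet, Matrix.mul_one] at h1
    rw [h1, ← Matrix.mul_assoc]
  have c2 : (w + J₀) * (J⁻¹ * J₀) = J₀ * J⁻¹ * (w + J₀) := by
    rw [Matrix.add_mul, c1, Matrix.mul_add, ← Matrix.mul_assoc J₀]
  have c3 : (w + J₀)⁻¹ * J₀ = J⁻¹ * J₀ * ((w + J₀)⁻¹ * J) := by
    have h1 := congrArg (fun M => (w + J₀)⁻¹ * M * (w + J₀)⁻¹ * J) c2
    simp only [← Matrix.mul_assoc, Matrix.nonsing_inv_mul _ hdet, Matrix.one_mul] at h1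
    rw [Matrix.mul_assoc _ (w + J₀), Matrix.mul_nonsing_inv _ hdet, Matrix.mul_one,
      Matrix.mul_assoc _ J⁻¹, Matrix.nonsing_inv_mul _ hJdet, Matrix.mul_one] at h1
    rw [← h1]
    simp only [Matrix.mul_assoc]
  rw [c3] at he
  have h2 := congrArg (fun M => M * J⁻¹ * (w + J₀)) he
  simp only [Matrix.mul_assoc, Matrix.mul_nonsing_inv_cancel_left _ _ hJdet,
    Matrix.nonsing_inv_mul _ hdet, Matrix.mul_one] at h2
  simpa only [Matrix.mul_assoc] using h2

/-- The solutions of the reconstruction equation are intertwined by a constant matrix. -/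
theorem exists_intertwiner (hAB : DynamicsAssumption A B) (hK : ContDiff ℝ ∞ K)
    (hFK : ∀ t, F t = A t - B t * K t) (hZ : ContDiff ℝ ∞ Z) (hZ₀ : ContDiff ℝ ∞ Z₀)
    (hZpos : ∀ t, (Z t).PosDef) (hZ₀pos : ∀ t, (Z₀ t).PosDef) (hw : wᵀ = w) (hwu : IsUnit w)
    (hY : ∀ t, IsUnit (w + gramian F B Z₀ t))
    (heq : ∀ t, Z₀ t * (pulledInput F B t)ᵀ * ((w + gramian F B Z₀ t)⁻¹ * gramian F B Z t) =
      Z t * (pulledInput F B t)ᵀ * ((w + gramian F B Z₀ t)⁻¹ * gramian F B Z₀ t)) :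
    ∃ N : Matrix (Fin n) (Fin n) ℝ, IsUnit N ∧
      ∀ t, Z₀ t * (pulledInput F B t)ᵀ = Z t * (pulledInput F B t)ᵀ * N := by
  have hFs : ContDiff ℝ ∞ F := by
    have h1 : F = fun t => A t - B t * K t := funext hFK
    rw [h1]
    exact hAB.smooth_A.sub (ContDiff.matMul hAB.smooth_B hK)
  have hF := hFs.continuous
  have hB := hAB.smooth_B.continuous
  have hJ : ∀ t, t ≠ 0 → IsUnit (gramian F B Z t) := fun t ht =>
    isUnit_gramian hAB hFK hF hZ.continuous hZpos ht
  have hint : ∀ t, t ≠ 0 → Z₀ t * (pulledInput F B t)ᵀ =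
      Z t * (pulledInput F B t)ᵀ * ((gramian F B Z t)⁻¹ * gramian F B Z₀ t) := fun t ht =>
    intertwines_gramian_quotient hF hB hZ.continuous hZ₀.continuous
      (fun t => posDef_isSymm (hZpos t)) (fun t => posDef_isSymm (hZ₀pos t)) hw hwu hY heq (hJ t ht)
  -- The derivative is J⁻¹(J₀' − J'J⁻¹J₀), which vanishes by the intertwining relation. Since J(0) =
  -- 0, each half-line must be treated separately.
  have hNd : ∀ t, t ≠ 0 → HasDerivAt (fun t => (gramian F B Z t)⁻¹ * gramian F B Z₀ t) 0 t := by
    intro t ht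
    refine HasDerivAt.congr_deriv (HasDerivAt.matMul
      (HasDerivAt.matInv (hasDerivAt_gramian hF hB hZ.continuous t) (hJ t ht))
      (hasDerivAt_gramian hF hB hZ₀.continuous t)) ?_
    rw [Matrix.mul_assoc _ (Z₀ t), hint t ht]
    simp only [Matrix.neg_mul, Matrix.mul_assoc]
    abel
  have hright : ∀ t, 0 < t → (gramian F B Z t)⁻¹ * gramian F B Z₀ t =
      (gramian F B Z 1)⁻¹ * gramian F B Z₀ 1 := fun t ht =>
    isOpen_Ioi.is_const_of_deriv_eq_zero (s := Set.Ioi (0 : ℝ)) isPreconnected_Ioi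
      (fun s hs => (hNd s (ne_of_gt hs)).differentiableAt.differentiableWithinAt)
      (fun s hs => (hNd s (ne_of_gt hs)).deriv) ht (Set.mem_Ioi.2 one_pos)
  have hleft : ∀ t, t < 0 → (gramian F B Z t)⁻¹ * gramian F B Z₀ t =
      (gramian F B Z (-1))⁻¹ * gramian F B Z₀ (-1) := fun t ht =>
    isOpen_Iio.is_const_of_deriv_eq_zero (s := Set.Iio (0 : ℝ)) isPreconnected_Iio
      (fun s hs => (hNd s (ne_of_lt hs)).differentiableAt.differentiableWithinAt)
      (fun s hs => (hNd s (ne_of_lt hs)).deriv) ht (Set.mem_Iio.2 (by simp))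
  have hpc : ContDiff ℝ ∞ fun t => (pulledInput F B t)ᵀ :=
    ContDiff.matTranspose (ContDiff.matMul (contDiff_transitionMatrix_right hFs 0) hAB.smooth_B)
  have hsmooth : ContDiff ℝ ∞ fun t => (Z t)⁻¹ * (Z₀ t * (pulledInput F B t)ᵀ) :=
    ContDiff.matMul (ContDiff.matInv hZ fun t => (hZpos t).isUnit) (ContDiff.matMul hZ₀ hpc)
  -- For each v, the adjoint arcs through the images of v under the two constants have outputs that
  -- are the two halves of the smooth function Z⁻¹Z₀bᵀv, so they coincide at 0.
  have hN : (gramian F B Z 1)⁻¹ * gramian F B Z₀ 1 =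
      (gramian F B Z (-1))⁻¹ * gramian F B Z₀ (-1) := by
    refine Matrix.ext_iff_mulVec.2 fun v => ?_
    have h1 := eq_of_smooth_gluing hAB hK
      (q₁ := fun t => (transitionMatrix F 0 t)ᵀ *ᵥ
        (((gramian F B Z 1)⁻¹ * gramian F B Z₀ 1) *ᵥ v))
      (q₂ := fun t => (transitionMatrix F 0 t)ᵀ *ᵥ
        (((gramian F B Z (-1))⁻¹ * gramian F B Z₀ (-1)) *ᵥ v))
      (g := fun t => ((Z t)⁻¹ * (Z₀ t * (pulledInput F B t)ᵀ)) *ᵥ v)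
      (fun t => by rw [← hFK t]; exact hasDerivAt_adjoint hF _ t)
      (fun t => by rw [← hFK t]; exact hasDerivAt_adjoint hF _ t)
      (by
        rw [contDiff_matrix_iff] at hsmooth
        rw [contDiff_pi]
        intro i
        simp only [Matrix.mulVec, dotProduct]
        exact ContDiff.sum fun j _ => (hsmooth i j).mul contDiff_const)
      (fun t ht => by
        rw [hint t ht.ne', hright t ht, Matrix.mul_assoc (Z t), ← Matrix.mul_assoc (Z t)⁻¹ (Z t),
          posDef_inv_mul (hZpos t), Matrix.one_mul, pulledInput, Matrix.transpose_mul]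
        simp only [Matrix.mulVec_mulVec, Matrix.mul_assoc])
      (fun t ht => by
        rw [hint t ht.ne, hleft t ht, Matrix.mul_assoc (Z t), ← Matrix.mul_assoc (Z t)⁻¹ (Z t),
          posDef_inv_mul (hZpos t), Matrix.one_mul, pulledInput, Matrix.transpose_mul]
        simp only [Matrix.mulVec_mulVec, Matrix.mul_assoc])
    simpa [transitionMatrix_self hF] using h1
  refine ⟨(gramian F B Z 1)⁻¹ * gramian F B Z₀ 1, ?_, fun t => ?_⟩
  · exact (Matrix.isUnit_nonsing_inv_iff.2 (hJ 1 one_ne_zero)).mul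
      (isUnit_gramian hAB hFK hF hZ₀.continuous hZ₀pos one_ne_zero)
  · have c1 : Continuous fun t => Z₀ t * (pulledInput F B t)ᵀ :=
      (ContDiff.matMul hZ₀ hpc).continuous
    have c2 : Continuous fun t => Z t * (pulledInput F B t)ᵀ *
        ((gramian F B Z 1)⁻¹ * gramian F B Z₀ 1) :=
      (ContDiff.matMul hZ hpc).continuous.matrix_mul continuous_const
    refine congrFun (c1.ext_on (dense_compl_singleton (0 : ℝ)) c2 fun s hs => ?_) t
    rcases lt_or_gt_of_ne (show s ≠ 0 from hs) with h | h
    · beta_reduce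
      rw [hint s h.ne, hleft s h, hN]
    · beta_reduce
      rw [hint s h.ne', hright s h]

end Intertwiner

/-! ### Euclidean norm estimates and comparison of quadratic forms. -/

section QuadraticBounds

variable {p q : ℕ}

theorem dotProduct_self_eq_norm_sq (x : Fin p → ℝ) : x ⬝ᵥ x = ‖WithLp.toLp 2 x‖ ^ 2 := by
  rw [EuclideanSpace.norm_sq_eq]
  simp [dotProduct, sq]

theorem abs_dotProduct_le (x y : Fin p → ℝ) :
    |x ⬝ᵥ y| ≤ ‖WithLp.toLp 2 x‖ * ‖WithLp.toLp 2 y‖ := by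
  have := abs_real_inner_le_norm (WithLp.toLp 2 y) (WithLp.toLp 2 x)
  rw [EuclideanSpace.inner_toLp_toLp] at this
  simpa [mul_comm] using this

theorem norm_mulVec_le (M : Matrix (Fin p) (Fin q) ℝ) (x : Fin q → ℝ) :
    ‖WithLp.toLp 2 (M *ᵥ x)‖ ≤ ‖M‖ * ‖WithLp.toLp 2 x‖ :=
  Matrix.l2_opNorm_mulVec M (WithLp.toLp 2 x)

theorem abs_dotProduct_mulVec_le (M : Matrix (Fin p) (Fin q) ℝ) (x : Fin p → ℝ) (y : Fin q → ℝ) :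
    |x ⬝ᵥ (M *ᵥ y)| ≤ ‖M‖ * (‖WithLp.toLp 2 x‖ * ‖WithLp.toLp 2 y‖) := by
  refine (abs_dotProduct_le _ _).trans ?_
  calc _ ≤ ‖WithLp.toLp 2 x‖ * (‖M‖ * ‖WithLp.toLp 2 y‖) :=
        mul_le_mul_of_nonneg_left (norm_mulVec_le M y) (norm_nonneg _)
    _ = _ := by ring

theorem norm_matTranspose (M : Matrix (Fin p) (Fin q) ℝ) : ‖Mᵀ‖ = ‖M‖ := by
  rw [← Matrix.conjTranspose_eq_transpose_of_trivial, Matrix.l2_opNorm_conjTranspose]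

theorem isBoundedMap_of_entries {M : ℝ → Matrix (Fin p) (Fin q) ℝ} {C : ℝ} (hC : 0 ≤ C)
    (h : ∀ t i j, |M t i j| ≤ C) : IsBoundedMap M := by
  let e : (Fin p → Fin q → ℝ) ≃L[ℝ] Matrix (Fin p) (Fin q) ℝ :=
    (LinearEquiv.refl ℝ (Fin p → Fin q → ℝ) :
      (Fin p → Fin q → ℝ) ≃ₗ[ℝ] Matrix (Fin p) (Fin q) ℝ).toContinuousLinearEquiv
  refine ⟨‖(e : (Fin p → Fin q → ℝ) →L[ℝ] Matrix (Fin p) (Fin q) ℝ)‖ * C, fun t => ?_⟩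
  refine ((e : (Fin p → Fin q → ℝ) →L[ℝ] Matrix (Fin p) (Fin q) ℝ).le_opNorm (M t)).trans ?_
  refine mul_le_mul_of_nonneg_left ?_ (norm_nonneg _)
  exact (pi_norm_le_iff_of_nonneg hC).2 fun i => (pi_norm_le_iff_of_nonneg hC).2 fun j => h t i j

/-- Polarization: the entry (i,j) is controlled by the values of the form at e_i ± e_j. -/
theorem isBoundedMap_of_quadratic {M : ℝ → Matrix (Fin p) (Fin p) ℝ} (hs : ∀ t, (M t).IsSymm)
    {C : ℝ} (h : ∀ t v, |v ⬝ᵥ (M t *ᵥ v)| ≤ C * (v ⬝ᵥ v)) : IsBoundedMap M := by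
  refine isBoundedMap_of_entries (C := 2 * |C|) (by positivity) fun t i j => ?_
  set a : Fin p → ℝ := Pi.single i 1
  set b : Fin p → ℝ := Pi.single j 1
  have hab : M t i j = a ⬝ᵥ (M t *ᵥ b) := by simp [a, b]
  have hba : b ⬝ᵥ (M t *ᵥ a) = a ⬝ᵥ (M t *ᵥ b) := by
    rw [dotProduct_comm, mulVec_dotProduct, (hs t).eq]
  have haa : a ⬝ᵥ a = 1 := by simp [a]
  have hbb : b ⬝ᵥ b = 1 := by simp [b]
  have h1 := abs_le.1 (h t (a + b))
  have h2 := abs_le.1 (h t (a - b))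
  have hc := dotProduct_comm b a
  simp only [Matrix.mulVec_add, Matrix.mulVec_sub, add_dotProduct, sub_dotProduct, dotProduct_add,
    dotProduct_sub, hba, haa, hbb, hc] at h1 h2
  have hsum := (abs_le.1 (abs_dotProduct_le a b))
  have na : ‖WithLp.toLp 2 a‖ = 1 := by
    have := dotProduct_self_eq_norm_sq a
    rw [haa] at this
    exact (pow_eq_one_iff_of_nonneg (norm_nonneg _) two_ne_zero).1 this.symm
  have nb : ‖WithLp.toLp 2 b‖ = 1 := by
    have := dotProduct_self_eq_norm_sq b
    rw [hbb] at this
    exact (pow_eq_one_iff_of_nonneg (norm_nonneg _) two_ne_zero).1 this.symm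
  rw [na, nb] at hsum
  have k1 : C * (1 + a ⬝ᵥ b + (a ⬝ᵥ b + 1)) ≤ |C| * (1 + a ⬝ᵥ b + (a ⬝ᵥ b + 1)) :=
    mul_le_mul_of_nonneg_right (le_abs_self C) (by linarith)
  have k2 : C * (1 - a ⬝ᵥ b - (a ⬝ᵥ b - 1)) ≤ |C| * (1 - a ⬝ᵥ b - (a ⬝ᵥ b - 1)) :=
    mul_le_mul_of_nonneg_right (le_abs_self C) (by linarith)
  rw [hab, abs_le]
  constructor <;> nlinarith

theorem IsBoundedMap.abs_quadratic_le {M : ℝ → Matrix (Fin p) (Fin p) ℝ} (h : IsBoundedMap M) :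
    ∃ C, ∀ t v, |v ⬝ᵥ (M t *ᵥ v)| ≤ C * (v ⬝ᵥ v) := by
  obtain ⟨C, hC⟩ := h
  refine ⟨C, fun t v => (abs_dotProduct_mulVec_le _ _ _).trans ?_⟩
  rw [dotProduct_self_eq_norm_sq, ← sq]
  exact mul_le_mul_of_nonneg_right (hC t) (sq_nonneg _)

theorem IsBoundedMap.mul {r : ℕ} {M : ℝ → Matrix (Fin p) (Fin q) ℝ}
    {N : ℝ → Matrix (Fin q) (Fin r) ℝ} (hM : IsBoundedMap M) (hN : IsBoundedMap N) :
    IsBoundedMap fun t => M t * N t := by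
  obtain ⟨C, hC⟩ := hM
  obtain ⟨D, hD⟩ := hN
  exact ⟨C * D, fun t => (Matrix.l2_opNorm_mul _ _).trans
    (mul_le_mul (hC t) (hD t) (norm_nonneg _) ((norm_nonneg _).trans (hC t)))⟩

theorem IsBoundedMap.add {M N : ℝ → Matrix (Fin p) (Fin q) ℝ} (hM : IsBoundedMap M)
    (hN : IsBoundedMap N) : IsBoundedMap fun t => M t + N t := by
  obtain ⟨C, hC⟩ := hM
  obtain ⟨D, hD⟩ := hN
  exact ⟨C + D, fun t => (norm_add_le _ _).trans (add_le_add (hC t) (hD t))⟩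

theorem IsBoundedMap.transpose {M : ℝ → Matrix (Fin p) (Fin q) ℝ} (hM : IsBoundedMap M) :
    IsBoundedMap fun t => (M t)ᵀ := by
  obtain ⟨C, hC⟩ := hM
  exact ⟨C, fun t => (norm_matTranspose _).le.trans (hC t)⟩

theorem posDef_of_sub_smul_one {M : Matrix (Fin p) (Fin p) ℝ} {α : ℝ} (hα : 0 < α)
    (h : (M - α • (1 : Matrix (Fin p) (Fin p) ℝ)).PosDef) : M.PosDef := by
  have := h.add (Matrix.PosDef.one.smul hα)
  simpa using this

theorem IsUniformlyPosDef.posDef {R : ℝ → Matrix (Fin p) (Fin p) ℝ} (h : IsUniformlyPosDef R)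
    (t : ℝ) : (R t).PosDef := by
  obtain ⟨α, hα, h⟩ := h
  exact posDef_of_sub_smul_one hα (h t)

theorem le_quadratic_of_sub_smul_one {M : Matrix (Fin p) (Fin p) ℝ} {α : ℝ}
    (h : (M - α • (1 : Matrix (Fin p) (Fin p) ℝ)).PosDef) (v : Fin p → ℝ) :
    α * (v ⬝ᵥ v) ≤ v ⬝ᵥ (M *ᵥ v) := by
  have := h.posSemidef.dotProduct_mulVec_nonneg v
  simp only [star_trivial, Matrix.sub_mulVec, Matrix.smul_mulVec, Matrix.one_mulVec,
    dotProduct_sub, dotProduct_smul, smul_eq_mul] at this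
  linarith

/-- A lower bound for the quadratic form bounds the solutions of the linear system. -/
theorem norm_le_of_mulVec_eq {M : Matrix (Fin p) (Fin p) ℝ} {α : ℝ} (hα : 0 < α)
    (h : (M - α • (1 : Matrix (Fin p) (Fin p) ℝ)).PosDef) {v w : Fin p → ℝ} (hv : M *ᵥ v = w) :
    ‖WithLp.toLp 2 v‖ ≤ α⁻¹ * ‖WithLp.toLp 2 w‖ := by
  have h1 := le_quadratic_of_sub_smul_one h v
  rw [hv, dotProduct_self_eq_norm_sq] at h1
  have h2 := (le_abs_self _).trans (abs_dotProduct_le v w)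
  rw [inv_mul_eq_div, le_div_iff₀ hα]
  rcases (norm_nonneg (WithLp.toLp 2 v)).eq_or_lt with h0 | h0
  · rw [← h0]; simp
  · nlinarith

theorem IsUniformlyPosDef.isBoundedMap_inv {R : ℝ → Matrix (Fin p) (Fin p) ℝ}
    (h : IsUniformlyPosDef R) : IsBoundedMap fun t => (R t)⁻¹ := by
  have hpos := h.posDef
  obtain ⟨α, hα, h⟩ := h
  refine isBoundedMap_of_quadratic (C := α⁻¹) (fun t => posDef_isSymm (hpos t).inv) fun t v => ?_
  have h1 := norm_le_of_mulVec_eq hα (h t) (v := (R t)⁻¹ *ᵥ v) (w := v)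
    (by rw [Matrix.mulVec_mulVec, posDef_mul_inv (hpos t), Matrix.one_mulVec])
  refine (abs_dotProduct_le _ _).trans ?_
  rw [dotProduct_self_eq_norm_sq]
  nlinarith [norm_nonneg (WithLp.toLp 2 v)]

/-- Comparison of two quadratic forms through the eigenvalues of their pencil. -/
theorem quadratic_le_of_eigenvalues {M M₀ : Matrix (Fin p) (Fin p) ℝ} (hM : M.IsSymm)
    (hM₀ : M₀.PosDef) {c : ℝ} (h : ∀ v μ, v ≠ 0 → M *ᵥ v = μ • (M₀ *ᵥ v) → μ ≤ c)
    (v : Fin p → ℝ) : v ⬝ᵥ (M *ᵥ v) ≤ c * (v ⬝ᵥ (M₀ *ᵥ v)) := by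
  by_cases hv : v = 0
  · simp [hv]
  set f : (Fin p → ℝ) → ℝ := fun x => x ⬝ᵥ (M *ᵥ x) / (x ⬝ᵥ (M₀ *ᵥ x)) with hf
  have hpos : ∀ x, x ≠ 0 → 0 < x ⬝ᵥ (M₀ *ᵥ x) := fun x hx => hM₀.dotProduct_mulVec_pos hx
  have hcont : ContinuousOn f (Metric.sphere 0 1) := by
    refine ContinuousOn.div (by fun_prop) (by fun_prop) fun x hx => (hpos x ?_).ne'
    rintro rfl
    simp at hx
  have hscale : ∀ (r : ℝ) (x : Fin p → ℝ), r ≠ 0 → f (r • x) = f x := fun r x hr => by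
    simp only [hf, Matrix.mulVec_smul, dotProduct_smul, smul_dotProduct, smul_eq_mul]
    rw [mul_div_mul_left _ _ hr, mul_div_mul_left _ _ hr]
  have hmem : ∀ x : Fin p → ℝ, x ≠ 0 → ‖x‖⁻¹ • x ∈ Metric.sphere (0 : Fin p → ℝ) 1 := fun x hx => by
    simp [norm_smul, norm_ne_zero_iff.2 hx]
  -- A maximizer of the generalized Rayleigh quotient is an eigenvector of the pencil: λM₀ − M, with
  -- λ the maximum, is positive semidefinite and its form vanishes at `x₀`, so `x₀` lies in its
  -- kernel.
  obtain ⟨x₀, hx₀, hmax⟩ := (isCompact_sphere (0 : Fin p → ℝ) 1).exists_isMaxOn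
    ⟨_, hmem v hv⟩ hcont
  have hx₀0 : x₀ ≠ 0 := by
    rintro rfl
    simp at hx₀
  have hle : ∀ x, x ⬝ᵥ (M *ᵥ x) ≤ f x₀ * (x ⬝ᵥ (M₀ *ᵥ x)) := fun x => by
    by_cases hx : x = 0
    · simp [hx]
    have h1 := hmax (hmem x hx)
    simp only [Set.mem_ofPred_eq] at h1
    rw [hscale _ _ (inv_ne_zero (norm_ne_zero_iff.2 hx))] at h1
    rwa [← div_le_iff₀ (hpos x hx)]
  have hpsd : (f x₀ • M₀ - M).PosSemidef := by
    refine Matrix.PosSemidef.of_dotProduct_mulVec_nonneg ?_ fun x => ?_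
    · rw [Matrix.IsHermitian, Matrix.conjTranspose_eq_transpose_of_trivial, Matrix.transpose_sub,
        Matrix.transpose_smul, (posDef_isSymm hM₀).eq, hM.eq]
    · simp only [star_trivial, Matrix.sub_mulVec, Matrix.smul_mulVec, dotProduct_sub,
        dotProduct_smul, smul_eq_mul]
      linarith [hle x]
  have hzero : (f x₀ • M₀ - M) *ᵥ x₀ = 0 := by
    rw [← hpsd.dotProduct_mulVec_zero_iff]
    simp only [star_trivial, Matrix.sub_mulVec, Matrix.smul_mulVec, dotProduct_sub,
      dotProduct_smul, smul_eq_mul, hf]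
    rw [div_mul_cancel₀ _ (hpos x₀ hx₀0).ne', sub_self]
  rw [Matrix.sub_mulVec, Matrix.smul_mulVec, sub_eq_zero] at hzero
  refine (hle v).trans (mul_le_mul_of_nonneg_right (h x₀ _ hx₀0 hzero.symm) (hpos v hv).le)

theorem abs_eigenvalue_le {M : Matrix (Fin p) (Fin p) ℝ} {y : Fin p → ℝ} {μ : ℝ} (hy : y ≠ 0)
    (h : M *ᵥ y = μ • y) : |μ| ≤ ‖M‖ := by
  have h1 := norm_mulVec_le M y
  rw [h, WithLp.toLp_smul, norm_smul, Real.norm_eq_abs] at h1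
  refine le_of_mul_le_mul_right h1 (norm_pos_iff.2 ?_)
  simpa using hy

end QuadraticBounds

/-! ### Uniform bounds on the weight from the intertwining relation. -/

section WeightBounds

variable {n m : ℕ} {Z Z₀ : ℝ → Matrix (Fin m) (Fin m) ℝ} {b : ℝ → Matrix (Fin n) (Fin m) ℝ}
  {N : Matrix (Fin n) (Fin n) ℝ}

/-- If Z⁻¹x = μZ₀⁻¹x, the transposed relation bZ₀ = NᵀbZ gives Nᵀ(bx) = μ(bx), and bx ≠ 0. So every
eigenvalue of the pencil is an eigenvalue of one fixed matrix, uniformly in t. -/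
theorem inv_quadratic_le_of_intertwiner (hZ : ∀ t, (Z t).PosDef) (hZ₀ : ∀ t, (Z₀ t).PosDef)
    (hb : ∀ t, Function.Injective fun v : Fin m → ℝ => b t *ᵥ v)
    (h : ∀ t, Z₀ t * (b t)ᵀ = Z t * (b t)ᵀ * N) (t : ℝ) (v : Fin m → ℝ) :
    v ⬝ᵥ ((Z t)⁻¹ *ᵥ v) ≤ ‖Nᵀ‖ * (v ⬝ᵥ ((Z₀ t)⁻¹ *ᵥ v)) := by
  refine quadratic_le_of_eigenvalues (posDef_isSymm (hZ t).inv) (hZ₀ t).inv (fun x μ hx hμ => ?_) v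
  refine (le_abs_self μ).trans (abs_eigenvalue_le (y := b t *ᵥ x) ?_ ?_)
  · intro h0
    exact hx (hb t (by simpa using h0))
  · have h1 : b t * Z₀ t = Nᵀ * (b t * Z t) := by
      have := congrArg Matrix.transpose (h t)
      simpa [Matrix.transpose_mul, (posDef_isSymm (hZ t)).eq, (posDef_isSymm (hZ₀ t)).eq] using this
    have h2 : b t *ᵥ x = (b t * Z t) *ᵥ ((Z t)⁻¹ *ᵥ x) := by
      rw [Matrix.mulVec_mulVec, Matrix.mul_assoc, posDef_mul_inv (hZ t), Matrix.mul_one]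
    rw [h2, Matrix.mulVec_mulVec, ← h1, ← h2, hμ, Matrix.mulVec_smul, Matrix.mulVec_mulVec,
      Matrix.mul_assoc, posDef_mul_inv (hZ₀ t), Matrix.mul_one]

theorem isBoundedMap_inv_of_intertwiner (hZ : ∀ t, (Z t).PosDef) (hZ₀ : ∀ t, (Z₀ t).PosDef)
    (hb : ∀ t, Function.Injective fun v : Fin m → ℝ => b t *ᵥ v)
    (h : ∀ t, Z₀ t * (b t)ᵀ = Z t * (b t)ᵀ * N) (hbd : IsBoundedMap fun t => (Z₀ t)⁻¹) :
    IsBoundedMap fun t => (Z t)⁻¹ := by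
  obtain ⟨C, hC⟩ := hbd.abs_quadratic_le
  refine isBoundedMap_of_quadratic (C := ‖Nᵀ‖ * C) (fun t => posDef_isSymm (hZ t).inv) fun t v => ?_
  have h0 : 0 ≤ v ⬝ᵥ ((Z t)⁻¹ *ᵥ v) := (hZ t).inv.posSemidef.dotProduct_mulVec_nonneg v
  rw [abs_of_nonneg h0, mul_assoc]
  exact (inv_quadratic_le_of_intertwiner hZ hZ₀ hb h t v).trans
    (mul_le_mul_of_nonneg_left ((le_abs_self _).trans (hC t v)) (norm_nonneg _))

theorem isUniformlyPosDef_inv_of_intertwiner (hZ : ∀ t, (Z t).PosDef) (hZ₀ : ∀ t, (Z₀ t).PosDef)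
    (hb : ∀ t, Function.Injective fun v : Fin m → ℝ => b t *ᵥ v) (hN : IsUnit N)
    (h : ∀ t, Z₀ t * (b t)ᵀ = Z t * (b t)ᵀ * N)
    (hpd : IsUniformlyPosDef fun t => (Z₀ t)⁻¹) : IsUniformlyPosDef fun t => (Z t)⁻¹ := by
  obtain ⟨α, hα, hpd⟩ := hpd
  have h' : ∀ t, Z t * (b t)ᵀ = Z₀ t * (b t)ᵀ * N⁻¹ := fun t => by
    rw [h, Matrix.mul_nonsing_inv_cancel_right _ _ ((Matrix.isUnit_iff_isUnit_det _).1 hN)]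
  have hc : 0 < ‖(N⁻¹)ᵀ‖ + 1 := by positivity
  -- The bound comes from exchanging the roles of Z and Z₀. Adding 1 keeps the denominator positive,
  -- and the factor 2 makes the inequality strict.
  refine ⟨α / (2 * (‖(N⁻¹)ᵀ‖ + 1)), by positivity, fun t => ?_⟩
  refine Matrix.PosDef.of_dotProduct_mulVec_pos ?_ fun v hv => ?_
  · rw [Matrix.IsHermitian, Matrix.conjTranspose_eq_transpose_of_trivial, Matrix.transpose_sub,
      Matrix.transpose_smul, (posDef_isSymm (hZ t).inv).eq, Matrix.transpose_one]
  · simp only [star_trivial, Matrix.sub_mulVec, Matrix.smul_mulVec, Matrix.one_mulVec,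
      dotProduct_sub, dotProduct_smul, smul_eq_mul]
    have h1 := inv_quadratic_le_of_intertwiner hZ₀ hZ hb h' t v
    have h2 := le_quadratic_of_sub_smul_one (hpd t) v
    have h3 : 0 ≤ v ⬝ᵥ ((Z t)⁻¹ *ᵥ v) := (hZ t).inv.posSemidef.dotProduct_mulVec_nonneg v
    have h4 : 0 < v ⬝ᵥ v := by
      have := (Matrix.PosDef.one (n := Fin m) (R := ℝ)).dotProduct_mulVec_pos hv
      simpa using this
    have h5 : α * (v ⬝ᵥ v) ≤ (‖(N⁻¹)ᵀ‖ + 1) * (v ⬝ᵥ ((Z t)⁻¹ *ᵥ v)) := by linarith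
    have h6 : α / (2 * (‖(N⁻¹)ᵀ‖ + 1)) * (v ⬝ᵥ v) < v ⬝ᵥ ((Z t)⁻¹ *ᵥ v) := by
      rw [div_mul_eq_mul_div, div_lt_iff₀ (by positivity)]
      nlinarith [mul_pos hα h4]
    linarith

end WeightBounds

/-! ### Boundedness and smoothness of Riccati solutions. -/

section Steering

variable {n m : ℕ} {A : ℝ → Matrix (Fin n) (Fin n) ℝ} {B : ℝ → Matrix (Fin n) (Fin m) ℝ}
  {Q : ℝ → Matrix (Fin n) (Fin n) ℝ} {S : ℝ → Matrix (Fin n) (Fin m) ℝ}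
  {R : ℝ → Matrix (Fin m) (Fin m) ℝ} {P : ℝ → Matrix (Fin n) (Fin n) ℝ}

/-- Uniform controllability: any two states are joined in a fixed time, with uniform bounds on the
trajectory and on the control. -/
theorem exists_bounded_steering (hAB : DynamicsAssumption A B) :
    ∃ s > (0 : ℝ), ∃ C : ℝ, ∀ (t : ℝ) (a b : Fin n → ℝ), ∃ (x : ℝ → Fin n → ℝ) (u : ℝ → Fin m → ℝ),
      (∀ τ, HasDerivAt x (A τ *ᵥ x τ + B τ *ᵥ u τ) τ) ∧ x t = a ∧ x (t + s) = b ∧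
      ∀ τ ∈ Set.Icc t (t + s),
        ‖WithLp.toLp 2 (x τ)‖ ≤ C * (‖WithLp.toLp 2 a‖ + ‖WithLp.toLp 2 b‖) ∧
        ‖WithLp.toLp 2 (u τ)‖ ≤ C * (‖WithLp.toLp 2 a‖ + ‖WithLp.toLp 2 b‖) := by
  obtain ⟨s, hs, β, hβ, hG⟩ := hAB.uniformly_controllable
  obtain ⟨MA, hMA⟩ := hAB.bounded_A
  obtain ⟨MB, hMB⟩ := hAB.bounded_B
  have hA := hAB.smooth_A.continuous
  have hB := hAB.smooth_B.continuous
  have hMA0 : 0 ≤ MA := (norm_nonneg _).trans (hMA 0)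
  have hMB0 : 0 ≤ MB := (norm_nonneg _).trans (hMB 0)
  obtain ⟨c, hc0, hc⟩ : ∃ c : ℝ, 0 ≤ c ∧ ∀ t τ, |t - τ| ≤ s → ‖transitionMatrix A t τ‖ ≤ c := by
    refine ⟨‖(1 : Matrix (Fin n) (Fin n) ℝ)‖ * Real.exp (MA * s), by positivity, fun t τ h => ?_⟩
    refine (norm_transitionMatrix_le hA hMA t τ).trans ?_
    gcongr
  set d := (c * MB) * (c * MB) * s
  have hd0 : 0 ≤ d := by positivity
  -- The first summand bounds the state and the second the control; `c` bounds the transition matrix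
  -- of A over time lapses at most s, and `d` bounds the partial Gramians.
  refine ⟨s, hs, c * (1 + d * (β⁻¹ * (c + 1))) + MB * c * (β⁻¹ * (c + 1)), fun t a b => ?_⟩
  set ψ : ℝ → Matrix (Fin n) (Fin n) ℝ := fun τ =>
    transitionMatrix A t τ * B τ * (B τ)ᵀ * (transitionMatrix A t τ)ᵀ with hψ
  have hψc : Continuous ψ := by
    have := continuous_transitionMatrix_right hA t
    fun_prop
  set W : ℝ → Matrix (Fin n) (Fin n) ℝ := fun τ => ∫ r in t..τ, ψ r
  have hψn : ∀ τ ∈ Set.Icc t (t + s), ‖ψ τ‖ ≤ (c * MB) * (c * MB) := fun τ hτ => by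
    have h1 : ‖transitionMatrix A t τ * B τ‖ ≤ c * MB :=
      (Matrix.l2_opNorm_mul _ _).trans (mul_le_mul
        (hc _ _ (abs_le.2 ⟨by linarith [hτ.2], by linarith [hτ.1]⟩)) (hMB τ) (norm_nonneg _) hc0)
    have h2 : ψ τ = (transitionMatrix A t τ * B τ) * (transitionMatrix A t τ * B τ)ᵀ := by
      simp only [hψ, Matrix.transpose_mul, Matrix.mul_assoc]
    rw [h2]
    refine (Matrix.l2_opNorm_mul _ _).trans ?_
    rw [norm_matTranspose]
    exact mul_le_mul h1 h1 (norm_nonneg _) (by positivity)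
  have hWn : ∀ τ ∈ Set.Icc t (t + s), ‖W τ‖ ≤ d := fun τ hτ => by
    refine (intervalIntegral.norm_integral_le_of_norm_le_const fun r hr =>
      hψn r ?_).trans ?_
    · rw [Set.uIoc_of_le hτ.1] at hr
      exact ⟨hr.1.le, hr.2.trans hτ.2⟩
    · rw [abs_of_nonneg (by linarith [hτ.1])]
      exact mul_le_mul_of_nonneg_left (by linarith [hτ.2]) (by positivity)
  have hGt : (W (t + s) - β • (1 : Matrix (Fin n) (Fin n) ℝ)).PosDef := hG t
  set η : Fin n → ℝ := transitionMatrix A t (t + s) *ᵥ b - a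
  set ξ : Fin n → ℝ := (W (t + s))⁻¹ *ᵥ η
  have hξ : W (t + s) *ᵥ ξ = η := by
    rw [Matrix.mulVec_mulVec, posDef_mul_inv (posDef_of_sub_smul_one hβ hGt), Matrix.one_mulVec]
  have na := norm_nonneg (WithLp.toLp 2 a)
  have nb := norm_nonneg (WithLp.toLp 2 b)
  have hη : ‖WithLp.toLp 2 η‖ ≤ (c + 1) * (‖WithLp.toLp 2 a‖ + ‖WithLp.toLp 2 b‖) := by
    have h1 : ‖WithLp.toLp 2 η‖ ≤
        ‖WithLp.toLp 2 (transitionMatrix A t (t + s) *ᵥ b)‖ + ‖WithLp.toLp 2 a‖ := by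
      rw [WithLp.toLp_sub]
      exact norm_sub_le _ _
    have h2 := (norm_mulVec_le (transitionMatrix A t (t + s)) b).trans
      (mul_le_mul_of_nonneg_right (hc t (t + s) (by simp [abs_of_pos hs])) nb)
    nlinarith [mul_nonneg hc0 na]
  have hξn : ‖WithLp.toLp 2 ξ‖ ≤
      β⁻¹ * (c + 1) * (‖WithLp.toLp 2 a‖ + ‖WithLp.toLp 2 b‖) := by
    refine (norm_le_of_mulVec_eq hβ hGt hξ).trans ?_
    rw [mul_assoc]
    exact mul_le_mul_of_nonneg_left hη (inv_nonneg.2 hβ.le)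
  -- This is the minimum-energy control, with `ξ` chosen through the inverse Gramian so that the
  -- state at t + s is b.
  refine ⟨fun τ => transitionMatrix A τ t *ᵥ (a + W τ *ᵥ ξ),
    fun τ => (B τ)ᵀ *ᵥ ((transitionMatrix A t τ)ᵀ *ᵥ ξ), fun τ => ?_, ?_, ?_, fun τ hτ => ?_⟩
  · have h1 := HasDerivAt.mulVec (hasDerivAt_transitionMatrix hA τ t)
      ((HasDerivAt.mulVec_const (intervalIntegral_hasDerivAt hψc t τ) ξ).const_add a)
    refine h1.congr_deriv ?_
    have h2 : transitionMatrix A τ t * ψ τ = B τ * ((B τ)ᵀ * (transitionMatrix A t τ)ᵀ) := by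
      simp only [hψ, ← Matrix.mul_assoc]
      rw [transitionMatrix_mul hA, transitionMatrix_self hA, Matrix.one_mul]
    rw [Matrix.mulVec_mulVec (M := transitionMatrix A τ t), h2]
    simp only [Matrix.mulVec_mulVec]
    rfl
  · simp [W, transitionMatrix_self hA]
  · beta_reduce
    rw [hξ, add_sub_cancel, Matrix.mulVec_mulVec, transitionMatrix_mul hA,
      transitionMatrix_self hA, Matrix.one_mulVec]
  · have hτ' : |τ - t| ≤ s := abs_le.2 ⟨by linarith [hτ.1], by linarith [hτ.2]⟩
    have hβ' : 0 ≤ β⁻¹ * (c + 1) := by positivity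
    have hab : 0 ≤ ‖WithLp.toLp 2 a‖ + ‖WithLp.toLp 2 b‖ := by positivity
    constructor
    · have h1 : ‖WithLp.toLp 2 (a + W τ *ᵥ ξ)‖ ≤
          (1 + d * (β⁻¹ * (c + 1))) * (‖WithLp.toLp 2 a‖ + ‖WithLp.toLp 2 b‖) := by
        rw [WithLp.toLp_add]
        refine (norm_add_le _ _).trans ?_
        have h2 := (norm_mulVec_le (W τ) ξ).trans
          (mul_le_mul (hWn τ hτ) hξn (norm_nonneg _) hd0)
        linarith
      refine (norm_mulVec_le _ _).trans ((mul_le_mul (hc _ _ hτ') h1 (norm_nonneg _) hc0).trans ?_)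
      have h3 : 0 ≤ MB * c * (β⁻¹ * (c + 1)) *
        (‖WithLp.toLp 2 a‖ + ‖WithLp.toLp 2 b‖) := by positivity
      linarith
    · refine (norm_mulVec_le _ _).trans ?_
      rw [norm_matTranspose]
      have h1 := (norm_mulVec_le (transitionMatrix A t τ)ᵀ ξ)
      rw [norm_matTranspose] at h1
      have h2 := h1.trans (mul_le_mul (hc t τ (by rwa [abs_sub_comm])) hξn (norm_nonneg _) hc0)
      refine (mul_le_mul (hMB τ) h2 (norm_nonneg _) hMB0).trans ?_
      rw [add_mul]
      have h3 : 0 ≤ c * (1 + d * (β⁻¹ * (c + 1))) *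
        (‖WithLp.toLp 2 a‖ + ‖WithLp.toLp 2 b‖) := by positivity
      linarith

theorem abs_quadCost_le (hQ : IsBoundedMap Q) (hS : IsBoundedMap S) (hR : IsBoundedMap R) :
    ∃ C : ℝ, 0 ≤ C ∧ ∀ (t : ℝ) (x : Fin n → ℝ) (u : Fin m → ℝ) (r : ℝ),
      ‖WithLp.toLp 2 x‖ ≤ r → ‖WithLp.toLp 2 u‖ ≤ r → |quadCost Q S R t x u| ≤ C * r ^ 2 := by
  obtain ⟨c, hc⟩ := hQ
  obtain ⟨d, hd⟩ := hS
  obtain ⟨e, he⟩ := hR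
  have hc0 := (norm_nonneg _).trans (hc 0)
  have hd0 := (norm_nonneg _).trans (hd 0)
  have he0 := (norm_nonneg _).trans (he 0)
  refine ⟨c + 2 * d + e, by positivity, fun t x u r hx hu => ?_⟩
  have hr := (norm_nonneg _).trans hx
  have key : ∀ {p q : ℕ} (M : Matrix (Fin p) (Fin q) ℝ) (k : ℝ) (y : Fin p → ℝ) (z : Fin q → ℝ),
      ‖M‖ ≤ k → ‖WithLp.toLp 2 y‖ ≤ r → ‖WithLp.toLp 2 z‖ ≤ r →
      |y ⬝ᵥ (M *ᵥ z)| ≤ k * (r * r) := fun M k y z hk hy hz =>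
    (abs_dotProduct_mulVec_le M y z).trans (mul_le_mul hk
      (mul_le_mul hy hz (norm_nonneg _) hr) (by positivity) ((norm_nonneg _).trans hk))
  have h1 := abs_le.1 (key (Q t) c x x (hc t) hx hx)
  have h2 := abs_le.1 (key (S t) d x u (hd t) hx hu)
  have h3 := abs_le.1 (key (R t) e u u (he t) hu hu)
  rw [quadCost, abs_le]
  constructor <;> nlinarith

/-- Solutions of the Riccati equation on the whole line are bounded. -/
theorem IsRiccatiSolution.isBoundedMap (hAB : DynamicsAssumption A B) (hQ : IsBoundedMap Q)
    (hS : IsBoundedMap S) (hR : IsBoundedMap R) (hRpos : ∀ t, (R t).PosDef)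
    (hP : IsRiccatiSolution A B Q S R P) : IsBoundedMap P := by
  obtain ⟨s, hs, C, hC⟩ := exists_bounded_steering hAB
  obtain ⟨D, hD0, hD⟩ := abs_quadCost_le hQ hS hR
  -- Dissipation inequality along the steering trajectory: the derivative of xᵀPx is a nonnegative
  -- square minus the cost, and the constant κ dominates the cost pointwise.
  have key : ∀ t (a b : Fin n → ℝ), a ⬝ᵥ (P t *ᵥ a) ≤ b ⬝ᵥ (P (t + s) *ᵥ b) +
      D * (C * (‖WithLp.toLp 2 a‖ + ‖WithLp.toLp 2 b‖)) ^ 2 * s := fun t a b => by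
    obtain ⟨x, u, hx, hxa, hxb, hbd⟩ := hC t a b
    set κ := D * (C * (‖WithLp.toLp 2 a‖ + ‖WithLp.toLp 2 b‖)) ^ 2
    have hd : ∀ τ, HasDerivAt (fun τ => x τ ⬝ᵥ (P τ *ᵥ x τ) + κ * τ)
        ((u τ + riccatiGain B S R P τ *ᵥ x τ) ⬝ᵥ (R τ *ᵥ (u τ + riccatiGain B S R P τ *ᵥ x τ)) -
          quadCost Q S R τ (x τ) (u τ) + κ) τ :=
      fun τ => by
        refine ((HasDerivAt.dotProduct' (hx τ) (HasDerivAt.mulVec (hP τ).2 (hx τ))).add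
          ((hasDerivAt_id τ).const_mul κ)).congr_deriv ?_
        rw [quadCost_eq_sub (A := A) (hRpos τ) (hP τ).1]
        ring
    have hmono : MonotoneOn (fun τ => x τ ⬝ᵥ (P τ *ᵥ x τ) + κ * τ) (Set.Icc t (t + s)) := by
      refine monotoneOn_of_deriv_nonneg (convex_Icc _ _) (hasDerivAt_continuous hd).continuousOn
        (fun τ _ => (hd τ).differentiableAt.differentiableWithinAt) fun τ hτ => ?_
      rw [(hd τ).deriv]
      have h1 := hbd τ (interior_subset hτ)
      have h2 := (le_abs_self _).trans (hD τ (x τ) (u τ) _ h1.1 h1.2)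
      have h3 := (hRpos τ).posSemidef.dotProduct_mulVec_nonneg
        (u τ + riccatiGain B S R P τ *ᵥ x τ)
      rw [star_trivial] at h3
      linarith
    have := hmono (Set.left_mem_Icc.2 (by linarith)) (Set.right_mem_Icc.2 (by linarith))
      (by linarith)
    simp only [hxa, hxb] at this
    linarith
  refine isBoundedMap_of_quadratic (C := D * C ^ 2 * s) (fun t => (hP t).1) fun t v => ?_
  -- Steering v to 0 on [t, t + s] bounds vᵀP(t)v from above; steering 0 to v on [t − s, t] bounds
  -- it from below.
  have h1 := key t v 0
  have h2 := key (t - s) 0 v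
  rw [sub_add_cancel] at h2
  rw [dotProduct_self_eq_norm_sq, abs_le]
  simp only [WithLp.toLp_zero, norm_zero, add_zero, zero_add, Matrix.mulVec_zero,
    dotProduct_zero] at h1 h2
  constructor <;> linarith

theorem contDiff_riccatiGain {k : ℕ∞ω} (hB : ContDiff ℝ k B) (hS : ContDiff ℝ k S)
    (hR : ContDiff ℝ k R) (hRpos : ∀ t, (R t).PosDef) (hP : ContDiff ℝ k P) :
    ContDiff ℝ k (riccatiGain B S R P) :=
  ContDiff.matMul (ContDiff.matInv hR fun t => (hRpos t).isUnit)
    ((ContDiff.matTranspose hS).add (ContDiff.matMul (ContDiff.matTranspose hB) hP))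

theorem IsRiccatiSolution.contDiff (hA : ContDiff ℝ ∞ A) (hB : ContDiff ℝ ∞ B)
    (hQ : ContDiff ℝ ∞ Q) (hS : ContDiff ℝ ∞ S) (hR : ContDiff ℝ ∞ R)
    (hRpos : ∀ t, (R t).PosDef) (hP : IsRiccatiSolution A B Q S R P) : ContDiff ℝ ∞ P := by
  refine contDiff_infty_of_bootstrap (fun t => (hP t).2) fun k hk => ?_
  have hle : ((k : ℕ∞) : ℕ∞ω) ≤ ∞ := by exact_mod_cast le_top
  have hA := hA.of_le hle
  have hB := hB.of_le hle
  have hS := hS.of_le hle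
  have hRi := ContDiff.matInv (hR.of_le hle) fun t => (hRpos t).isUnit
  exact (((ContDiff.matMul hk hA).neg.sub (ContDiff.matMul (ContDiff.matTranspose hA) hk)).add
    (ContDiff.matMul (ContDiff.matMul ((ContDiff.matMul hk hB).add hS) hRi)
      ((ContDiff.matMul (ContDiff.matTranspose hB) hk).add (ContDiff.matTranspose hS)))).sub
    (hQ.of_le hle)

theorem isBoundedMap_riccatiGain (hB : IsBoundedMap B) (hS : IsBoundedMap S)
    (hR : IsUniformlyPosDef R) (hP : IsBoundedMap P) : IsBoundedMap (riccatiGain B S R P) :=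
  hR.isBoundedMap_inv.mul (hS.transpose.add (hB.transpose.mul hP))

end Steering

/-! ### The implications between the three characterizations. -/

section Reconstruction

variable {n m : ℕ} {A : ℝ → Matrix (Fin n) (Fin n) ℝ} {B : ℝ → Matrix (Fin n) (Fin m) ℝ}
  {Q₀ : ℝ → Matrix (Fin n) (Fin n) ℝ} {S₀ : ℝ → Matrix (Fin n) (Fin m) ℝ}
  {R₀ : ℝ → Matrix (Fin m) (Fin m) ℝ} {K : ℝ → Matrix (Fin m) (Fin n) ℝ}
  {Ap Am : ℝ → Matrix (Fin n) (Fin n) ℝ} {R Z : ℝ → Matrix (Fin m) (Fin m) ℝ}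

theorem leftInverse_mul_cancel {M : Matrix (Fin n) (Fin m) ℝ}
    (hM : Function.Injective fun v : Fin m → ℝ => M *ᵥ v) {p : ℕ} (N : Matrix (Fin m) (Fin p) ℝ) :
    (Mᵀ * M)⁻¹ * Mᵀ * (M * N) = N := by
  have h : (Mᵀ * M).PosDef := by
    have := Matrix.PosDef.conjTranspose_mul_self M hM
    rwa [Matrix.conjTranspose_eq_transpose_of_trivial] at this
  rw [← Matrix.mul_assoc, Matrix.mul_assoc _ Mᵀ, posDef_inv_mul h, Matrix.one_mul]

theorem SolvesReconstructionEq.smul (h : SolvesReconstructionEq B Ap Am Z) (k : ℝ) :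
    SolvesReconstructionEq B Ap Am fun t => k • Z t := fun t => by
  have := congrArg (k • ·) (h t)
  simp only [smul_zero, smul_sub] at this
  simp only [Matrix.mul_smul, Matrix.smul_mul, intervalIntegral.integral_smul]
  exact this

/-- A positive solution of the reconstruction equation, normalized at `0`, is the inverse of the
weight of a canonical cost described by the given pair. -/
theorem isCanonicalCost_of_solvesReconstructionEq (hAB : DynamicsAssumption A B)
    (hcost : CostAssumption Q₀ S₀ R₀) (hpair : IsSynthesisPair A B Q₀ S₀ R₀ Ap Am)
    (hK : ∀ t, K t = ((B t)ᵀ * B t)⁻¹ * (B t)ᵀ * (A t - Ap t))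
    (hZ : ContDiff ℝ ∞ Z) (hZpos : ∀ t, (Z t).PosDef) (hdet : (Z 0).det = 1)
    (hsol : SolvesReconstructionEq B Ap Am Z) :
    IsCanonicalCost A B K (fun t => (Z t)⁻¹) ∧
      IsSynthesisPair A B (fun t => (K t)ᵀ * (Z t)⁻¹ * K t) (fun t => (K t)ᵀ * (Z t)⁻¹)
        (fun t => (Z t)⁻¹) Ap Am := by
  obtain ⟨⟨P, hP, rfl, hst⟩, ⟨P', hP', rfl, hanti⟩⟩ := hpair
  have hA := hAB.smooth_A.continuous
  have hB := hAB.smooth_B.continuous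
  have hS := hcost.smooth_S.continuous
  have hR := hcost.smooth_R.continuous
  have hRpos := hcost.uniformlyPosDef_R.posDef
  have hF := continuous_closedLoop hA hB hS hR hRpos hP.continuous
  have hG := continuous_closedLoop hA hB hS hR hRpos hP'.continuous
  have hX := transitionMatrix_closedLoop_eq hF hG hB hR hRpos hP hP'
  have hDu := isUnit_riccati_sub hF hG hB hR hRpos hP hP' hst hanti
  have hDs : (P 0 - P' 0)ᵀ = P 0 - P' 0 := by
    rw [Matrix.transpose_sub, (hP 0).1.eq, (hP' 0).1.eq]
  have hFK : ∀ t, closedLoop A B S₀ R₀ P t = A t - B t * riccatiGain B S₀ R₀ P t := closedLoop_eq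
  obtain rfl : K = riccatiGain B S₀ R₀ P := by
    funext t
    rw [hK, hFK, sub_sub_cancel, leftInverse_mul_cancel (hAB.injective_B t)]
  have hKs : ContDiff ℝ ∞ (riccatiGain B S₀ R₀ P) :=
    contDiff_riccatiGain hAB.smooth_B hcost.smooth_S hcost.smooth_R hRpos
      (hP.contDiff hAB.smooth_A hAB.smooth_B hcost.smooth_Q hcost.smooth_S hcost.smooth_R hRpos)
  have hKb : IsBoundedMap (riccatiGain B S₀ R₀ P) :=
    isBoundedMap_riccatiGain hAB.bounded_B hcost.bounded_S hcost.uniformlyPosDef_R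
      (hP.isBoundedMap hAB hcost.bounded_Q hcost.bounded_S hcost.bounded_R hRpos)
  set F := closedLoop A B S₀ R₀ P
  set G := closedLoop A B S₀ R₀ P'
  set D := P 0 - P' 0
  set Z₀ : ℝ → Matrix (Fin m) (Fin m) ℝ := fun t => (R₀ t)⁻¹ with hZ₀def
  have hZ₀ : ContDiff ℝ ∞ Z₀ := ContDiff.matInv hcost.smooth_R fun t => (hRpos t).isUnit
  have hZ₀pos : ∀ t, (Z₀ t).PosDef := fun t => (hRpos t).inv
  have hZ₀inv : (fun t => (Z₀ t)⁻¹) = R₀ := funext fun t =>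
    Matrix.nonsing_inv_nonsing_inv _ ((Matrix.isUnit_iff_isUnit_det _).1 (hRpos t).isUnit)
  have hDdet := (Matrix.isUnit_iff_isUnit_det _).1 hDu
  have hwJ : ∀ t, D⁻¹ + gramian F B Z₀ t = (1 + gramian F B Z₀ t * D) * D⁻¹ := fun t => by
    rw [Matrix.add_mul, Matrix.one_mul, Matrix.mul_nonsing_inv_cancel_right _ _ hDdet]
  have hXu : ∀ t, IsUnit (1 + gramian F B Z₀ t * D) := fun t => by
    have h1 : 1 + gramian F B Z₀ t * D = transitionMatrix F 0 t * transitionMatrix G t 0 := by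
      rw [hX, transitionMatrix_mul_cancel hF]
    rw [h1]
    exact (isUnit_transitionMatrix hF 0 t).mul (isUnit_transitionMatrix hG t 0)
  have hwu : IsUnit D⁻¹ := Matrix.isUnit_nonsing_inv_iff.2 hDu
  have hwJinv : ∀ t, (D⁻¹ + gramian F B Z₀ t)⁻¹ = D * (1 + gramian F B Z₀ t * D)⁻¹ := fun t => by
    rw [hwJ, Matrix.mul_inv_rev, Matrix.nonsing_inv_nonsing_inv _ hDdet]
  -- With w = D⁻¹ one has D(1 + J₀D)⁻¹ = (w + J₀)⁻¹. The reconstruction equation then has the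
  -- required form once B is cancelled on the left and Φ_F(t,0)ᵀ on the right.
  obtain ⟨N, hN, hint⟩ := exists_intertwiner hAB hKs hFK hZ hZ₀ hZpos hZ₀pos
    (w := D⁻¹) (by rw [Matrix.transpose_nonsing_inv, hDs]) hwu
    (fun t => by rw [hwJ]; exact (hXu t).mul hwu) fun t => by
      have h1 := hsol t
      rw [reconstruction_residual hF hG hB hZ.continuous hZ₀.continuous
        (fun t => posDef_isSymm (hZ₀pos t)) hDs hX t, ← hwJinv, Matrix.mul_assoc] at h1
      have h2 := leftInverse_mul_cancel (hAB.injective_B t) (p := n) _ |>.symm.trans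
        (congrArg (((B t)ᵀ * B t)⁻¹ * (B t)ᵀ * ·) h1)
      have h3 := congrArg (· * (transitionMatrix F 0 t)ᵀ) h2
      simp only [Matrix.mul_zero, Matrix.zero_mul, Matrix.mul_assoc _ (transitionMatrix F t 0)ᵀ,
        ← Matrix.transpose_mul, transitionMatrix_mul hF, transitionMatrix_self hF,
        Matrix.transpose_one, Matrix.mul_one] at h3
      exact sub_eq_zero.1 h3
  have hJ : ∀ t, gramian F B Z₀ t = gramian F B Z t * N :=
    eq_of_hasDerivAt_eq (hasDerivAt_gramian hF hB hZ₀.continuous)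
      (fun t => (HasDerivAt.matMul_const (hasDerivAt_gramian hF hB hZ.continuous t) N).congr_deriv
        (by simp only [Matrix.mul_assoc]
            rw [hint, Matrix.mul_assoc])) (a := 0) (by simp)
  have hb : ∀ t, Function.Injective fun v : Fin m → ℝ => pulledInput F B t *ᵥ v := fun t v v' h => by
    simp only [pulledInput, ← Matrix.mulVec_mulVec] at h
    exact hAB.injective_B t (Matrix.mulVec_injective_of_isUnit (isUnit_transitionMatrix hF 0 t) h)
  have hZi : ContDiff ℝ ∞ fun t => (Z t)⁻¹ := ContDiff.matInv hZ fun t => (hZpos t).isUnit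
  have hZii : ∀ t, (Z t)⁻¹⁻¹ = Z t := fun t =>
    Matrix.nonsing_inv_nonsing_inv _ ((Matrix.isUnit_iff_isUnit_det _).1 (hZpos t).isUnit)
  have hFK' : (fun t => A t - B t * riccatiGain B S₀ R₀ P t) = F := funext fun t => (hFK t).symm
  refine ⟨⟨fun t => posDef_isSymm (hZpos t).inv, hZi, ?_, ?_, ?_, hKs, hKb, hFK' ▸ hst⟩, ?_⟩
  · exact isBoundedMap_inv_of_intertwiner hZpos hZ₀pos hb hint (hZ₀inv ▸ hcost.bounded_R)
  · exact isUniformlyPosDef_inv_of_intertwiner hZpos hZ₀pos hb hN hint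
      (hZ₀inv ▸ hcost.uniformlyPosDef_R)
  · rw [Matrix.det_nonsing_inv, hdet, Ring.inverse_one]
  -- Since J₀ = JN, the relation Φ_G = Φ_F(1 + J₀D) is the one required for the weight Z⁻¹ with E =
  -- ND.
  · refine isSynthesisPair_feedback (E := N * D) hF hG hB hZi.continuous (fun t => (hZpos t).inv)
      hFK hst hanti fun t => ?_
    simp only [hZii]
    rw [hX, hJ, Matrix.mul_assoc]

/-- The equation is linear in Z, so Z may be divided by (det Z(0))^{1/m}, which normalizes its
determinant at 0 to 1. -/
theorem isCanonicalCost_of_eq_smul_inv (hAB : DynamicsAssumption A B)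
    (hcost : CostAssumption Q₀ S₀ R₀) (hpair : IsSynthesisPair A B Q₀ S₀ R₀ Ap Am)
    (hK : ∀ t, K t = ((B t)ᵀ * B t)⁻¹ * (B t)ᵀ * (A t - Ap t))
    (hZ : ContDiff ℝ ∞ Z) (hZpos : ∀ t, (Z t).PosDef) (hsol : SolvesReconstructionEq B Ap Am Z)
    (hR : ∀ t, R t = ((Z 0).det ^ (1 / (m : ℝ))) • (Z t)⁻¹) :
    IsCanonicalCost A B K R ∧
      IsSynthesisPair A B (fun t => (K t)ᵀ * R t * K t) (fun t => (K t)ᵀ * R t) R Ap Am := by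
  have hd : 0 < (Z 0).det := (hZpos 0).det_pos
  have hk : 0 < (Z 0).det ^ (1 / (m : ℝ)) := Real.rpow_pos_of_pos hd _
  have hkm : ((Z 0).det ^ (1 / (m : ℝ))) ^ m = (Z 0).det := by
    -- For m = 0 the exponent 1/m is 0 by convention; the identity survives because an empty
    -- determinant is 1.
    rcases Nat.eq_zero_or_pos m with rfl | hm
    · simp [Matrix.det_isEmpty]
    · rw [← Real.rpow_natCast, ← Real.rpow_mul hd.le,
        one_div_mul_cancel (by exact_mod_cast hm.ne'), Real.rpow_one]
  set k := (Z 0).det ^ (1 / (m : ℝ))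
  obtain rfl : R = fun t => (k⁻¹ • Z t)⁻¹ := by
    funext t
    rw [hR]
    refine (Matrix.inv_eq_right_inv ?_).symm
    rw [Matrix.smul_mul, Matrix.mul_smul, smul_smul, inv_mul_cancel₀ hk.ne', one_smul,
      posDef_mul_inv (hZpos t)]
  refine isCanonicalCost_of_solvesReconstructionEq hAB hcost hpair hK (hZ.const_smul _)
    (fun t => (hZpos t).smul (inv_pos.2 hk)) ?_ (hsol.smul _)
  rw [Matrix.det_smul, Fintype.card_fin, inv_pow, hkm, inv_mul_cancel₀ hd.ne']

theorem IsCanonicalCost.optimalSynthesis_eq (hAB : DynamicsAssumption A B)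
    (hcost : CostAssumption Q₀ S₀ R₀) (hpair : IsSynthesisPair A B Q₀ S₀ R₀ Ap Am)
    (hc : IsCanonicalCost A B K R)
    (hpair' : IsSynthesisPair A B (fun t => (K t)ᵀ * R t * K t) (fun t => (K t)ᵀ * R t) R Ap Am) :
    optimalSynthesis A B (feedbackCost K R) = optimalSynthesis A B (quadCost Q₀ S₀ R₀) := by
  have hK := hc.smooth_K.continuous
  have hR := hc.smooth_R.continuous
  rw [feedbackCost_eq_quadCost K R hc.symm_R]
  ext ⟨t₀, t₁, x⟩
  rw [mem_optimalSynthesis_iff_of_pair hAB (by fun_prop) (by fun_prop) hR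
      hc.uniformlyPosDef_R.posDef hpair',
    mem_optimalSynthesis_iff_of_pair hAB hcost.smooth_Q.continuous hcost.smooth_S.continuous
      hcost.smooth_R.continuous hcost.uniformlyPosDef_R.posDef hpair]

/-- The witness is Z = R⁻¹: both Gramians in the residual then coincide and its two terms cancel. As
det R(0) = 1, the scalar factor is 1. -/
theorem IsCanonicalCost.exists_solution_of_optimalSynthesis_eq (hAB : DynamicsAssumption A B)
    (hcost : CostAssumption Q₀ S₀ R₀) (hpair : IsSynthesisPair A B Q₀ S₀ R₀ Ap Am)
    (hc : IsCanonicalCost A B K R)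
    (h : optimalSynthesis A B (feedbackCost K R) = optimalSynthesis A B (quadCost Q₀ S₀ R₀)) :
    (∀ t, K t = ((B t)ᵀ * B t)⁻¹ * (B t)ᵀ * (A t - Ap t)) ∧
      ∃ Z : ℝ → Matrix (Fin m) (Fin m) ℝ, ContDiff ℝ ∞ Z ∧ (∀ t, (Z t).PosDef) ∧
        SolvesReconstructionEq B Ap Am Z ∧
        ∀ t, R t = ((Z 0).det ^ (1 / (m : ℝ))) • (Z t)⁻¹ := by
  have hRpos := hc.uniformlyPosDef_R.posDef
  have hB := hAB.smooth_B.continuous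
  rw [feedbackCost_eq_quadCost K R hc.symm_R] at h
  obtain ⟨hF, E, hE⟩ := eq_feedback_of_optimalSynthesis_eq hAB hcost.smooth_Q.continuous
    hcost.smooth_S.continuous hcost.smooth_R.continuous hcost.uniformlyPosDef_R.posDef hpair
    hc.smooth_K.continuous hc.smooth_R.continuous hRpos hc.stabilizing h
  have hZ : ContDiff ℝ ∞ fun t => (R t)⁻¹ := ContDiff.matInv hc.smooth_R fun t => (hRpos t).isUnit
  have hs : ∀ t, ((R t)⁻¹).IsSymm := fun t => posDef_isSymm (hRpos t).inv
  obtain ⟨⟨P, hP, hAp, hst⟩, ⟨P', hP', hAm, hanti⟩⟩ := hpair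
  have hApc : Continuous Ap := hAp ▸ continuous_closedLoop hAB.smooth_A.continuous hB
    hcost.smooth_S.continuous hcost.smooth_R.continuous hcost.uniformlyPosDef_R.posDef hP.continuous
  have hAmc : Continuous Am := hAm ▸ continuous_closedLoop hAB.smooth_A.continuous hB
    hcost.smooth_S.continuous hcost.smooth_R.continuous hcost.uniformlyPosDef_R.posDef
    hP'.continuous
  have hEs := transpose_eq_of_transitionMatrix_eq hApc hB hZ.continuous hs hst hanti hE
  refine ⟨fun t => ?_, fun t => (R t)⁻¹, hZ, fun t => (hRpos t).inv, fun t => ?_, fun t => ?_⟩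
  · rw [hF, sub_sub_cancel, leftInverse_mul_cancel (hAB.injective_B t)]
  · rw [reconstruction_residual hApc hAmc hB hZ.continuous hZ.continuous hs hEs hE, sub_self,
      Matrix.mul_zero, Matrix.zero_mul]
  · rw [Matrix.det_nonsing_inv, hc.det_R_zero, Ring.inverse_one, Real.one_rpow, one_smul,
      Matrix.nonsing_inv_nonsing_inv _ ((Matrix.isUnit_iff_isUnit_det _).1 (hRpos t).isUnit)]

end Reconstruction

end InverseLQ

end

theorem mainTheorem11 {n m : ℕ}
    (A : ℝ → Matrix (Fin n) (Fin n) ℝ) (B : ℝ → Matrix (Fin n) (Fin m) ℝ)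
    (hAB : InverseLQ.DynamicsAssumption A B)
    (Q₀ : ℝ → Matrix (Fin n) (Fin n) ℝ) (S₀ : ℝ → Matrix (Fin n) (Fin m) ℝ)
    (R₀ : ℝ → Matrix (Fin m) (Fin m) ℝ)
    (hcost : InverseLQ.CostAssumption Q₀ S₀ R₀)
    (Ap Am : ℝ → Matrix (Fin n) (Fin n) ℝ)
    (hpair : InverseLQ.IsSynthesisPair A B Q₀ S₀ R₀ Ap Am)
    (K : ℝ → Matrix (Fin m) (Fin n) ℝ) (R : ℝ → Matrix (Fin m) (Fin m) ℝ) :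
    [ InverseLQ.IsCanonicalCost A B K R ∧
        InverseLQ.optimalSynthesis A B (InverseLQ.feedbackCost K R) =
          InverseLQ.optimalSynthesis A B (InverseLQ.quadCost Q₀ S₀ R₀),
      InverseLQ.IsCanonicalCost A B K R ∧
        InverseLQ.IsSynthesisPair A B (fun t => (K t)ᵀ * R t * K t) (fun t => (K t)ᵀ * R t) R Ap Am,
      (∀ t, K t = ((B t)ᵀ * B t)⁻¹ * (B t)ᵀ * (A t - Ap t)) ∧
        ∃ Z : ℝ → Matrix (Fin m) (Fin m) ℝ,
          ContDiff ℝ ∞ Z ∧ (∀ t, (Z t).PosDef) ∧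
          InverseLQ.SolvesReconstructionEq B Ap Am Z ∧
          ∀ t, R t = ((Z 0).det ^ (1 / (m : ℝ))) • (Z t)⁻¹ ].TFAE := by
  tfae_have 1 → 3 := fun ⟨hc, h⟩ => hc.exists_solution_of_optimalSynthesis_eq hAB hcost hpair h
  tfae_have 3 → 2 := fun ⟨hK, _, hZ, hZpos, hsol, hR⟩ =>
    InverseLQ.isCanonicalCost_of_eq_smul_inv hAB hcost hpair hK hZ hZpos hsol hR
  tfae_have 2 → 1 := fun ⟨hc, h⟩ => ⟨hc, hc.optimalSynthesis_eq hAB hcost hpair h⟩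
  tfae_finish
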